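/- **Theorem 4.4 (Quadruple Law).** Let $({\cal Z},{\cal Y})=({\cal Z}_s,{\cal Y}_s)_{s\ge 0}$ be a (finite-valued) bivariate subordinator, i.e. a two-dimensional process with stationary independent increments, started at $(0,0)$, with right-continuous, coordinatewise non-decreasing paths. Let $q\ge 0$ and let $e(q)$ be a random time independent of $({\cal Z},{\cal Y})$, exponentially distributed with parameter $q$ if $q>0$, and $e(q)=\infty$ if $q=0$. Let ${\rm d}_Z,{\rm d}_Y\ge 0$ be the drifts and $\Pi_{Z,Y}$ the Lévy measure, a measure on $[0,\infty)^2\setminus\{(0,0)\}$ with $\int \min(1,s+x)\,\Pi_{Z,Y}(ds,dx)<\infty$, so that for $a,b\ge 0$ $$q-\log E e^{-a{\cal Z}_1-b{\cal Y}_1}=q+{\rm d}_Z a+{\rm d}_Y b+\int\left(1-e^{-as-bx}\right)\Pi_{Z,Y}(ds,dx).$$ Put $$V_{Z,Y}(t,u)=\int_0^\infty e^{-qs}P({\cal Z}_s\le t,{\cal Y}_s\le u)\,ds ,\qquad T_u=T^{\cal Y}_u=\inf\{s\ge 0:{\cal Y}_s>u\},$$ write $V_{Z,Y}(dt,dw)=\int_0^\infty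 e^{-qs}P({\cal Z}_s\in dt,{\cal Y}_s\in dw)\,ds$, and let $|V_{Z,Y}(dt,u-dy)|$ be the image of the measure $V_{Z,Y}(dt,dw)$ restricted to $w\le u$ under $(t,w)\mapsto(t,u-w)$. Write $\Delta{\cal Z}_{T_u}={\cal Z}_{T_u}-{\cal Z}_{T_u-}$. Then for every $u>0$ the following equality of measures in $(x,y,s,t)$, $x\ge 0$, $0\le y\le u$, $s\ge 0$, $t\ge 0$, holds: $$P\left({\cal Y}_{T_u}-u\in dx,\; u-{\cal Y}_{T_u-}\in dy,\; \Delta {\cal Z}_{T_u}\in ds,\; {\cal Z}_{T_u-}\in dt;\; T_u<e(q)\right)$$ $$={\bf 1}_{\{x>0\}}\,|V_{Z,Y}(dt,u-dy)|\,\Pi_{Z,Y}(ds,dx+y)+{\rm d}_Y\,\frac{\partial_-}{\partial_- u}V_{Z,Y}(dt,u)\,\delta_0(ds,dx,dy),$$ where $\delta_0$ is the point mass at the origin and the last term is absent when ${\rm d}_Y=0$. When ${\rm d}_Y>0$, $V_{Z,Y}(t,v)<\infty$ for all $t,v$, the left derivative $\frac{\partial_-}{\partial_- u}V_{Z,Y}(t,u)$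 of $V_{Z,Y}(t,\cdot)$ at $u$ exists for every $t$, and $\frac{\partial_-}{\partial_- u}V_{Z,Y}(dt,u)$ is the finite measure on $[0,\infty)$ whose distribution function is $t\mapsto\frac{\partial_-}{\partial_- u}V_{Z,Y}(t,u)$. -/

import Mathlib

open MeasureTheory ProbabilityTheory Set
open scoped ENNReal NNReal

/-- `(Z, Y)` is a (true, i.e. unkilled) bivariate subordinator: a two-dimensional process
indexed by `[0, ∞)`, started at `0`, with independent and stationary increments, whose paths are
almost surely right-continuous and non-decreasing in each coordinate (left limits are then
automatic). -/
structure IsBivariateSubordinator {Ω : Type*} [MeasurableSpace Ω] (P : Measure Ω)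
    (Z Y : ℝ≥0 → Ω → ℝ) : Prop where
  measurable_fst : ∀ s, Measurable (Z s)
  measurable_snd : ∀ s, Measurable (Y s)
  zero : ∀ᵐ ω ∂P, Z 0 ω = 0 ∧ Y 0 ω = 0
  indep : HasIndepIncrements (fun s ω => (Z s ω, Y s ω)) P
  stationary : ∀ r s : ℝ≥0,
    P.map (fun ω => (Z (r + s) ω - Z r ω, Y (r + s) ω - Y r ω)) = P.map (fun ω => (Z s ω, Y s ω))
  monotone : ∀ᵐ ω ∂P, Monotone (fun s => Z s ω) ∧ Monotone (fun s => Y s ω)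
  rightCont : ∀ᵐ ω ∂P, ∀ s : ℝ≥0,
    ContinuousWithinAt (fun r => Z r ω) (Ici s) s ∧ ContinuousWithinAt (fun r => Y r ω) (Ici s) s

/-- `e` is exponentially distributed with parameter `q`: `P(e > s) = exp (-q s)` for all `s ≥ 0`.
When `q = 0` this says `e = ∞` almost surely (no killing). -/
def IsExponentialTime {Ω : Type*} [MeasurableSpace Ω] (P : Measure Ω) (q : ℝ) (e : Ω → ℝ≥0∞) :
    Prop :=
  Measurable e ∧ ∀ s : ℝ≥0, P {ω | (s : ℝ≥0∞) < e ω} = ENNReal.ofReal (Real.exp (-(q * s)))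

/-- The Laplace exponent `κ(a, b) = q - log E exp (-a Z₁ - b Y₁)` of the subordinator `(Z, Y)`
killed at rate `q`. -/
noncomputable def killedLaplaceExponent {Ω : Type*} [MeasurableSpace Ω] (P : Measure Ω)
    (Z Y : ℝ≥0 → Ω → ℝ) (q a b : ℝ) : ℝ :=
  q - Real.log (∫ ω, Real.exp (-(a * Z 1 ω) - b * Y 1 ω) ∂P)

/-- The subordinator `(Z, Y)` killed at rate `q` has drift `(dZ, dY)` and Lévy measure `ν`
(a measure on `[0, ∞)² \ {0}` integrating `min (1, s + x)`), these being the (unique) data for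
which `κ(a, b) = q + dZ a + dY b + ∫ (1 - exp (-a s - b x)) ν(ds, dx)`. -/
structure HasDriftAndLevyMeasure {Ω : Type*} [MeasurableSpace Ω] (P : Measure Ω)
    (Z Y : ℝ≥0 → Ω → ℝ) (q dZ dY : ℝ) (ν : Measure (ℝ × ℝ)) : Prop where
  drift_fst_nonneg : 0 ≤ dZ
  drift_snd_nonneg : 0 ≤ dY
  support : ν {r | ¬ (0 ≤ r.1 ∧ 0 ≤ r.2 ∧ r ≠ (0, 0))} = 0
  integrable : ∫⁻ r, ENNReal.ofReal (min 1 (r.1 + r.2)) ∂ν < ∞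
  exponent : ∀ a b : ℝ, 0 ≤ a → 0 ≤ b →
    killedLaplaceExponent P Z Y q a b =
      q + dZ * a + dY * b + ∫ r, (1 - Real.exp (-(a * r.1) - b * r.2)) ∂ν

/-- The first passage time `T_u = inf {s ≥ 0 : Y_s > u}`, equal to `∞` if `Y` never exceeds `u`. -/
noncomputable def passageTime {Ω : Type*} (Y : ℝ≥0 → Ω → ℝ) (u : ℝ) (ω : Ω) : ℝ≥0∞ :=
  ⨅ (s : ℝ≥0) (_ : u < Y s ω), (s : ℝ≥0∞)

/-- The value `X_T` of the process `X` at the time `T` (used only where `T < ∞`). -/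
noncomputable def valueAt {Ω : Type*} (X : ℝ≥0 → Ω → ℝ) (T : Ω → ℝ≥0∞) (ω : Ω) : ℝ :=
  X (T ω).toNNReal ω

/-- The left limit `X_{T-}` of the process `X` at the time `T` (used only where `0 < T < ∞`). -/
noncomputable def leftValueAt {Ω : Type*} (X : ℝ≥0 → Ω → ℝ) (T : Ω → ℝ≥0∞) (ω : Ω) : ℝ :=
  Function.leftLim (fun s => X s ω) (T ω).toNNReal

/-- The quadruple: overshoot `Y_T - u`, undershoot `u - Y_{T-}`, jump `ΔZ_T = Z_T - Z_{T-}`, and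
`Z_{T-}`, where `T = T_u` is the first passage time of `Y` above `u`. -/
noncomputable def passageQuadruple {Ω : Type*} (Z Y : ℝ≥0 → Ω → ℝ) (u : ℝ) (ω : Ω) :
    ℝ × ℝ × ℝ × ℝ :=
  (valueAt Y (passageTime Y u) ω - u,
   u - leftValueAt Y (passageTime Y u) ω,
   valueAt Z (passageTime Y u) ω - leftValueAt Z (passageTime Y u) ω,
   leftValueAt Z (passageTime Y u) ω)

/-- The renewal function `V(t, u) = ∫₀^∞ e^{-qs} P(Z_s ≤ t, Y_s ≤ u) ds`. -/
noncomputable def renewalFunction {Ω : Type*} [MeasurableSpace Ω] (P : Measure Ω)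
    (Z Y : ℝ≥0 → Ω → ℝ) (q t u : ℝ) : ℝ≥0∞ :=
  ∫⁻ s : ℝ in Ioi 0, ENNReal.ofReal (Real.exp (-(q * s))) *
    P {ω | Z s.toNNReal ω ≤ t ∧ Y s.toNNReal ω ≤ u}

/-- The renewal measure `V(dt, dy) = ∫₀^∞ e^{-qs} P(Z_s ∈ dt, Y_s ∈ dy) ds`, whose distribution
function is the renewal function. -/
noncomputable def renewalMeasure {Ω : Type*} [MeasurableSpace Ω] (P : Measure Ω)
    (Z Y : ℝ≥0 → Ω → ℝ) (q : ℝ) : Measure (ℝ × ℝ) :=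
  Measure.bind
    ((volume.restrict (Ioi (0 : ℝ))).withDensity fun s => ENNReal.ofReal (Real.exp (-(q * s))))
    (fun s => P.map (fun ω => (Z s.toNNReal ω, Y s.toNNReal ω)))

/-- The distribution function of the renewal measure is the renewal function. -/
theorem renewalMeasure_Iic {Ω : Type*} [MeasurableSpace Ω] (P : Measure Ω)
    [IsProbabilityMeasure P] (Z Y : ℝ≥0 → Ω → ℝ) (h : IsBivariateSubordinator P Z Y)
    (q t u : ℝ) :
    renewalMeasure P Z Y q (Iic t ×ˢ Iic u) = renewalFunction P Z Y q t u := by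
  have hXm : ∀ s, Measurable (fun ω => (Z s ω, Y s ω)) := fun s =>
    (h.measurable_fst s).prodMk (h.measurable_snd s)
  have hval : ∀ s a b, P.map (fun ω => (Z s ω, Y s ω)) (Iic a ×ˢ Iic b)
      = P {ω | Z s ω ≤ a ∧ Y s ω ≤ b} := by
    intro s a b
    rw [Measure.map_apply (hXm s) (measurableSet_Iic.prod measurableSet_Iic)]
    rfl
  have hanti : ∀ a b, Antitone (fun s => P {ω | Z s ω ≤ a ∧ Y s ω ≤ b}) := by
    intro a b r s hrs
    apply measure_mono_ae
    filter_upwards [h.monotone] with ω hω hs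
    exact ⟨(hω.1 hrs).trans hs.1, (hω.2 hrs).trans hs.2⟩
  have hmeas : Measurable (fun s => P.map (fun ω => (Z s ω, Y s ω))) := by
    have : ∀ s, IsProbabilityMeasure (P.map (fun ω => (Z s ω, Y s ω))) := fun s =>
      Measure.isProbabilityMeasure_map (hXm s).aemeasurable
    refine Measurable.measure_of_isPiSystem_of_isProbabilityMeasure
      (S := image2 (· ×ˢ ·) (range Iic) (range Iic)) ?_ ?_ ?_
    · have hs : IsCountablySpanning (range (Iic : ℝ → Set ℝ)) := by
        refine ⟨fun n : ℕ => Iic (n : ℝ), fun n => ⟨_, rfl⟩, ?_⟩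
        ext x
        simpa using exists_nat_ge x
      have := generateFrom_prod_eq hs hs
      rw [← borel_eq_generateFrom_Iic, ← BorelSpace.measurable_eq] at this
      exact this.symm ▸ rfl
    · exact isPiSystem_Iic.prod isPiSystem_Iic
    · rintro _ ⟨_, ⟨a, rfl⟩, _, ⟨b, rfl⟩, rfl⟩
      simp only [hval]
      exact (hanti a b).measurable
  have hmeasR : Measurable (fun s : ℝ => P.map (fun ω => (Z s.toNNReal ω, Y s.toNNReal ω))) :=
    hmeas.comp measurable_real_toNNReal
  rw [renewalMeasure, Measure.bind_apply (measurableSet_Iic.prod measurableSet_Iic)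
    hmeasR.aemeasurable, lintegral_withDensity_eq_lintegral_mul₀ (by fun_prop)]
  · simp only [hval, renewalFunction, Pi.mul_apply]
  · simp only [hval]
    exact ((hanti t u).measurable.comp measurable_real_toNNReal).aemeasurable

/-- The measure `|V(dt, u - dy)|` on `0 ≤ y ≤ u`: the image of the renewal measure restricted to
`{(t, w) : w ≤ u}` under `(t, w) ↦ (t, u - w)`. -/
noncomputable def reflectedRenewalMeasure {Ω : Type*} [MeasurableSpace Ω] (P : Measure Ω)
    (Z Y : ℝ≥0 → Ω → ℝ) (q u : ℝ) : Measure (ℝ × ℝ) :=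
  ((renewalMeasure P Z Y q).restrict {p | p.2 ≤ u}).map (fun p => (p.1, u - p.2))

/-- The measure `ν(ds, dx + y)` in the variables `(s, x)`, restricted to `x > 0`. -/
noncomputable def shiftedLevyMeasure (ν : Measure (ℝ × ℝ)) (y : ℝ) : Measure (ℝ × ℝ) :=
  (ν.map (fun r => (r.1, r.2 - y))).restrict {r | 0 < r.2}

/-- The mass that `1_{x > 0} |V(dt, u - dy)| ν(ds, dx + y)` gives to a set `B` of quadruples
`(x, y, s, t)`. -/
noncomputable def jumpTerm {Ω : Type*} [MeasurableSpace Ω] (P : Measure Ω)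
    (Z Y : ℝ≥0 → Ω → ℝ) (q : ℝ) (ν : Measure (ℝ × ℝ)) (u : ℝ) (B : Set (ℝ × ℝ × ℝ × ℝ)) : ℝ≥0∞ :=
  ∫⁻ p, shiftedLevyMeasure ν p.2 {r | (r.2, p.2, r.1, p.1) ∈ B}
    ∂(reflectedRenewalMeasure P Z Y q u)

/-- `μ` is the measure `(∂₋/∂₋u) V(dt, u)`: the renewal function is finite, for every `t` the
function `V(t, ·)` has a left derivative at `u`, and `μ` is the finite measure whose distribution
function is `t ↦ (∂₋/∂₋u) V(t, u)`. (Both sides vanish for `t < 0`.) -/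
structure IsLeftDerivRenewal {Ω : Type*} [MeasurableSpace Ω] (P : Measure Ω)
    (Z Y : ℝ≥0 → Ω → ℝ) (q u : ℝ) (μ : Measure ℝ) : Prop where
  renewal_lt_top : ∀ t v : ℝ, renewalFunction P Z Y q t v < ∞
  finite : IsFiniteMeasure μ
  leftDeriv : ∀ t : ℝ,
    HasDerivWithinAt (fun v => (renewalFunction P Z Y q t v).toReal) (μ (Iic t)).toReal (Iic u) u

/-!
Write `X = (Z, Y)`, `T` for the first passage time of `Y` over a level `v`, `V` for the renewal
measure of `X` killed at rate `q`, and `ψ` for the Laplace exponent of `X`. The independent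
exponential time enters only through the weight `e^{-qT}` on `T < ∞` (`measure_passage_lt`), so
the object of study is the weighted law of `(X_{T-}, ΔX_T)`.

*The level integrated out.* Observe `X` on a time grid of mesh `h`. By stationary independent
increments, the joint Laplace transform, in the level and in the position before and increment
across the grid cell in which the level is passed, is a geometric series. As `h → 0` it converges
to `(ψ(b₁, b₂ + l) - ψ(b₁, b₂)) / (l (q + ψ(a₁, a₂ + l)))`. Uniqueness of Laplace transforms
(`ext_of_laplace`) turns this into the identity `lintegral_passWeight`: as a measure in level,
position and jump, `dv E[e^{-qT}; X_{T-} ∈ dp, ΔX_T ∈ dr]` is the sum of `V(dp) ν(dr) dv` on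
`p₂ ≤ v < p₂ + r₂` and of `d_Y V(dp)` carried by `v = p₂`, `r = 0`.

*The jump term for a fixed level.* All levels in the gap left by a jump of `Y` are passed by that
jump, hence share their passage data. Averaging over the gap turns the identity for almost every
level into one for every level (`lintegral_passJump_eq`). Consequently the law of the quadruple is
the jump term plus the contribution of the paths with `Y_T = u` (`measure_passage_eq`).

*The paths with `Y_T = u`.* If `P(Y_1 = 0) > 0`, then by the Markov property `Y` would remain at
`u` for a short time with probability close to one, given `Y_T = u`; at a first passage this is
impossible (`ae_passValue_ne_of_flat`). Otherwise the paths of `Y` are strictly increasing and `V`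
does not charge levels, so that `Y` neither lands on `u` nor leaves from `u` by a jump. Applied to
the process with exchanged coordinates, the same bound shows that `Z` does not jump at that time
either (`ae_creep`): the quadruple is `(0, 0, 0, Z_{T-})`.

*No drift.* Here `p(v)`, the probability that `v` is in the closed range of `Y`, vanishes for
almost every `v`, by `lintegral_passWeight` with `d_Y = 0`. That it vanishes for every `v > 0`
(`hitProb_eq_zero`) follows from the regenerative identity `P(a and a + b are hit) = p(a) p(b)`:
if `p(u) > 0` then `p` is close to `1` at arbitrarily small levels (`exists_hitProb_gt`); if
`p(x)` is close to `1`, then below `x` the function `p` avoids an interval of values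
(`hitProb_gap`), so it remains large along the multiples of a small level; upper semicontinuity
makes `p` large on all of `(0, x)`.

*Positive drift.* Let `c_t(v) = E[e^{-qT}; Z_{T-} ≤ t, Y_T = v]`. By `lintegral_passWeight`,
`d_Y V(t, u) = ∫₀^u c_t(v) dv` (`lintegral_creepMass`). The mass `E[e^{-qT}; Z_{T-} ≤ t]` is
left-continuous in the level, pathwise, and the mass of the passages by a jump is continuous,
because `V` has density at most `1 / d_Y` in the second coordinate. Hence their difference `c_t` is
left-continuous (`tendsto_creepMass`), and `c_t(u) / d_Y` is the left derivative of `V(t, ·)` at `u`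
(`hasDerivWithinAt_renewal`).
-/

namespace QuadrupleLaw

open Filter Topology

/-! ### First passage of a monotone path -/

/-- The first time `inf {s : u < y s}` at which the path `y` exceeds the level `u`;
`passageTime Y u ω` is its value on the path of `Y` at `ω`. -/
noncomputable def firstPassage (y : ℝ≥0 → ℝ) (u : ℝ) : ℝ≥0∞ :=
  ⨅ (s : ℝ≥0) (_ : u < y s), (s : ℝ≥0∞)

section FirstPassage

variable {y : ℝ≥0 → ℝ} {u v : ℝ}

lemma firstPassage_le {s : ℝ≥0} (h : u < y s) : firstPassage y u ≤ s :=
  iInf₂_le s h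

lemma le_of_lt_firstPassage {s : ℝ≥0} (h : (s : ℝ≥0∞) < firstPassage y u) : y s ≤ u := by
  by_contra! hc
  exact absurd (firstPassage_le hc) (not_le.2 h)

lemma firstPassage_ne_top_iff : firstPassage y u ≠ ∞ ↔ ∃ s, u < y s := by
  constructor
  · intro h
    by_contra! hc
    apply h
    simp only [firstPassage, iInf_eq_top]
    intro s hs
    exact absurd hs (not_lt.2 (hc s))
  · rintro ⟨s, hs⟩
    exact ((firstPassage_le hs).trans_lt ENNReal.coe_lt_top).ne

lemma lt_of_firstPassage_lt (hy : Monotone y) {s : ℝ≥0} (h : firstPassage y u < s) : u < y s := by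
  simp only [firstPassage, iInf_lt_iff] at h
  obtain ⟨r, hr, hrs⟩ := h
  exact hr.trans_le (hy (by exact_mod_cast hrs.le))

lemma firstPassage_eq_coe {t : ℝ≥0} (h₁ : ∀ s < t, y s ≤ u) (h₂ : ∀ s, t < s → u < y s) :
    firstPassage y u = t := by
  apply le_antisymm
  · refine le_of_forall_gt_imp_ge_of_dense fun a ha => ?_
    obtain ⟨r, hr₁, hr₂⟩ := ENNReal.lt_iff_exists_nnreal_btwn.1 ha
    exact (firstPassage_le (h₂ r (by exact_mod_cast hr₁))).trans hr₂.le
  · refine le_iInf₂ fun s hs => ?_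
    by_contra! hc
    exact absurd hs (not_lt.2 (h₁ s (by exact_mod_cast hc)))

lemma firstPassage_mono (huv : u ≤ v) : firstPassage y u ≤ firstPassage y v :=
  le_iInf₂ fun _ hs => firstPassage_le (huv.trans_lt hs)

end FirstPassage

/-- A path of a bivariate subordinator outside a null set: both coordinates start at `0`, are
non-decreasing and right-continuous, and neither jumps at a positive time of a grid
`{k / (n + 1) : k ∈ ℕ}`. -/
structure IsRegularPath (w : ℝ≥0 → ℝ × ℝ) : Prop where
  zero : w 0 = 0
  mono_fst : Monotone fun s => (w s).1
  mono_snd : Monotone fun s => (w s).2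
  rightCont : ∀ s, ContinuousWithinAt w (Ici s) s
  cont_grid : ∀ n k : ℕ, ContinuousAt w ((k + 1 : ℕ) * ((n : ℝ≥0) + 1)⁻¹)

/-- The first passage time of the second coordinate, made real by sending `∞` to `0`. -/
noncomputable def passTime (w : ℝ≥0 → ℝ × ℝ) (v : ℝ) : ℝ≥0 :=
  (firstPassage (fun s => (w s).2) v).toNNReal

/-- The value of the path just before the first passage of the second coordinate over `v`. -/
noncomputable def prePassage (w : ℝ≥0 → ℝ × ℝ) (v : ℝ) : ℝ × ℝ :=
  (Function.leftLim (fun s => (w s).1) (passTime w v),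
   Function.leftLim (fun s => (w s).2) (passTime w v))

/-- The jump of the path at the first passage of the second coordinate over `v`. -/
noncomputable def passJump (w : ℝ≥0 → ℝ × ℝ) (v : ℝ) : ℝ × ℝ :=
  w (passTime w v) - prePassage w v

/-- The first passage over `v` happens at a finite time. -/
def Passes (w : ℝ≥0 → ℝ × ℝ) (v : ℝ) : Prop := ∃ s, v < (w s).2

instance nhdsLT_neBot_of_pos {a : ℝ≥0} [h : Fact (0 < a)] : (𝓝[<] a).NeBot :=
  nhdsLT_neBot_of_exists_lt ⟨0, h.out⟩

lemma Passes.coe_passTime {w : ℝ≥0 → ℝ × ℝ} {v : ℝ} (h : Passes w v) :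
    (passTime w v : ℝ≥0∞) = firstPassage (fun s => (w s).2) v :=
  ENNReal.coe_toNNReal (firstPassage_ne_top_iff.2 h)

lemma Passes.mono {w : ℝ≥0 → ℝ × ℝ} {u v : ℝ} (h : Passes w v) (huv : u ≤ v) : Passes w u :=
  h.imp fun _ hs => huv.trans_lt hs

namespace IsRegularPath

variable {w : ℝ≥0 → ℝ × ℝ} {u v : ℝ}

lemma le_of_lt_passTime (_hw : IsRegularPath w) (h : Passes w v) {s : ℝ≥0} (hs : s < passTime w v) :
    (w s).2 ≤ v :=
  le_of_lt_firstPassage (y := fun s => (w s).2) (by rw [← h.coe_passTime]; exact_mod_cast hs)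

lemma lt_of_passTime_lt (hw : IsRegularPath w) (h : Passes w v) {s : ℝ≥0} (hs : passTime w v < s) :
    v < (w s).2 :=
  lt_of_firstPassage_lt hw.mono_snd (by rw [← h.coe_passTime]; exact_mod_cast hs)

lemma passTime_le (_hw : IsRegularPath w) (h : Passes w v) {s : ℝ≥0} (hs : v < (w s).2) :
    passTime w v ≤ s := by
  have := firstPassage_le (y := fun s => (w s).2) hs
  rw [← h.coe_passTime] at this
  exact_mod_cast this

lemma le_passTime (hw : IsRegularPath w) (h : Passes w v) {s : ℝ≥0} (hs : (w s).2 ≤ v) :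
    s ≤ passTime w v := by
  by_contra! hc
  exact absurd (hw.lt_of_passTime_lt h hc) (not_lt.2 hs)

lemma tendsto_snd (hw : IsRegularPath w) (s : ℝ≥0) :
    ContinuousWithinAt (fun s => (w s).2) (Ici s) s := (hw.rightCont s).snd

lemma nonneg_fst (hw : IsRegularPath w) (s : ℝ≥0) : 0 ≤ (w s).1 := by
  have := hw.mono_fst (zero_le (a := s))
  simpa [hw.zero] using this

lemma nonneg_snd (hw : IsRegularPath w) (s : ℝ≥0) : 0 ≤ (w s).2 := by
  have := hw.mono_snd (zero_le (a := s))
  simpa [hw.zero] using this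

lemma le_passValue (hw : IsRegularPath w) (h : Passes w v) : v ≤ (w (passTime w v)).2 := by
  have h1 := (hw.tendsto_snd (passTime w v)).tendsto.mono_left
    (nhdsWithin_mono _ (Ioi_subset_Ici_self))
  refine ge_of_tendsto h1 ?_
  filter_upwards [self_mem_nhdsWithin] with s hs
  exact (hw.lt_of_passTime_lt h hs).le

lemma passTime_pos (hw : IsRegularPath w) (hv : 0 < v) (h : Passes w v) : 0 < passTime w v := by
  by_contra! hc
  have h0 : passTime w v = 0 := le_antisymm hc zero_le
  have := hw.le_passValue h
  rw [h0, hw.zero] at this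
  exact absurd this (not_le.2 (by simpa using hv))

lemma prePassage_snd_le (hw : IsRegularPath w) (hv : 0 ≤ v) (h : Passes w v) :
    (prePassage w v).2 ≤ v := by
  rcases eq_or_lt_of_le (zero_le (a := passTime w v)) with h0 | h0
  · have : (prePassage w v).2 = 0 := by
      simp only [prePassage]
      rw [← h0, leftLim_eq_of_isBot (fun _ => zero_le), hw.zero]; rfl
    rw [this]; exact hv
  · have : Fact (0 < passTime w v) := ⟨h0⟩
    refine le_of_tendsto (hw.mono_snd.tendsto_leftLim (passTime w v)) ?_
    filter_upwards [self_mem_nhdsWithin] with s hs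
    exact hw.le_of_lt_passTime h hs

lemma prePassage_fst_nonneg (hw : IsRegularPath w) : 0 ≤ (prePassage w v).1 := by
  rcases eq_or_lt_of_le (zero_le (a := passTime w v)) with h0 | h0
  · simp only [prePassage]
    rw [← h0, leftLim_eq_of_isBot (fun _ => zero_le), hw.zero]; rfl
  · have := hw.mono_fst.le_leftLim h0
    exact (hw.nonneg_fst 0).trans this

lemma prePassage_snd_nonneg (hw : IsRegularPath w) : 0 ≤ (prePassage w v).2 := by
  rcases eq_or_lt_of_le (zero_le (a := passTime w v)) with h0 | h0
  · simp only [prePassage]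
    rw [← h0, leftLim_eq_of_isBot (fun _ => zero_le), hw.zero]; rfl
  · have := hw.mono_snd.le_leftLim h0
    exact (hw.nonneg_snd 0).trans this

lemma passJump_fst_nonneg (hw : IsRegularPath w) : 0 ≤ (passJump w v).1 := by
  simp only [passJump, Prod.fst_sub, sub_nonneg]
  exact hw.mono_fst.leftLim_le le_rfl

lemma passJump_snd_nonneg (hw : IsRegularPath w) : 0 ≤ (passJump w v).2 := by
  simp only [passJump, Prod.snd_sub, sub_nonneg]
  exact hw.mono_snd.leftLim_le le_rfl

lemma prePassage_add_passJump (w : ℝ≥0 → ℝ × ℝ) (v : ℝ) :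
    prePassage w v + passJump w v = w (passTime w v) := by
  simp [passJump]

lemma le_prePassage_add_passJump_snd (hw : IsRegularPath w) (h : Passes w v) :
    v ≤ (prePassage w v).2 + (passJump w v).2 := by
  rw [← Prod.snd_add, prePassage_add_passJump]
  exact hw.le_passValue h

/-- All levels in the gap `[y(T-), y(T))` left by a jump are first exceeded at that jump. -/
lemma passTime_eq_of_mem_gap (hw : IsRegularPath w) {t : ℝ≥0}
    (h₁ : Function.leftLim (fun s => (w s).2) t ≤ v) (h₂ : v < (w t).2) :
    Passes w v ∧ passTime w v = t := by
  refine ⟨⟨t, h₂⟩, ?_⟩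
  have : firstPassage (fun s => (w s).2) v = t := by
    refine firstPassage_eq_coe (fun s hs => ?_) (fun s hs => ?_)
    · exact (hw.mono_snd.le_leftLim hs).trans h₁
    · exact h₂.trans_le (hw.mono_snd hs.le)
  rw [passTime, this, ENNReal.toNNReal_coe]

end IsRegularPath

/-! ### Approximation along time grids -/

open Classical in
/-- The index `k` of the first grid cell `[k h, (k + 1) h]` at whose right end the path exceeds
`v`, and `0` if there is none. -/
noncomputable def passCell (h : ℝ≥0) (w : ℝ≥0 → ℝ × ℝ) (v : ℝ) : ℕ :=
  Nat.find (p := fun k => v < (w ((k + 1 : ℕ) * h)).2 ∨ ∀ j : ℕ, ¬ v < (w ((j + 1 : ℕ) * h)).2)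
    (by
      by_cases hc : ∃ j : ℕ, v < (w ((j + 1 : ℕ) * h)).2
      · exact ⟨hc.choose, Or.inl hc.choose_spec⟩
      · exact ⟨0, Or.inr (by simpa using hc)⟩)

lemma measurable_passCell (h : ℝ≥0) :
    Measurable fun p : ℝ × (ℝ≥0 → ℝ × ℝ) => passCell h p.2 p.1 := by
  classical
  have key : ∀ k : ℕ, MeasurableSet
      {p : ℝ × (ℝ≥0 → ℝ × ℝ) | p.1 < (p.2 ((k + 1 : ℕ) * h)).2} := fun k =>
    measurableSet_lt measurable_fst (measurable_snd.eval.snd)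
  refine measurable_find _ fun k => ?_
  refine (key k).union ?_
  have : {p : ℝ × (ℝ≥0 → ℝ × ℝ) | ∀ j : ℕ, ¬ p.1 < (p.2 ((j + 1 : ℕ) * h)).2} =
      ⋂ j : ℕ, {p : ℝ × (ℝ≥0 → ℝ × ℝ) | p.1 < (p.2 ((j + 1 : ℕ) * h)).2}ᶜ := by
    ext p; simp
  change MeasurableSet {p : ℝ × (ℝ≥0 → ℝ × ℝ) | ∀ j : ℕ, ¬ p.1 < (p.2 ((j + 1 : ℕ) * h)).2}
  rw [this]
  exact MeasurableSet.iInter fun j => (key j).compl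

/-- The mesh `1 / (n + 1)`. -/
noncomputable def mesh (n : ℕ) : ℝ≥0 := ((n : ℝ≥0) + 1)⁻¹

lemma mesh_pos (n : ℕ) : 0 < mesh n := by unfold mesh; positivity

lemma tendsto_mesh : Tendsto mesh atTop (𝓝 0) := by
  have := tendsto_one_div_add_atTop_nhds_zero_nat (𝕜 := ℝ)
  rw [← NNReal.tendsto_coe]
  simpa [mesh] using this

section Cell

variable {w : ℝ≥0 → ℝ × ℝ} {v : ℝ} {h : ℝ≥0}

lemma passes_iff_exists_nat (hw : IsRegularPath w) (hh : 0 < h) :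
    Passes w v ↔ ∃ j : ℕ, v < (w ((j + 1 : ℕ) * h)).2 := by
  constructor
  · rintro ⟨s, hs⟩
    obtain ⟨n, hn⟩ := exists_nat_ge (s / h)
    refine ⟨n, hs.trans_le (hw.mono_snd ?_)⟩
    rw [div_le_iff₀ hh] at hn
    refine hn.trans ?_
    gcongr
    simp
  · rintro ⟨j, hj⟩
    exact ⟨_, hj⟩

lemma lt_of_passCell (hw : IsRegularPath w) (hh : 0 < h) (hp : Passes w v) :
    v < (w ((passCell h w v + 1 : ℕ) * h)).2 := by
  classical
  rw [passes_iff_exists_nat hw hh] at hp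
  have := Nat.find_spec (p := fun k => v < (w ((k + 1 : ℕ) * h)).2 ∨
    ∀ j : ℕ, ¬ v < (w ((j + 1 : ℕ) * h)).2) ⟨hp.choose, Or.inl hp.choose_spec⟩
  rcases this with h1 | h1
  · unfold passCell; convert h1
  · exact absurd hp.choose_spec (h1 _)

lemma passCell_le (hw : IsRegularPath w) (hv : 0 ≤ v) :
    (w ((passCell h w v : ℕ) * h)).2 ≤ v := by
  classical
  by_cases h0 : passCell h w v = 0
  · rw [h0]; simpa [hw.zero] using hv
  · obtain ⟨k, hk⟩ := Nat.exists_eq_succ_of_ne_zero h0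
    have := Nat.find_min (p := fun k => v < (w ((k + 1 : ℕ) * h)).2 ∨
      ∀ j : ℕ, ¬ v < (w ((j + 1 : ℕ) * h)).2) (m := k) (by
        by_cases hc : ∃ j : ℕ, v < (w ((j + 1 : ℕ) * h)).2
        · exact ⟨hc.choose, Or.inl hc.choose_spec⟩
        · exact ⟨0, Or.inr (by simpa using hc)⟩) (by
        have : k < passCell h w v := by omega
        unfold passCell at this; convert this)
    push Not at this
    rw [hk]
    exact this.1

lemma passCell_eq_zero (hw : IsRegularPath w) (hh : 0 < h) (hp : ¬ Passes w v) :
    passCell h w v = 0 := by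
  classical
  rw [passes_iff_exists_nat hw hh] at hp
  push Not at hp
  unfold passCell
  rw [Nat.find_eq_zero]
  exact Or.inr fun j => not_lt.2 (hp j)

lemma passCell_eq (hw : IsRegularPath w) (hh : 0 < h) (hv : 0 ≤ v) {k : ℕ}
    (h₁ : (w (k * h)).2 ≤ v) (h₂ : v < (w ((k + 1 : ℕ) * h)).2) : passCell h w v = k := by
  have hp : Passes w v := ⟨_, h₂⟩
  apply le_antisymm
  · by_contra! hc
    have : (w ((k + 1 : ℕ) * h)).2 ≤ (w ((passCell h w v : ℕ) * h)).2 :=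
      hw.mono_snd (by gcongr; exact hc)
    exact absurd (h₂.trans_le this) (not_lt.2 (passCell_le hw hv))
  · by_contra! hc
    have : (w ((passCell h w v + 1 : ℕ) * h)).2 ≤ (w (k * h)).2 :=
      hw.mono_snd (by gcongr; exact hc)
    exact absurd ((lt_of_passCell hw hh hp).trans_le this) (not_lt.2 h₁)

lemma passCell_mul_le_passTime (hw : IsRegularPath w) (hv : 0 ≤ v) (hp : Passes w v) :
    (passCell h w v : ℕ) * h ≤ passTime w v :=
  hw.le_passTime hp (passCell_le hw hv)

lemma passTime_le_passCell (hw : IsRegularPath w) (hh : 0 < h) (hp : Passes w v) :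
    passTime w v ≤ (passCell h w v + 1 : ℕ) * h :=
  hw.passTime_le hp (lt_of_passCell hw hh hp)

lemma tendsto_passCell_left (hw : IsRegularPath w) (hv : 0 ≤ v) (hp : Passes w v) :
    Tendsto (fun n => (passCell (mesh n) w v : ℕ) * mesh n) atTop (𝓝 (passTime w v)) := by
  have h1 : Tendsto (fun n => passTime w v - mesh n) atTop (𝓝 (passTime w v)) := by
    simpa using tendsto_const_nhds.sub tendsto_mesh
  refine tendsto_of_tendsto_of_tendsto_of_le_of_le h1 tendsto_const_nhds (fun n => ?_)
    (fun n => passCell_mul_le_passTime hw hv hp)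
  have := passTime_le_passCell hw (mesh_pos n) hp
  simp only [tsub_le_iff_right]
  refine this.trans (le_of_eq ?_)
  push_cast; ring

lemma tendsto_passCell_right (hw : IsRegularPath w) (hv : 0 ≤ v) (hp : Passes w v) :
    Tendsto (fun n => (passCell (mesh n) w v + 1 : ℕ) * mesh n) atTop (𝓝 (passTime w v)) := by
  have := (tendsto_passCell_left hw hv hp).add tendsto_mesh
  simp only [add_zero] at this
  refine this.congr fun n => ?_
  push_cast; ring

lemma tendsto_eval_passCell_right (hw : IsRegularPath w) (hv : 0 ≤ v) (hp : Passes w v) :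
    Tendsto (fun n => w ((passCell (mesh n) w v + 1 : ℕ) * mesh n)) atTop
      (𝓝 (w (passTime w v))) := by
  refine (hw.rightCont (passTime w v)).tendsto.comp
    (tendsto_nhdsWithin_iff.2 ⟨tendsto_passCell_right hw hv hp, ?_⟩)
  exact Eventually.of_forall fun n => passTime_le_passCell hw (mesh_pos n) hp

lemma tendsto_eval_passCell_left_aux (hw : IsRegularPath w) (hv : 0 ≤ v) (hp : Passes w v)
    {f : ℝ≥0 → ℝ} (hf : Monotone f)
    (hfc : ∀ s, ContinuousAt w s → ContinuousAt f s) :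
    Tendsto (fun n => f ((passCell (mesh n) w v : ℕ) * mesh n)) atTop
      (𝓝 (Function.leftLim f (passTime w v))) := by
  by_cases hc : ∃ n, (passCell (mesh n) w v : ℕ) * mesh n = passTime w v
  · obtain ⟨n, hn⟩ := hc
    rcases Nat.eq_zero_or_pos (passCell (mesh n) w v) with h0 | h0
    · have ht : passTime w v = 0 := by rw [← hn, h0]; simp
      have : ∀ m, (passCell (mesh m) w v : ℕ) * mesh m = 0 := fun m =>
        le_antisymm (ht ▸ passCell_mul_le_passTime hw hv hp) zero_le
      simp only [this, ht]
      rw [leftLim_eq_of_isBot (fun _ => zero_le)]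
      exact tendsto_const_nhds
    · obtain ⟨k, hk⟩ := Nat.exists_eq_succ_of_ne_zero h0.ne'
      have hcont : ContinuousAt f (passTime w v) := by
        have := hw.cont_grid n k
        rw [← hn, hk]
        exact hfc _ this
      rw [hcont.continuousWithinAt.leftLim_eq]
      exact hcont.tendsto.comp (tendsto_passCell_left hw hv hp)
  · push Not at hc
    have hlt : ∀ n, (passCell (mesh n) w v : ℕ) * mesh n < passTime w v := fun n =>
      lt_of_le_of_ne (passCell_mul_le_passTime hw hv hp) (hc n)
    exact (hf.tendsto_leftLim _).comp (tendsto_nhdsWithin_iff.2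
      ⟨tendsto_passCell_left hw hv hp, Eventually.of_forall hlt⟩)

lemma tendsto_eval_passCell_left (hw : IsRegularPath w) (hv : 0 ≤ v) (hp : Passes w v) :
    Tendsto (fun n => w ((passCell (mesh n) w v : ℕ) * mesh n)) atTop (𝓝 (prePassage w v)) := by
  have h1 := tendsto_eval_passCell_left_aux hw hv hp hw.mono_fst (fun s hs => hs.fst)
  have h2 := tendsto_eval_passCell_left_aux hw hv hp hw.mono_snd (fun s hs => hs.snd)
  exact h1.prodMk_nhds h2

/-- If the level is never exceeded, the approximations converge to the default value. -/
lemma passData_of_not_passes (hw : IsRegularPath w) (hp : ¬ Passes w v) :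
    passTime w v = 0 ∧ prePassage w v = 0 ∧ w (passTime w v) = 0 := by
  have h0 : passTime w v = 0 := by
    have : firstPassage (fun s => (w s).2) v = ∞ := by
      by_contra hc; exact hp (firstPassage_ne_top_iff.1 hc)
    rw [passTime, this]; rfl
  refine ⟨h0, ?_, by rw [h0, hw.zero]⟩
  simp only [prePassage, h0]
  rw [leftLim_eq_of_isBot (fun _ => zero_le), leftLim_eq_of_isBot (fun _ => zero_le), hw.zero]

end Cell

/-- Passage time, value before the passage and jump at the passage, as one random element. -/
noncomputable def passData (w : ℝ≥0 → ℝ × ℝ) (v : ℝ) : ℝ≥0 × (ℝ × ℝ) × (ℝ × ℝ) :=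
  (passTime w v, prePassage w v, passJump w v)

/-- The grid approximation of `passData`. -/
noncomputable def cellData (h : ℝ≥0) (w : ℝ≥0 → ℝ × ℝ) (v : ℝ) : ℝ≥0 × (ℝ × ℝ) × (ℝ × ℝ) :=
  ((passCell h w v + 1 : ℕ) * h, w ((passCell h w v : ℕ) * h),
    w ((passCell h w v + 1 : ℕ) * h) - w ((passCell h w v : ℕ) * h))

lemma tendsto_cellData {w : ℝ≥0 → ℝ × ℝ} {v : ℝ} (hw : IsRegularPath w) (hv : 0 ≤ v) :
    Tendsto (fun n => cellData (mesh n) w v) atTop (𝓝 (passData w v)) := by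
  by_cases hp : Passes w v
  · exact (tendsto_passCell_right hw hv hp).prodMk_nhds
      ((tendsto_eval_passCell_left hw hv hp).prodMk_nhds
        ((tendsto_eval_passCell_right hw hv hp).sub (tendsto_eval_passCell_left hw hv hp)))
  · obtain ⟨h1, h2, h3⟩ := passData_of_not_passes hw hp
    simp only [cellData, passCell_eq_zero hw (mesh_pos _) hp, passData, h1, h2, passJump]
    simp only [zero_add, Nat.cast_one, one_mul, Nat.cast_zero, zero_mul, hw.zero, sub_zero]
    refine tendsto_mesh.prodMk_nhds (tendsto_const_nhds.prodMk_nhds ?_)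
    have := (hw.rightCont 0).tendsto
    rw [hw.zero] at this
    exact this.comp
      (tendsto_nhdsWithin_iff.2 ⟨tendsto_mesh, Eventually.of_forall fun n => (mesh_pos n).le⟩)

lemma measurable_eval_nat (h : ℝ≥0) :
    Measurable fun p : (ℝ≥0 → ℝ × ℝ) × ℕ => p.1 (p.2 * h) :=
  measurable_from_prod_countable_left fun k => measurable_pi_apply ((k : ℝ≥0) * h)

lemma measurable_cellData (h : ℝ≥0) :
    Measurable fun p : ℝ × (ℝ≥0 → ℝ × ℝ) => cellData h p.2 p.1 := by
  have hc := measurable_passCell h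
  have hc1 : Measurable fun p : ℝ × (ℝ≥0 → ℝ × ℝ) => passCell h p.2 p.1 + 1 :=
    (measurable_of_countable (fun k : ℕ => k + 1)).comp hc
  have e0 := (measurable_eval_nat h).comp (measurable_snd.prodMk hc)
  have e1 := (measurable_eval_nat h).comp (measurable_snd.prodMk hc1)
  refine Measurable.prodMk ?_ (e0.prodMk (e1.sub e0))
  exact (measurable_of_countable (fun k : ℕ => (k : ℝ≥0) * h)).comp hc1

/-- On regular paths the passage data are a jointly measurable function of level and path. -/
lemma exists_measurable_passData :
    ∃ D : ℝ × (ℝ≥0 → ℝ × ℝ) → ℝ≥0 × (ℝ × ℝ) × (ℝ × ℝ), Measurable D ∧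
      ∀ w, IsRegularPath w → ∀ v, 0 ≤ v → D (v, w) = passData w v := by
  refine ⟨fun p => limUnder atTop fun n => cellData (mesh n) p.2 p.1, ?_, ?_⟩
  · exact (StronglyMeasurable.limUnder fun n =>
      (measurable_cellData (mesh n)).stronglyMeasurable).measurable
  · intro w hw v hv
    exact (tendsto_cellData hw hv).limUnder_eq

lemma exists_measurableSet_passes :
    ∃ S : Set (ℝ × (ℝ≥0 → ℝ × ℝ)), MeasurableSet S ∧
      ∀ w, IsRegularPath w → ∀ v, (v, w) ∈ S ↔ Passes w v := by
  refine ⟨⋃ j : ℕ, {p | p.1 < (p.2 ((j + 1 : ℕ) * (1 : ℝ≥0))).2}, ?_, ?_⟩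
  · exact MeasurableSet.iUnion fun j => measurableSet_lt measurable_fst measurable_snd.eval.snd
  · intro w hw v
    rw [passes_iff_exists_nat hw one_pos]
    simp

/-! ### The Markov property of processes with stationary independent increments -/

/-- Finitely many times lie on a monotone sequence of times that starts at `0`. -/
lemma exists_monotone_enumeration (J : Finset ℝ≥0) :
    ∃ (t : ℕ → ℝ≥0) (N : ℕ), Monotone t ∧ t 0 = 0 ∧ (∀ r ∈ J, ∃ i ≤ N, t i = r) ∧
      ∀ i, t i ∈ insert 0 J := by
  induction J using Finset.induction_on_max with
  | empty => exact ⟨fun _ => 0, 0, monotone_const, rfl, by simp, by simp⟩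
  | insert m J hm ih =>
    obtain ⟨t, N, ht, h0, hJ, hmem⟩ := ih
    have hle : ∀ i, t i ≤ m := fun i => by
      rcases Finset.mem_insert.1 (hmem i) with h | h
      · rw [h]; exact zero_le
      · exact (hm _ h).le
    refine ⟨fun i => if i ≤ N then t i else m, N + 1, ?_, by simp [h0], ?_, ?_⟩
    · intro i j hij
      dsimp only
      split_ifs with h1 h2
      · exact ht hij
      · exact hle i
      · omega
      · exact le_rfl
    · intro r hr
      rcases Finset.mem_insert.1 hr with h | h
      · exact ⟨N + 1, le_rfl, by simp [h]⟩
      · obtain ⟨i, hi, hi'⟩ := hJ r h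
        exact ⟨i, by omega, by simp [hi, hi']⟩
    · intro i
      dsimp only
      split_ifs
      · have := hmem i
        simp only [Finset.mem_insert] at this ⊢
        tauto
      · simp

/-- The partial sum `∑_{j < i} a_j` of a finite family. -/
def partialSum {E : Type*} [AddCommGroup E] {N : ℕ} (i : ℕ) (a : Fin N → E) : E :=
  ∑ j : Fin N, if (j : ℕ) < i then a j else 0

lemma measurable_partialSum {E : Type*} [AddCommGroup E] [MeasurableSpace E]
    [MeasurableAdd₂ E] {N : ℕ} (i : ℕ) :
    Measurable (partialSum i : (Fin N → E) → E) := by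
  unfold partialSum
  refine Finset.measurable_sum _ fun j _ => ?_
  split_ifs
  · exact measurable_pi_apply j
  · exact measurable_const

lemma partialSum_increments {E : Type*} [AddCommGroup E] {N i : ℕ} (hi : i ≤ N) (x : ℕ → E) :
    partialSum i (fun j : Fin N => x (j + 1) - x j) = x i - x 0 := by
  unfold partialSum
  rw [Fin.sum_univ_eq_sum_range (fun j => if j < i then x (j + 1) - x j else 0) N,
    ← Finset.sum_filter, ← Finset.sum_range_sub x i]
  congr 1
  ext j
  simp only [Finset.mem_filter, Finset.mem_range]
  omega

section Markov

variable {Ω E : Type*} [MeasurableSpace Ω] {P : Measure Ω} [IsProbabilityMeasure P]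
  [AddCommGroup E] [MeasurableSpace E] [MeasurableAdd₂ E] [MeasurableSub₂ E] {X : ℝ≥0 → Ω → E}

/-- The path stopped at time `s` is independent of the increments after `s`. -/
lemma indepFun_past_future (hm : ∀ s, Measurable (X s)) (h0 : ∀ᵐ ω ∂P, X 0 ω = 0)
    (hi : HasIndepIncrements X P) (s : ℝ≥0) :
    IndepFun (fun ω r => X (min r s) ω) (fun ω r => X (s + r) ω - X s ω) P := by
  refine IndepFun.process_indepFun_process (fun r => hm _) (fun r => (hm _).sub (hm _))
    fun I J => ?_
  obtain ⟨t, N, ht, ht0, htI, htmem⟩ := exists_monotone_enumeration (I.image (min · s))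
  obtain ⟨t', M, ht', ht0', htJ, -⟩ := exists_monotone_enumeration J
  have hts : ∀ i, t i ≤ s := fun i => by
    rcases Finset.mem_insert.1 (htmem i) with h | h
    · rw [h]; exact zero_le
    · obtain ⟨a, -, ha⟩ := Finset.mem_image.1 h
      rw [← ha]; exact min_le_right _ _
  -- The two time grids are concatenated; step `N`, from `t N` to `s`, belongs to the past.
  let τ : ℕ → ℝ≥0 := fun i => if i ≤ N then t i else s + t' (i - (N + 1))
  have hτ : Monotone τ := by
    intro i j hij
    simp only [τ]
    split_ifs with h1 h2
    · exact ht hij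
    · exact (hts i).trans le_self_add
    · omega
    · gcongr
      exact ht' (by omega)
  have hind := hi.nat hτ
  have hind2 : IndepFun (fun ω (j : Fin (N + 1)) => X (τ (j + 1)) ω - X (τ j) ω)
      (fun ω (j : Fin M) => X (τ (N + 1 + j + 1)) ω - X (τ (N + 1 + j)) ω) P := by
    have h := hind.indepFun_finset (Finset.range (N + 1)) (Finset.Ico (N + 1) (N + 1 + M))
      (by
        rw [Finset.disjoint_left]
        intro a ha hb
        simp only [Finset.mem_range, Finset.mem_Ico] at ha hb
        omega) (fun i => (hm _).sub (hm _))
    exact h.comp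
      (φ := fun a (j : Fin (N + 1)) => a ⟨j, Finset.mem_range.2 j.2⟩)
      (ψ := fun a (j : Fin M) => a ⟨N + 1 + j, by simp⟩)
      (measurable_pi_lambda _ fun j => measurable_pi_apply _)
      (measurable_pi_lambda _ fun j => measurable_pi_apply _)
  choose! iI hiI hiI' using htI
  choose! iJ hiJ hiJ' using htJ
  have hcomp := hind2.comp
    (φ := fun a (r : I) => partialSum (iI (min r.1 s)) a)
    (ψ := fun a (r : J) => partialSum (iJ r.1) a)
    (measurable_pi_lambda _ fun r => measurable_partialSum _)
    (measurable_pi_lambda _ fun r => measurable_partialSum _)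
  refine hcomp.congr ?_ ?_
  · filter_upwards [h0] with ω hω
    funext r
    have hr : min r.1 s ∈ I.image (min · s) := Finset.mem_image_of_mem _ r.2
    have h1 := hiI _ hr
    have h2 := hiI' _ hr
    simp only [Function.comp]
    rw [partialSum_increments (x := fun j => X (τ j) ω) (by omega)]
    simp only [τ, if_pos h1, h2, zero_le, if_true, ht0, hω, sub_zero]
  · refine Eventually.of_forall fun ω => ?_
    funext r
    have h1 := hiJ _ r.2
    have h2 := hiJ' _ r.2
    simp only [Function.comp]
    have := partialSum_increments (N := M) h1 (fun j => X (τ (N + 1 + j)) ω)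
    simp only [← add_assoc] at this
    rw [this]
    have h3 : ∀ j, τ (N + 1 + j) = s + t' j := fun j => by
      simp only [τ, show ¬ (N + 1 + j ≤ N) by omega, if_false]
      congr 2
      omega
    have h4 := h3 0
    rw [add_zero, ht0', add_zero] at h4
    simp only [h3, h2, add_zero, h4]

/-- The increments after time `s` are distributed as the process. -/
lemma map_future (hm : ∀ s, Measurable (X s)) (h0 : ∀ᵐ ω ∂P, X 0 ω = 0)
    (hi : HasIndepIncrements X P)
    (hs : ∀ r s : ℝ≥0, P.map (fun ω => X (r + s) ω - X r ω) = P.map (X s)) (s : ℝ≥0) :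
    P.map (fun ω r => X (s + r) ω - X s ω) = P.map (fun ω r => X r ω) := by
  rw [map_eq_iff_forall_finset_map_restrict_eq
    (X := fun r ω => X (s + r) ω - X s ω) (Y := X)
    (measurable_pi_lambda _ fun r => (hm _).sub (hm _)).aemeasurable
    (measurable_pi_lambda _ fun r => hm r).aemeasurable]
  intro J
  obtain ⟨t, N, ht, ht0, htJ, -⟩ := exists_monotone_enumeration J
  choose! i hi1 hi2 using htJ
  have hshift : Monotone fun j => s + t j := fun a b hab => by dsimp only; gcongr; exact ht hab
  have ind1 := (hi.nat hshift).precomp (g := fun j : Fin N => (j : ℕ)) Fin.val_injective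
  have ind2 := (hi.nat ht).precomp (g := fun j : Fin N => (j : ℕ)) Fin.val_injective
  have m1 : ∀ j : Fin N, Measurable fun ω => X (s + t (j + 1)) ω - X (s + t j) ω :=
    fun j => (hm _).sub (hm _)
  have m2 : ∀ j : Fin N, Measurable fun ω => X (t (j + 1)) ω - X (t j) ω :=
    fun j => (hm _).sub (hm _)
  have e1 := (iIndepFun_iff_map_fun_eq_pi_map fun j => (m1 j).aemeasurable).1 ind1
  have e2 := (iIndepFun_iff_map_fun_eq_pi_map fun j => (m2 j).aemeasurable).1 ind2
  have hlaw : ∀ j : Fin N, P.map (fun ω => X (s + t (j + 1)) ω - X (s + t j) ω) =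
      P.map (fun ω => X (t (j + 1)) ω - X (t j) ω) := fun j => by
    have hle : t j ≤ t (j + 1) := ht (Nat.le_succ _)
    have a1 := hs (s + t j) (t (j + 1) - t j)
    have a2 := hs (t j) (t (j + 1) - t j)
    rw [add_assoc, add_tsub_cancel_of_le hle] at a1
    rw [add_tsub_cancel_of_le hle] at a2
    rw [a1, a2]
  have e3 : P.map (fun ω (j : Fin N) => X (s + t (j + 1)) ω - X (s + t j) ω) =
      P.map (fun ω (j : Fin N) => X (t (j + 1)) ω - X (t j) ω) := by
    rw [e1, e2]
    congr 1
    funext j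
    exact hlaw j
  let φ : (Fin N → E) → J → E := fun a r => partialSum (i r.1) a
  have hφ : Measurable φ := measurable_pi_lambda _ fun r => measurable_partialSum _
  have f1 : (fun ω => J.restrict (fun r => X (s + r) ω - X s ω)) =
      φ ∘ fun ω (j : Fin N) => X (s + t (j + 1)) ω - X (s + t j) ω := by
    funext ω r
    simp only [φ, Function.comp, Finset.restrict]
    rw [partialSum_increments (hi1 _ r.2) (fun j => X (s + t j) ω), hi2 _ r.2, ht0, add_zero]
  have f2 : (fun ω => J.restrict (fun r => X r ω)) =ᵐ[P]
      φ ∘ fun ω (j : Fin N) => X (t (j + 1)) ω - X (t j) ω := by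
    filter_upwards [h0] with ω hω
    funext r
    simp only [φ, Function.comp, Finset.restrict]
    rw [partialSum_increments (hi1 _ r.2) (fun j => X (t j) ω), hi2 _ r.2, ht0, hω, sub_zero]
  rw [Measure.map_congr f2, f1, ← Measure.map_map hφ (measurable_pi_lambda _ m1),
    ← Measure.map_map hφ (measurable_pi_lambda _ m2), e3]

/-- The Markov property at a fixed time: path stopped at `s` and increments after `s` are
jointly distributed as if the latter were a fresh copy of the process. -/
lemma map_past_future (hm : ∀ s, Measurable (X s)) (h0 : ∀ᵐ ω ∂P, X 0 ω = 0)
    (hi : HasIndepIncrements X P)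
    (hs : ∀ r s : ℝ≥0, P.map (fun ω => X (r + s) ω - X r ω) = P.map (X s)) (s : ℝ≥0) :
    P.map (fun ω => ((fun r => X (min r s) ω), fun r => X (s + r) ω - X s ω)) =
      (P.map fun ω r => X (min r s) ω).prod (P.map fun ω r => X r ω) := by
  rw [← map_future hm h0 hi hs s]
  exact (indepFun_iff_map_prod_eq_prod_map_map
    (measurable_pi_lambda _ fun r => hm _).aemeasurable
    (measurable_pi_lambda _ fun r => (hm _).sub (hm _)).aemeasurable).1
    (indepFun_past_future hm h0 hi s)

end Markov

/-! ### Bivariate subordinators: regularity of paths and Laplace exponent -/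

/-- A monotone additive function on `[0, ∞)` is linear. -/
lemma eq_mul_of_monotone_of_add {g : ℝ≥0 → ℝ} (hg : Monotone g)
    (hadd : ∀ r s, g (r + s) = g r + g s) (s : ℝ≥0) : g s = s * g 1 := by
  have h0 : g 0 = 0 := by have := hadd 0 0; simp at this; exact this
  have hn : ∀ (n : ℕ) (s : ℝ≥0), g (n * s) = n * g s := by
    intro n s
    induction n with
    | zero => simp [h0]
    | succ n ih => push_cast; rw [add_mul, one_mul, hadd, ih]; ring
  have h1 : 0 ≤ g 1 := h0 ▸ hg zero_le
  have key : ∀ n : ℕ, (n : ℝ) * |g s - s * g 1| ≤ g 1 := by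
    intro n
    have hf1 : ((⌊(n : ℝ≥0) * s⌋₊ : ℕ) : ℝ≥0) ≤ n * s := Nat.floor_le zero_le
    have hf2 : (n : ℝ≥0) * s ≤ (⌊(n : ℝ≥0) * s⌋₊ + 1 : ℕ) := by
      push_cast; exact (Nat.lt_floor_add_one _).le
    set m := ⌊(n : ℝ≥0) * s⌋₊
    have a1 := hg hf1
    have a2 := hg hf2
    have b1 := hn m 1
    have b2 := hn (m + 1) 1
    rw [mul_one] at b1 b2
    rw [b1, hn] at a1
    rw [b2, hn] at a2
    have c1 : (m : ℝ) ≤ n * s := by exact_mod_cast hf1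
    have c2 : (n : ℝ) * s ≤ m + 1 := by exact_mod_cast hf2
    push_cast at a2
    rw [← abs_of_nonneg (Nat.cast_nonneg (α := ℝ) n), ← abs_mul, abs_le]
    constructor <;> nlinarith
  by_contra hne
  have hpos : 0 < |g s - s * g 1| := abs_pos.2 (sub_ne_zero.2 hne)
  obtain ⟨n, hn'⟩ := exists_nat_gt (g 1 / |g s - s * g 1|)
  rw [div_lt_iff₀ hpos] at hn'
  exact absurd (key n) (not_le.2 hn')

/-- The path of `(Z, Y)` at `ω`. -/
def path {Ω : Type*} (Z Y : ℝ≥0 → Ω → ℝ) (ω : Ω) : ℝ≥0 → ℝ × ℝ := fun s => (Z s ω, Y s ω)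

/-- The Laplace exponent `ψ(a, b) = - log E exp (-a Z₁ - b Y₁)` of the unkilled subordinator. -/
noncomputable def laplaceExponent {Ω : Type*} [MeasurableSpace Ω] (P : Measure Ω)
    (Z Y : ℝ≥0 → Ω → ℝ) (a b : ℝ) : ℝ :=
  -Real.log (∫ ω, Real.exp (-(a * Z 1 ω) - b * Y 1 ω) ∂P)

section Subordinator

variable {Ω : Type*} [MeasurableSpace Ω] {P : Measure Ω} {Z Y : ℝ≥0 → Ω → ℝ}

namespace Subordinator

lemma measurable_pair (h : IsBivariateSubordinator P Z Y) (s : ℝ≥0) :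
    Measurable fun ω => (Z s ω, Y s ω) :=
  (h.measurable_fst s).prodMk (h.measurable_snd s)

lemma measurable_path (h : IsBivariateSubordinator P Z Y) : Measurable (path Z Y) :=
  measurable_pi_lambda _ fun s => measurable_pair h s

lemma ae_zero (h : IsBivariateSubordinator P Z Y) : ∀ᵐ ω ∂P, (Z 0 ω, Y 0 ω) = 0 := by
  filter_upwards [h.zero] with ω hω
  rw [hω.1, hω.2]; rfl

lemma map_increment (h : IsBivariateSubordinator P Z Y) (r s : ℝ≥0) :
    P.map (fun ω => (Z (r + s) ω, Y (r + s) ω) - (Z r ω, Y r ω)) =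
      P.map (fun ω => (Z s ω, Y s ω)) := h.stationary r s

/-- The same process with the roles of the two coordinates exchanged. -/
lemma swap (h : IsBivariateSubordinator P Z Y) : IsBivariateSubordinator P Y Z where
  measurable_fst := h.measurable_snd
  measurable_snd := h.measurable_fst
  zero := h.zero.mono fun _ hω => hω.symm
  indep := h.indep.map' (f := (AddMonoidHom.snd ℝ ℝ).prod (AddMonoidHom.fst ℝ ℝ)) measurable_swap
  stationary r s := by
    have m1 : Measurable fun ω => (Z (r + s) ω - Z r ω, Y (r + s) ω - Y r ω) :=
      (measurable_pair h (r + s)).sub (measurable_pair h r)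
    have := congrArg (fun μ => μ.map Prod.swap) (h.stationary r s)
    rw [Measure.map_map measurable_swap m1, Measure.map_map measurable_swap (measurable_pair h s)]
      at this
    exact this
  monotone := h.monotone.mono fun _ hω => hω.symm
  rightCont := h.rightCont.mono fun _ hω s => (hω s).symm

lemma ae_nonneg (h : IsBivariateSubordinator P Z Y) : ∀ᵐ ω ∂P, ∀ s, 0 ≤ Z s ω ∧ 0 ≤ Y s ω := by
  filter_upwards [h.zero, h.monotone] with ω h0 hm s
  exact ⟨h0.1 ▸ hm.1 zero_le, h0.2 ▸ hm.2 zero_le⟩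

/-- Independence and stationarity of the increments, for two consecutive time spans. -/
lemma lintegral_mul_increment (h : IsBivariateSubordinator P Z Y) (r s : ℝ≥0)
    {f g : ℝ × ℝ → ℝ≥0∞} (hf : Measurable f) (hg : Measurable g) :
    ∫⁻ ω, f (Z r ω, Y r ω) * g ((Z (r + s) ω, Y (r + s) ω) - (Z r ω, Y r ω)) ∂P =
      (∫⁻ ω, f (Z r ω, Y r ω) ∂P) * ∫⁻ ω, g (Z s ω, Y s ω) ∂P := by
  have hm := (measurable_pair h (r + s)).sub (measurable_pair h r)
  have hind := h.indep.indepFun_eval_sub (r := 0) (s := r) (t := r + s) zero_le le_self_add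
    (ae_zero h)
  have h1 := lintegral_mul_eq_lintegral_mul_lintegral_of_indepFun (μ := P)
    (hf.comp (measurable_pair h r)) (hg.comp hm) (hind.comp hf hg)
  have a1 := lintegral_map (μ := P) hg hm
  have a2 := lintegral_map (μ := P) hg (measurable_pair h s)
  have e : P.map ((fun ω => (Z (r + s) ω, Y (r + s) ω)) - fun ω => (Z r ω, Y r ω)) =
      P.map (fun ω => (Z s ω, Y s ω)) := map_increment h r s
  rw [e, a2] at a1
  rw [a1]
  exact h1

variable [IsProbabilityMeasure P]

/-- A fixed positive time is almost surely no jump time. -/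
lemma ae_leftLim_fst_eq (h : IsBivariateSubordinator P Z Y) {r : ℝ≥0} (hr : 0 < r) :
    ∀ᵐ ω ∂P, Function.leftLim (fun s => Z s ω) r = Z r ω := by
  -- The increment over `[r - δ, r]` has the law of the value at `δ`, which tends to `0`.
  let δ : ℕ → ℝ≥0 := fun m => mesh m * r
  have hδ0 : ∀ m, 0 < δ m := fun m => mul_pos (mesh_pos m) hr
  have hδr : ∀ m, δ m ≤ r := fun m => by
    have : mesh m ≤ 1 := by
      unfold mesh; exact inv_le_one_of_one_le₀ (by simp)
    calc mesh m * r ≤ 1 * r := by gcongr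
      _ = r := one_mul r
  have hδ : Tendsto δ atTop (𝓝 0) := by
    simpa [δ] using tendsto_mesh.mul_const r
  let φ : ℝ × ℝ → ℝ≥0∞ := fun p => ENNReal.ofReal (min 1 p.1)
  have hφ : Measurable φ := by fun_prop
  let g : ℕ → Ω → ℝ≥0∞ := fun m ω => φ ((Z r ω, Y r ω) - (Z (r - δ m) ω, Y (r - δ m) ω))
  have hg : ∀ m, Measurable (g m) := fun m =>
    hφ.comp ((measurable_pair h _).sub (measurable_pair h _))
  have hint : ∀ m, ∫⁻ ω, g m ω ∂P = ∫⁻ ω, φ (Z (δ m) ω, Y (δ m) ω) ∂P := fun m => by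
    have e := map_increment h (r - δ m) (δ m)
    rw [tsub_add_cancel_of_le (hδr m)] at e
    have a1 := lintegral_map (μ := P) hφ
      ((measurable_pair h r).sub (measurable_pair h (r - δ m)))
    have a2 := lintegral_map (μ := P) hφ (measurable_pair h (δ m))
    rw [← a2, ← e]
    exact a1.symm
  have hlim : Tendsto (fun m => ∫⁻ ω, φ (Z (δ m) ω, Y (δ m) ω) ∂P) atTop (𝓝 0) := by
    have : Tendsto (fun m => ∫⁻ ω, φ (Z (δ m) ω, Y (δ m) ω) ∂P) atTop
        (𝓝 (∫⁻ _, (0 : ℝ≥0∞) ∂P)) := by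
      refine tendsto_lintegral_of_dominated_convergence (fun _ => 1)
        (fun m => hφ.comp (measurable_pair h _)) (fun m => ?_) (by simp) ?_
      · refine Eventually.of_forall fun ω => ?_
        simp only [φ]
        rw [← ENNReal.ofReal_one]
        exact ENNReal.ofReal_le_ofReal (min_le_left _ _)
      · filter_upwards [h.zero, h.rightCont] with ω h0 hc
        have h1 : Tendsto (fun m => Z (δ m) ω) atTop (𝓝 0) := by
          have := (hc 0).1.tendsto
          rw [h0.1] at this
          exact this.comp (tendsto_nhdsWithin_iff.2 ⟨hδ, Eventually.of_forall fun m => (hδ0 m).le⟩)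
        have h2 : Tendsto (fun m => ENNReal.ofReal (min 1 (Z (δ m) ω))) atTop
            (𝓝 (ENNReal.ofReal (min 1 0))) :=
          (ENNReal.continuous_ofReal.tendsto _).comp (tendsto_const_nhds.min h1)
        rw [min_eq_right zero_le_one, ENNReal.ofReal_zero] at h2
        exact h2
    simpa using this
  have hzero : ∫⁻ ω, ⨅ m, g m ω ∂P = 0 := by
    refine le_antisymm (ge_of_tendsto' hlim fun m => ?_) zero_le
    rw [← hint]
    exact lintegral_mono fun ω => iInf_le _ m
  rw [lintegral_eq_zero_iff (Measurable.iInf hg)] at hzero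
  filter_upwards [hzero, h.monotone] with ω hω hm
  refine le_antisymm (hm.1.leftLim_le le_rfl) ?_
  by_contra! hc
  have hpos : 0 < ENNReal.ofReal (min 1 (Z r ω - Function.leftLim (fun s => Z s ω) r)) := by
    rw [ENNReal.ofReal_pos]
    exact lt_min one_pos (sub_pos.2 hc)
  have hle : ENNReal.ofReal (min 1 (Z r ω - Function.leftLim (fun s => Z s ω) r)) ≤
      ⨅ m, g m ω := by
    refine le_iInf fun m => ?_
    have hlt : r - δ m < r := tsub_lt_self hr (hδ0 m)
    have := hm.1.le_leftLim hlt
    simp only [g, φ]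
    refine ENNReal.ofReal_le_ofReal (min_le_min le_rfl ?_)
    simp only [Prod.fst_sub]
    linarith
  rw [hω] at hle
  exact absurd hpos (not_lt.2 hle)

lemma ae_continuousAt_fst (h : IsBivariateSubordinator P Z Y) {r : ℝ≥0} (hr : 0 < r) :
    ∀ᵐ ω ∂P, ContinuousAt (fun s => Z s ω) r := by
  filter_upwards [ae_leftLim_fst_eq h hr, h.monotone, h.rightCont] with ω h1 hm hc
  rw [continuousAt_iff_continuous_left_right]
  refine ⟨?_, (hc r).1⟩
  rw [← continuousWithinAt_Iio_iff_Iic]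
  have := hm.1.tendsto_leftLim r
  rw [h1] at this
  exact this

lemma ae_isRegularPath (h : IsBivariateSubordinator P Z Y) :
    ∀ᵐ ω ∂P, IsRegularPath (path Z Y ω) := by
  have hgrid : ∀ᵐ ω ∂P, ∀ n k : ℕ, ContinuousAt (fun s => Z s ω)
      ((k + 1 : ℕ) * ((n : ℝ≥0) + 1)⁻¹) ∧
      ContinuousAt (fun s => Y s ω) ((k + 1 : ℕ) * ((n : ℝ≥0) + 1)⁻¹) := by
    simp only [ae_all_iff]
    intro n k
    have hpos : 0 < ((k + 1 : ℕ) : ℝ≥0) * ((n : ℝ≥0) + 1)⁻¹ := by positivity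
    filter_upwards [ae_continuousAt_fst h hpos, ae_continuousAt_fst (swap h) hpos] with ω h1 h2
    exact ⟨h1, h2⟩
  filter_upwards [ae_zero h, h.monotone, h.rightCont, hgrid] with ω h0 hm hc hg
  exact ⟨h0, hm.1, hm.2, fun s => (hc s).1.prodMk (hc s).2, fun n k => (hg n k).1.prodMk (hg n k).2⟩

lemma measurable_exp_lin (a b : ℝ) :
    Measurable fun p : ℝ × ℝ => ENNReal.ofReal (Real.exp (-(a * p.1) - b * p.2)) := by fun_prop

lemma lintegral_exp_le_one (h : IsBivariateSubordinator P Z Y) {a b : ℝ} (ha : 0 ≤ a)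
    (hb : 0 ≤ b) (s : ℝ≥0) :
    ∫⁻ ω, ENNReal.ofReal (Real.exp (-(a * Z s ω) - b * Y s ω)) ∂P ≤ 1 := by
  calc _ ≤ ∫⁻ _, 1 ∂P := by
        refine lintegral_mono_ae ?_
        filter_upwards [ae_nonneg h] with ω hω
        rw [← ENNReal.ofReal_one]
        refine ENNReal.ofReal_le_ofReal (Real.exp_le_one_iff.2 ?_)
        have := mul_nonneg ha (hω s).1
        have := mul_nonneg hb (hω s).2
        linarith
    _ = 1 := by simp

lemma lintegral_exp_pos (h : IsBivariateSubordinator P Z Y) (a b : ℝ) (s : ℝ≥0) :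
    0 < ∫⁻ ω, ENNReal.ofReal (Real.exp (-(a * Z s ω) - b * Y s ω)) ∂P := by
  have hm := (measurable_exp_lin a b).comp (measurable_pair h s)
  refine (lintegral_pos_iff_support hm).2 ?_
  have : Function.support ((fun p : ℝ × ℝ => ENNReal.ofReal (Real.exp (-(a * p.1) - b * p.2))) ∘
      fun ω => (Z s ω, Y s ω)) = univ := by
    ext ω
    simp [Real.exp_pos]
  exact this ▸ (by simp)

/-- `E exp (-a Z_s - b Y_s) = exp (-s ψ(a, b))`. -/
lemma lintegral_exp (h : IsBivariateSubordinator P Z Y) {a b : ℝ} (ha : 0 ≤ a) (hb : 0 ≤ b)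
    (s : ℝ≥0) :
    ∫⁻ ω, ENNReal.ofReal (Real.exp (-(a * Z s ω) - b * Y s ω)) ∂P =
      ENNReal.ofReal (Real.exp (-(s * laplaceExponent P Z Y a b))) := by
  let ℓ : ℝ≥0 → ℝ≥0∞ := fun s => ∫⁻ ω, ENNReal.ofReal (Real.exp (-(a * Z s ω) - b * Y s ω)) ∂P
  have hle : ∀ s, ℓ s ≤ 1 := lintegral_exp_le_one h ha hb
  have htop : ∀ s, ℓ s ≠ ∞ := fun s => ((hle s).trans_lt ENNReal.one_lt_top).ne
  have hpos : ∀ s, 0 < (ℓ s).toReal := fun s =>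
    ENNReal.toReal_pos (lintegral_exp_pos h a b s).ne' (htop s)
  have hmul : ∀ r s, ℓ (r + s) = ℓ r * ℓ s := fun r s => by
    rw [← lintegral_mul_increment h r s (measurable_exp_lin a b) (measurable_exp_lin a b)]
    refine lintegral_congr fun ω => ?_
    rw [← ENNReal.ofReal_mul (Real.exp_pos _).le, ← Real.exp_add]
    simp only [Prod.fst_sub, Prod.snd_sub]
    congr 2
    ring
  have hanti : Antitone ℓ := fun r s hrs => by
    obtain ⟨d, rfl⟩ := exists_add_of_le hrs
    rw [hmul]
    calc ℓ r * ℓ d ≤ ℓ r * 1 := by gcongr; exact hle d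
      _ = ℓ r := mul_one _
  have hlin := eq_mul_of_monotone_of_add (g := fun s => -Real.log (ℓ s).toReal)
    (fun r s hrs => neg_le_neg (Real.log_le_log (hpos s)
      (ENNReal.toReal_mono (htop r) (hanti hrs))))
    (fun r s => by
      rw [hmul, ENNReal.toReal_mul, Real.log_mul (hpos r).ne' (hpos s).ne']; ring) s
  have h1 : (ℓ 1).toReal = ∫ ω, Real.exp (-(a * Z 1 ω) - b * Y 1 ω) ∂P := by
    rw [integral_eq_lintegral_of_nonneg_ae (Eventually.of_forall fun ω => (Real.exp_pos _).le)]
    have := h.measurable_fst 1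
    have := h.measurable_snd 1
    fun_prop
  have h2 : Real.log (ℓ s).toReal = -(s * laplaceExponent P Z Y a b) := by
    rw [laplaceExponent, ← h1]
    linarith
  change ℓ s = _
  rw [← h2, Real.exp_log (hpos s), ENNReal.ofReal_toReal (htop s)]

lemma laplaceExponent_nonneg (h : IsBivariateSubordinator P Z Y) {a b : ℝ} (ha : 0 ≤ a)
    (hb : 0 ≤ b) : 0 ≤ laplaceExponent P Z Y a b := by
  have h1 := lintegral_exp_le_one h ha hb 1
  rw [lintegral_exp h ha hb, ← ENNReal.ofReal_one, ENNReal.ofReal_le_ofReal_iff zero_le_one,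
    Real.exp_le_one_iff] at h1
  simpa using h1

lemma laplaceExponent_mono (h : IsBivariateSubordinator P Z Y) {a b a' b' : ℝ} (ha : 0 ≤ a)
    (hb : 0 ≤ b) (haa : a ≤ a') (hbb : b ≤ b') :
    laplaceExponent P Z Y a b ≤ laplaceExponent P Z Y a' b' := by
  have h1 : ∫⁻ ω, ENNReal.ofReal (Real.exp (-(a' * Z 1 ω) - b' * Y 1 ω)) ∂P ≤
      ∫⁻ ω, ENNReal.ofReal (Real.exp (-(a * Z 1 ω) - b * Y 1 ω)) ∂P := by
    refine lintegral_mono_ae ?_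
    filter_upwards [ae_nonneg h] with ω hω
    refine ENNReal.ofReal_le_ofReal (Real.exp_le_exp.2 ?_)
    have := mul_le_mul_of_nonneg_right haa (hω 1).1
    have := mul_le_mul_of_nonneg_right hbb (hω 1).2
    linarith
  rw [lintegral_exp h ha hb, lintegral_exp h (ha.trans haa) (hb.trans hbb),
    ENNReal.ofReal_le_ofReal_iff (Real.exp_pos _).le, Real.exp_le_exp] at h1
  simpa using h1

end Subordinator

end Subordinator

/-! ### Uniqueness of multivariate Laplace transforms -/

section Laplace

open BoundedContinuousFunction

/-- The exponential `x ↦ exp (-∑ cᵢ xᵢ)` on the orthant `[0, ∞)^ι`. -/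
noncomputable def expMonomial {ι : Type*} [Fintype ι] (c : ι → ℕ) : (ι → ℝ≥0) →ᵇ ℝ :=
  BoundedContinuousFunction.ofNormedAddCommGroup
    (fun x => Real.exp (-∑ i, (c i : ℝ) * (x i : ℝ))) (by fun_prop) 1 (fun x => by
      rw [Real.norm_eq_abs, Real.abs_exp, Real.exp_le_one_iff, neg_nonpos]
      positivity)

lemma expMonomial_apply {ι : Type*} [Fintype ι] (c : ι → ℕ) (x : ι → ℝ≥0) :
    expMonomial c x = Real.exp (-∑ i, (c i : ℝ) * (x i : ℝ)) := rfl

/-- A finite measure on an orthant is determined by its Laplace transform at integer points: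
the exponentials span an algebra that separates points. -/
theorem ext_of_laplace {ι : Type*} [Fintype ι] {μ ν : Measure (ι → ℝ≥0)} [IsFiniteMeasure μ]
    [IsFiniteMeasure ν]
    (h : ∀ c : ι → ℕ, ∫⁻ x, ENNReal.ofReal (Real.exp (-∑ i, (c i : ℝ) * (x i : ℝ))) ∂μ =
      ∫⁻ x, ENNReal.ofReal (Real.exp (-∑ i, (c i : ℝ) * (x i : ℝ))) ∂ν) : μ = ν := by
  classical
  let S : Submonoid ((ι → ℝ≥0) →ᵇ ℝ) :=
    { carrier := range expMonomial
      one_mem' := ⟨0, by ext x; simp [expMonomial_apply]⟩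
      mul_mem' := by
        rintro _ _ ⟨c, rfl⟩ ⟨d, rfl⟩
        refine ⟨c + d, ?_⟩
        ext x
        rw [BoundedContinuousFunction.mul_apply, expMonomial_apply, expMonomial_apply,
          expMonomial_apply, ← Real.exp_add]
        congr 1
        simp only [Pi.add_apply, Nat.cast_add, add_mul, Finset.sum_add_distrib]
        ring }
  let A : StarSubalgebra ℝ ((ι → ℝ≥0) →ᵇ ℝ) :=
    { Algebra.adjoin ℝ (S : Set ((ι → ℝ≥0) →ᵇ ℝ)) with
      star_mem' := fun {a} ha => by
        have : star a = a := by ext x; simp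
        rw [this]; exact ha }
  refine ext_of_forall_mem_subalgebra_integral_eq_of_polish (𝕜 := ℝ) (A := A) ?_ ?_
  · intro x y hxy
    obtain ⟨i, hi⟩ : ∃ i, x i ≠ y i := by
      by_contra! hc
      exact hxy (funext hc)
    refine ⟨_, ⟨_, ⟨expMonomial (Pi.single i 1), ?_, rfl⟩, rfl⟩, ?_⟩
    · exact Algebra.subset_adjoin (⟨_, rfl⟩ : _ ∈ range expMonomial)
    · change expMonomial (Pi.single i 1) x ≠ expMonomial (Pi.single i 1) y
      rw [expMonomial_apply, expMonomial_apply]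
      intro hc
      have hc' := Real.exp_injective hc
      rw [neg_inj, Finset.sum_eq_single i, Finset.sum_eq_single i] at hc'
      · simp only [Pi.single_eq_same, Nat.cast_one, one_mul] at hc'
        exact hi (by exact_mod_cast hc')
      all_goals simp +contextual
  · intro g hg
    have hg' : g ∈ Submodule.span ℝ (S : Set ((ι → ℝ≥0) →ᵇ ℝ)) := by
      have := Algebra.adjoin_eq_span (R := ℝ) (s := (S : Set ((ι → ℝ≥0) →ᵇ ℝ)))
      rw [Submonoid.closure_eq] at this
      rw [← this]
      exact hg
    clear hg
    induction hg' using Submodule.span_induction with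
    | mem f hf =>
      obtain ⟨c, rfl⟩ := hf
      have hm := (expMonomial c).continuous.stronglyMeasurable
      change ∫ x, Real.exp (-∑ i, (c i : ℝ) * (x i : ℝ)) ∂μ =
        ∫ x, Real.exp (-∑ i, (c i : ℝ) * (x i : ℝ)) ∂ν
      rw [integral_eq_lintegral_of_nonneg_ae (Eventually.of_forall fun _ => (Real.exp_pos _).le)
          hm.aestronglyMeasurable,
        integral_eq_lintegral_of_nonneg_ae (Eventually.of_forall fun _ => (Real.exp_pos _).le)
          hm.aestronglyMeasurable]
      exact congrArg ENNReal.toReal (h c)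
    | zero => simp
    | add f g _ _ hf hg =>
      simp only [BoundedContinuousFunction.add_apply]
      rw [integral_add (f.integrable μ) (g.integrable μ),
        integral_add (f.integrable ν) (g.integrable ν), hf, hg]
    | smul a f _ hf =>
      simp only [BoundedContinuousFunction.smul_apply]
      rw [integral_smul, integral_smul, hf]

/-- The coordinates of a point of `ℝ × ℝ² × ℝ²`, with negative ones replaced by `0`. -/
noncomputable def toOrthant (x : ℝ × (ℝ × ℝ) × (ℝ × ℝ)) : Fin 5 → ℝ≥0 :=
  ![x.1.toNNReal, x.2.1.1.toNNReal, x.2.1.2.toNNReal, x.2.2.1.toNNReal, x.2.2.2.toNNReal]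

/-- Inclusion of the orthant `[0, ∞)⁵` into `ℝ × ℝ² × ℝ²`. -/
noncomputable def ofOrthant (x : Fin 5 → ℝ≥0) : ℝ × (ℝ × ℝ) × (ℝ × ℝ) :=
  (x 0, (x 1, x 2), (x 3, x 4))

lemma measurable_toOrthant : Measurable toOrthant := by
  refine measurable_pi_lambda _ fun i => ?_
  fin_cases i <;> simp only [toOrthant] <;> simp <;> fun_prop

lemma measurable_ofOrthant : Measurable ofOrthant := by
  unfold ofOrthant; fun_prop

/-- All coordinates are nonnegative. -/
def InOrthant (x : ℝ × (ℝ × ℝ) × (ℝ × ℝ)) : Prop :=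
  0 ≤ x.1 ∧ (0 ≤ x.2.1.1 ∧ 0 ≤ x.2.1.2) ∧ (0 ≤ x.2.2.1 ∧ 0 ≤ x.2.2.2)

lemma ofOrthant_toOrthant {x : ℝ × (ℝ × ℝ) × (ℝ × ℝ)} (hx : InOrthant x) :
    ofOrthant (toOrthant x) = x := by
  obtain ⟨h1, ⟨h2, h3⟩, h4, h5⟩ := hx
  simp [ofOrthant, toOrthant, h1, h2, h3, h4, h5]

/-- A finite measure on `ℝ × ℝ² × ℝ²` carried by the orthant is determined by its Laplace
transform. -/
theorem ext_of_laplace_prod {μ ν : Measure (ℝ × (ℝ × ℝ) × (ℝ × ℝ))} [IsFiniteMeasure μ]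
    [IsFiniteMeasure ν] (hμ : ∀ᵐ x ∂μ, InOrthant x) (hν : ∀ᵐ x ∂ν, InOrthant x)
    (h : ∀ c a₁ a₂ b₁ b₂ : ℕ,
      ∫⁻ x, ENNReal.ofReal (Real.exp (-(c * x.1) +
        ((-(a₁ * x.2.1.1) - a₂ * x.2.1.2) + (-(b₁ * x.2.2.1) - b₂ * x.2.2.2)))) ∂μ =
      ∫⁻ x, ENNReal.ofReal (Real.exp (-(c * x.1) +
        ((-(a₁ * x.2.1.1) - a₂ * x.2.1.2) + (-(b₁ * x.2.2.1) - b₂ * x.2.2.2)))) ∂ν) :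
    μ = ν := by
  have key : μ.map toOrthant = ν.map toOrthant := by
    refine ext_of_laplace fun c => ?_
    have hm : Measurable fun x : Fin 5 → ℝ≥0 =>
        ENNReal.ofReal (Real.exp (-∑ i, (c i : ℝ) * (x i : ℝ))) := by fun_prop
    have e : ∀ x, InOrthant x → ENNReal.ofReal (Real.exp (-∑ i, (c i : ℝ) * (toOrthant x i : ℝ))) =
        ENNReal.ofReal (Real.exp (-(c 0 * x.1) +
        ((-(c 1 * x.2.1.1) - c 2 * x.2.1.2) + (-(c 3 * x.2.2.1) - c 4 * x.2.2.2)))) := by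
      rintro x ⟨h1, ⟨h2, h3⟩, h4, h5⟩
      congr 2
      simp [Fin.sum_univ_five, toOrthant, h1, h2, h3, h4, h5]
      ring
    rw [lintegral_map hm measurable_toOrthant, lintegral_map hm measurable_toOrthant,
      lintegral_congr_ae (hμ.mono e), lintegral_congr_ae (hν.mono e)]
    exact h _ _ _ _ _
  have back : ∀ ρ : Measure (ℝ × (ℝ × ℝ) × (ℝ × ℝ)), (∀ᵐ x ∂ρ, InOrthant x) →
      (ρ.map toOrthant).map ofOrthant = ρ := fun ρ hρ => by
    rw [Measure.map_map measurable_ofOrthant measurable_toOrthant]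
    conv_rhs => rw [← Measure.map_id (μ := ρ)]
    exact Measure.map_congr (hρ.mono fun x hx => ofOrthant_toOrthant hx)
  rw [← back μ hμ, ← back ν hν, key]

end Laplace

/-! ### Renewal measure and Lévy measure -/

/-- A measure that integrates some positive finite function is s-finite. -/
lemma sFinite_of_lintegral_ne_top {α : Type*} [MeasurableSpace α] {μ : Measure α} {f : α → ℝ≥0∞}
    (hf : Measurable f) (h0 : ∀ᵐ x ∂μ, f x ≠ 0) (ht : ∀ x, f x ≠ ∞) (hi : ∫⁻ x, f x ∂μ ≠ ∞) :
    SFinite μ := by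
  have : IsFiniteMeasure (μ.withDensity f) := isFiniteMeasure_withDensity hi
  rw [← withDensity_inv_same hf h0 (Eventually.of_forall ht)]
  infer_instance

namespace HasDriftAndLevyMeasure

variable {Ω : Type*} [MeasurableSpace Ω] {P : Measure Ω} {Z Y : ℝ≥0 → Ω → ℝ} {q dZ dY : ℝ}
  {ν : Measure (ℝ × ℝ)}

lemma ae_support (hν : HasDriftAndLevyMeasure P Z Y q dZ dY ν) :
    ∀ᵐ r ∂ν, 0 ≤ r.1 ∧ 0 ≤ r.2 ∧ r ≠ (0, 0) := hν.support

lemma ae_add_pos (hν : HasDriftAndLevyMeasure P Z Y q dZ dY ν) : ∀ᵐ r ∂ν, 0 < r.1 + r.2 := by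
  filter_upwards [ae_support hν] with r hr
  rcases hr.1.lt_or_eq with h1 | h1
  · linarith [hr.2.1]
  · rcases hr.2.1.lt_or_eq with h2 | h2
    · linarith
    · exact absurd (Prod.ext h1.symm h2.symm) hr.2.2

lemma sFinite (hν : HasDriftAndLevyMeasure P Z Y q dZ dY ν) : SFinite ν := by
  refine sFinite_of_lintegral_ne_top (f := fun r => ENNReal.ofReal (min 1 (r.1 + r.2)))
    (by fun_prop) ?_ (fun _ => ENNReal.ofReal_ne_top) hν.integrable.ne
  filter_upwards [ae_add_pos hν] with r hr
  exact (ENNReal.ofReal_pos.2 (lt_min one_pos hr)).ne'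

/-- The data of the process with exchanged coordinates. -/
lemma swap (hν : HasDriftAndLevyMeasure P Z Y q dZ dY ν) :
    HasDriftAndLevyMeasure P Y Z q dY dZ (ν.map Prod.swap) where
  drift_fst_nonneg := hν.drift_snd_nonneg
  drift_snd_nonneg := hν.drift_fst_nonneg
  support := by
    have h : ∀ᵐ r ∂ν.map Prod.swap, 0 ≤ r.1 ∧ 0 ≤ r.2 ∧ r ≠ (0, 0) := by
      rw [ae_map_iff measurable_swap.aemeasurable]
      · filter_upwards [ae_support hν] with r hr
        refine ⟨hr.2.1, hr.1, fun hc => hr.2.2 ?_⟩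
        rw [← Prod.swap_swap r, hc]; rfl
      · refine (measurableSet_le measurable_const measurable_fst).inter
          ((measurableSet_le measurable_const measurable_snd).inter ?_)
        exact (measurableSet_singleton _).compl
    exact h
  integrable := by
    rw [lintegral_map (by fun_prop) measurable_swap]
    simpa [add_comm] using hν.integrable
  exponent a b ha hb := by
    have h1 := hν.exponent b a hb ha
    have h2 : killedLaplaceExponent P Y Z q a b = killedLaplaceExponent P Z Y q b a := by
      unfold killedLaplaceExponent
      congr 3
      funext ω
      congr 1
      ring
    rw [h2, h1, integral_map_of_stronglyMeasurable measurable_swap (by fun_prop)]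
    have : ∀ r : ℝ × ℝ, (1 - Real.exp (-(b * r.1) - a * r.2)) =
        1 - Real.exp (-(a * r.swap.1) - b * r.swap.2) := fun r => by
      simp only [Prod.fst_swap, Prod.snd_swap]
      congr 2
      ring
    simp_rw [this]
    ring

lemma exponent_eq (hν : HasDriftAndLevyMeasure P Z Y q dZ dY ν) {a b : ℝ} (ha : 0 ≤ a)
    (hb : 0 ≤ b) : laplaceExponent P Z Y a b =
      dZ * a + dY * b + ∫ r, (1 - Real.exp (-(a * r.1) - b * r.2)) ∂ν := by
  have := hν.exponent a b ha hb
  unfold killedLaplaceExponent at this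
  unfold laplaceExponent
  linarith

lemma integrable_one_sub_exp (hν : HasDriftAndLevyMeasure P Z Y q dZ dY ν) {a b : ℝ} (ha : 0 ≤ a)
    (hb : 0 ≤ b) : Integrable (fun r => 1 - Real.exp (-(a * r.1) - b * r.2)) ν := by
  have hi : Integrable (fun r : ℝ × ℝ => min 1 (r.1 + r.2)) ν := by
    refine ⟨by fun_prop, ?_⟩
    rw [hasFiniteIntegral_iff_ofReal]
    · exact hν.integrable
    · filter_upwards [ae_add_pos hν] with r hr
      exact (lt_min one_pos hr).le
  refine (hi.const_mul (1 + a + b)).mono' (by fun_prop) ?_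
  filter_upwards [ae_support hν] with r hr
  have e0 : 0 ≤ a * r.1 := mul_nonneg ha hr.1
  have e1 : 0 ≤ b * r.2 := mul_nonneg hb hr.2.1
  have e2 : Real.exp (-(a * r.1) - b * r.2) ≤ 1 := Real.exp_le_one_iff.2 (by linarith)
  rw [Real.norm_eq_abs, abs_of_nonneg (by linarith)]
  have e3 := Real.add_one_le_exp (-(a * r.1) - b * r.2)
  have e4 := Real.exp_pos (-(a * r.1) - b * r.2)
  rcases le_total 1 (r.1 + r.2) with h | h
  · rw [min_eq_left h]; linarith
  · rw [min_eq_right h]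
    nlinarith [hr.1, hr.2.1, mul_nonneg ha hr.2.1, mul_nonneg hb hr.1]

/-- The Laplace transform of the Lévy measure against `1 - exp (-l x)`, with the drift removed. -/
lemma lintegral_exp_mul (hν : HasDriftAndLevyMeasure P Z Y q dZ dY ν) {a b l : ℝ} (ha : 0 ≤ a)
    (hb : 0 ≤ b) (hl : 0 ≤ l) :
    ∫⁻ r, ENNReal.ofReal (Real.exp (-(a * r.1) - b * r.2) * (1 - Real.exp (-(l * r.2)))) ∂ν +
      ENNReal.ofReal (dY * l) =
    ENNReal.ofReal (laplaceExponent P Z Y a (b + l) - laplaceExponent P Z Y a b) := by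
  have i1 := integrable_one_sub_exp hν ha hb
  have i2 := integrable_one_sub_exp hν ha (add_nonneg hb hl)
  have e : ∀ r : ℝ × ℝ, Real.exp (-(a * r.1) - b * r.2) * (1 - Real.exp (-(l * r.2))) =
      (1 - Real.exp (-(a * r.1) - (b + l) * r.2)) - (1 - Real.exp (-(a * r.1) - b * r.2)) := by
    intro r
    have : Real.exp (-(a * r.1) - (b + l) * r.2) =
        Real.exp (-(a * r.1) - b * r.2) * Real.exp (-(l * r.2)) := by
      rw [← Real.exp_add]; congr 1; ring
    rw [this]; ring
  have hpos : 0 ≤ᵐ[ν] fun r : ℝ × ℝ =>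
      Real.exp (-(a * r.1) - b * r.2) * (1 - Real.exp (-(l * r.2))) := by
    filter_upwards [ae_support hν] with r hr
    refine mul_nonneg (Real.exp_pos _).le (sub_nonneg.2 (Real.exp_le_one_iff.2 ?_))
    have := mul_nonneg hl hr.2.1
    linarith
  have hint : Integrable (fun r : ℝ × ℝ =>
      Real.exp (-(a * r.1) - b * r.2) * (1 - Real.exp (-(l * r.2)))) ν := by
    simp_rw [e]; exact i2.sub i1
  rw [← ofReal_integral_eq_lintegral_ofReal hint hpos,
    ← ENNReal.ofReal_add (integral_nonneg_of_ae hpos) (mul_nonneg hν.drift_snd_nonneg hl)]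
  congr 1
  simp_rw [e]
  rw [integral_sub i2 i1, exponent_eq hν ha hb, exponent_eq hν ha (add_nonneg hb hl)]
  ring

end HasDriftAndLevyMeasure

section Renewal

variable {Ω : Type*} [MeasurableSpace Ω] {P : Measure Ω} [IsProbabilityMeasure P]
  {Z Y : ℝ≥0 → Ω → ℝ}

namespace Subordinator

/-- The laws of `(Z_s, Y_s)` depend measurably on `s`. -/
lemma measurable_law (h : IsBivariateSubordinator P Z Y) :
    Measurable fun s : ℝ => P.map (fun ω => (Z s.toNNReal ω, Y s.toNNReal ω)) := by
  have hval : ∀ s a b, P.map (fun ω => (Z s ω, Y s ω)) (Iic a ×ˢ Iic b)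
      = P {ω | Z s ω ≤ a ∧ Y s ω ≤ b} := by
    intro s a b
    rw [Measure.map_apply (measurable_pair h s) (measurableSet_Iic.prod measurableSet_Iic)]
    rfl
  have hanti : ∀ a b, Antitone (fun s => P {ω | Z s ω ≤ a ∧ Y s ω ≤ b}) := by
    intro a b r s hrs
    apply measure_mono_ae
    filter_upwards [h.monotone] with ω hω hs
    exact ⟨(hω.1 hrs).trans hs.1, (hω.2 hrs).trans hs.2⟩
  have hmeas : Measurable (fun s => P.map (fun ω => (Z s ω, Y s ω))) := by
    have : ∀ s, IsProbabilityMeasure (P.map (fun ω => (Z s ω, Y s ω))) := fun s =>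
      Measure.isProbabilityMeasure_map (measurable_pair h s).aemeasurable
    refine Measurable.measure_of_isPiSystem_of_isProbabilityMeasure
      (S := image2 (· ×ˢ ·) (range Iic) (range Iic)) ?_ (isPiSystem_Iic.prod isPiSystem_Iic) ?_
    · have hs : IsCountablySpanning (range (Iic : ℝ → Set ℝ)) := by
        refine ⟨fun n : ℕ => Iic (n : ℝ), fun n => ⟨_, rfl⟩, ?_⟩
        ext x
        simpa using exists_nat_ge x
      have := generateFrom_prod_eq hs hs
      rw [← borel_eq_generateFrom_Iic, ← BorelSpace.measurable_eq] at this
      exact this.symm ▸ rfl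
    · rintro _ ⟨_, ⟨a, rfl⟩, _, ⟨b, rfl⟩, rfl⟩
      simp only [hval]
      exact (hanti a b).measurable
  exact hmeas.comp measurable_real_toNNReal

lemma measurable_lintegral_eval (h : IsBivariateSubordinator P Z Y) {f : ℝ × ℝ → ℝ≥0∞}
    (hf : Measurable f) :
    Measurable fun s : ℝ => ∫⁻ ω, f (Z s.toNNReal ω, Y s.toNNReal ω) ∂P := by
  have := (Measure.measurable_lintegral hf).comp (measurable_law h)
  convert this using 1
  funext s
  exact (lintegral_map hf (measurable_pair h _)).symm

lemma lintegral_renewalMeasure (h : IsBivariateSubordinator P Z Y) (q : ℝ) {f : ℝ × ℝ → ℝ≥0∞}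
    (hf : Measurable f) :
    ∫⁻ p, f p ∂renewalMeasure P Z Y q = ∫⁻ s in Ioi (0 : ℝ), ENNReal.ofReal (Real.exp (-(q * s))) *
      ∫⁻ ω, f (Z s.toNNReal ω, Y s.toNNReal ω) ∂P := by
  rw [renewalMeasure, Measure.lintegral_bind (measurable_law h).aemeasurable hf.aemeasurable]
  have e : ∀ s : ℝ, ∫⁻ p, f p ∂P.map (fun ω => (Z s.toNNReal ω, Y s.toNNReal ω)) =
      ∫⁻ ω, f (Z s.toNNReal ω, Y s.toNNReal ω) ∂P := fun s =>
    lintegral_map hf (measurable_pair h _)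
  simp_rw [e]
  rw [lintegral_withDensity_eq_lintegral_mul _ (by fun_prop) (measurable_lintegral_eval h hf)]
  rfl

/-- The Laplace transform of the renewal measure is `1 / (q + ψ)`. -/
lemma lintegral_exp_renewalMeasure (h : IsBivariateSubordinator P Z Y) {q a b : ℝ}
    (ha : 0 ≤ a) (hb : 0 ≤ b) (hpos : 0 < q + laplaceExponent P Z Y a b) :
    ∫⁻ p, ENNReal.ofReal (Real.exp (-(a * p.1) - b * p.2)) ∂renewalMeasure P Z Y q =
      ENNReal.ofReal (1 / (q + laplaceExponent P Z Y a b)) := by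
  rw [lintegral_renewalMeasure h q (measurable_exp_lin a b)]
  have e : ∀ s ∈ Ioi (0 : ℝ), ENNReal.ofReal (Real.exp (-(q * s))) *
      ∫⁻ ω, ENNReal.ofReal (Real.exp (-(a * Z s.toNNReal ω) - b * Y s.toNNReal ω)) ∂P =
      ENNReal.ofReal (Real.exp (-(q + laplaceExponent P Z Y a b) * s)) := by
    intro s hs
    rw [lintegral_exp h ha hb, ← ENNReal.ofReal_mul (Real.exp_pos _).le, ← Real.exp_add,
      Real.coe_toNNReal s (le_of_lt hs)]
    congr 2
    ring
  rw [setLIntegral_congr_fun measurableSet_Ioi e,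
    ← ofReal_integral_eq_lintegral_ofReal (integrableOn_exp_mul_Ioi (by linarith) 0)
      (Eventually.of_forall fun _ => (Real.exp_pos _).le), integral_exp_mul_Ioi (by linarith)]
  congr 1
  rw [mul_zero, Real.exp_zero, neg_div_neg_eq]

lemma renewalMeasure_ae_nonneg (h : IsBivariateSubordinator P Z Y) (q : ℝ) :
    ∀ᵐ p ∂renewalMeasure P Z Y q, 0 ≤ p.1 ∧ 0 ≤ p.2 := by
  have hS : MeasurableSet {p : ℝ × ℝ | ¬ (0 ≤ p.1 ∧ 0 ≤ p.2)} :=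
    ((measurableSet_le measurable_const measurable_fst).inter
      (measurableSet_le measurable_const measurable_snd)).compl
  rw [ae_iff, ← lintegral_indicator_one hS,
    lintegral_renewalMeasure h q (measurable_one.indicator hS)]
  have : ∀ s : ℝ≥0, ∫⁻ ω, {p : ℝ × ℝ | ¬ (0 ≤ p.1 ∧ 0 ≤ p.2)}.indicator (1 : ℝ × ℝ → ℝ≥0∞)
      (Z s ω, Y s ω) ∂P = 0 := fun s => by
    refine (lintegral_eq_zero_iff ((measurable_one.indicator hS).comp (measurable_pair h s))).2 ?_
    filter_upwards [ae_nonneg h] with ω hω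
    exact indicator_of_notMem (by simp [hω s]) _
  simp only [this, mul_zero, lintegral_zero]

lemma sFinite_renewalMeasure (h : IsBivariateSubordinator P Z Y) {q : ℝ}
    (hpos : 0 < q + laplaceExponent P Z Y 0 1) : SFinite (renewalMeasure P Z Y q) := by
  refine sFinite_of_lintegral_ne_top (measurable_exp_lin 0 1) ?_
    (fun _ => ENNReal.ofReal_ne_top) ?_
  · exact Eventually.of_forall fun p => (ENNReal.ofReal_pos.2 (Real.exp_pos _)).ne'
  · rw [lintegral_exp_renewalMeasure h le_rfl zero_le_one hpos]
    exact ENNReal.ofReal_ne_top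

end Subordinator

end Renewal

/-! ### The passage data integrated over the level -/

lemma lintegral_exp_Ico {l α β : ℝ} (hl : 0 < l) (hαβ : α ≤ β) :
    ∫⁻ v in Ico α β, ENNReal.ofReal (Real.exp (-(l * v))) =
      ENNReal.ofReal ((Real.exp (-(l * α)) - Real.exp (-(l * β))) / l) := by
  have hc : Continuous fun v : ℝ => Real.exp (-(l * v)) := by fun_prop
  rw [← ofReal_integral_eq_lintegral_ofReal]
  · congr 1
    rw [integral_Ico_eq_integral_Ioc, ← intervalIntegral.integral_of_le hαβ]
    have hd : ∀ v ∈ uIcc α β, HasDerivAt (fun v => Real.exp (-(l * v)) * -l⁻¹)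
        (Real.exp (-(l * v))) v := fun v _ => by
      have h1 : HasDerivAt (fun v : ℝ => -(l * v)) (-l) v := by
        simpa using (hasDerivAt_id v).const_mul (-l)
      refine (h1.exp.mul_const (-l⁻¹)).congr_deriv ?_
      field_simp
    rw [intervalIntegral.integral_eq_sub_of_hasDerivAt hd (hc.intervalIntegrable _ _)]
    ring
  · exact (hc.integrableOn_Icc (a := α) (b := β)).mono_set Ico_subset_Icc_self
  · exact Eventually.of_forall fun v => (Real.exp_pos _).le

lemma tendsto_mesh_real : Tendsto (fun n => (mesh n : ℝ)) atTop (𝓝[≠] 0) := by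
  refine tendsto_nhdsWithin_iff.2 ⟨NNReal.tendsto_coe.2 tendsto_mesh, ?_⟩
  exact Eventually.of_forall fun n => by simpa using (mesh_pos n).ne'

lemma tendsto_exp_diff_div (β₁ β₂ : ℝ) :
    Tendsto (fun n => (Real.exp (-(mesh n * β₁)) - Real.exp (-(mesh n * β₂))) / mesh n) atTop
      (𝓝 (β₂ - β₁)) := by
  have h1 : ∀ β : ℝ, HasDerivAt (fun t : ℝ => Real.exp (-(t * β))) (-β) 0 := fun β => by
    have : HasDerivAt (fun t : ℝ => -(t * β)) (-β) 0 := by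
      simpa using (hasDerivAt_id (0 : ℝ)).mul_const (-β)
    simpa using this.exp
  have h2 := (h1 β₁).sub (h1 β₂)
  rw [hasDerivAt_iff_tendsto_slope_zero] at h2
  have h3 := h2.comp tendsto_mesh_real
  rw [show β₂ - β₁ = -β₁ - -β₂ by ring]
  refine h3.congr fun n => ?_
  simp [div_eq_inv_mul]

/-- The small-mesh limit of the Laplace transform of the passage data of the grid. -/
lemma tendsto_grid_transform {q l β₁ β₂ κ : ℝ} (hl : 0 < l) (hκ : 0 < κ) :
    Tendsto (fun n => ENNReal.ofReal (Real.exp (-(q * mesh n))) *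
      ENNReal.ofReal ((Real.exp (-(mesh n * β₁)) - Real.exp (-(mesh n * β₂))) / l) *
      (1 - ENNReal.ofReal (Real.exp (-(mesh n * κ))))⁻¹) atTop
      (𝓝 (ENNReal.ofReal ((β₂ - β₁) / (l * κ)))) := by
  have hlt : ∀ n, Real.exp (-(mesh n * κ)) < 1 := fun n => by
    rw [Real.exp_lt_one_iff, neg_lt_zero]
    exact mul_pos (by exact_mod_cast mesh_pos n) hκ
  have e : ∀ n, ENNReal.ofReal (Real.exp (-(q * mesh n))) *
      ENNReal.ofReal ((Real.exp (-(mesh n * β₁)) - Real.exp (-(mesh n * β₂))) / l) *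
      (1 - ENNReal.ofReal (Real.exp (-(mesh n * κ))))⁻¹ =
      ENNReal.ofReal (Real.exp (-(q * mesh n)) *
        (((Real.exp (-(mesh n * β₁)) - Real.exp (-(mesh n * β₂))) / mesh n) /
          ((Real.exp (-(mesh n * 0)) - Real.exp (-(mesh n * κ))) / mesh n)) / l) := by
    intro n
    have hm : (mesh n : ℝ) ≠ 0 := by exact_mod_cast (mesh_pos n).ne'
    have h1 : 0 < 1 - Real.exp (-(mesh n * κ)) := sub_pos.2 (hlt n)
    rw [← ENNReal.ofReal_one, ← ENNReal.ofReal_sub _ (Real.exp_pos _).le,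
      ← ENNReal.ofReal_inv_of_pos h1, ← ENNReal.ofReal_mul (Real.exp_pos _).le,
      ← ENNReal.ofReal_mul' (inv_pos.2 h1).le]
    congr 1
    simp only [mul_zero, neg_zero, Real.exp_zero]
    field_simp
  simp_rw [e]
  refine (ENNReal.continuous_ofReal.tendsto _).comp ?_
  have hq : Tendsto (fun n => Real.exp (-(q * mesh n))) atTop (𝓝 1) := by
    have : Tendsto (fun n => (mesh n : ℝ)) atTop (𝓝 0) :=
      tendsto_mesh_real.mono_right nhdsWithin_le_nhds
    have := (Real.continuous_exp.tendsto _).comp ((this.const_mul q).neg)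
    rw [mul_zero, neg_zero, Real.exp_zero] at this
    exact this
  have h2 := tendsto_exp_diff_div 0 κ
  rw [sub_zero] at h2
  have := (hq.mul ((tendsto_exp_diff_div β₁ β₂).div h2 hκ.ne')).div_const l
  refine this.congr' ?_ |>.trans ?_
  · exact Eventually.of_forall fun n => rfl
  · rw [one_mul, div_div, mul_comm κ l]

open Classical in
/-- The discount `e^{-q T}` on the event that the first passage time `T` over `v` is finite. -/
noncomputable def passWeight (q : ℝ) (w : ℝ≥0 → ℝ × ℝ) (v : ℝ) : ℝ≥0∞ :=
  if Passes w v then ENNReal.ofReal (Real.exp (-(q * passTime w v))) else 0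

/-- The exponential test function in the variables `(X_{T-}, ΔX_T)`. -/
noncomputable def expTest (a₁ a₂ b₁ b₂ : ℝ) (p r : ℝ × ℝ) : ℝ :=
  Real.exp ((-(a₁ * p.1) - a₂ * p.2) + (-(b₁ * r.1) - b₂ * r.2))

open Classical in
/-- The discounted exponential test function of the passage data of a grid. -/
noncomputable def cellTest (q a₁ a₂ b₁ b₂ : ℝ) (h : ℝ≥0) (w : ℝ≥0 → ℝ × ℝ) (v : ℝ) : ℝ≥0∞ :=
  if Passes w v then
    ENNReal.ofReal (Real.exp (-(q * (cellData h w v).1)) *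
      expTest a₁ a₂ b₁ b₂ (cellData h w v).2.1 (cellData h w v).2.2) else 0

lemma cellTest_eq_tsum {q a₁ a₂ b₁ b₂ v : ℝ} {h : ℝ≥0} {w : ℝ≥0 → ℝ × ℝ} (hw : IsRegularPath w)
    (hh : 0 < h) (hv : 0 ≤ v) :
    cellTest q a₁ a₂ b₁ b₂ h w v = ∑' k : ℕ,
      (Ico (w (k * h)).2 (w ((k + 1 : ℕ) * h)).2).indicator (fun _ =>
        ENNReal.ofReal (Real.exp (-(q * ((k + 1 : ℕ) * h))) *
          expTest a₁ a₂ b₁ b₂ (w (k * h)) (w ((k + 1 : ℕ) * h) - w (k * h)))) v := by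
  by_cases hp : Passes w v
  · rw [tsum_eq_single (passCell h w v)]
    · have hmem : v ∈ Ico (w ((passCell h w v : ℕ) * h)).2 (w ((passCell h w v + 1 : ℕ) * h)).2 :=
        ⟨passCell_le hw hv, lt_of_passCell hw hh hp⟩
      rw [indicator_of_mem hmem, cellTest, if_pos hp]
      simp only [cellData, NNReal.coe_mul, NNReal.coe_natCast]
    · intro k hk
      refine indicator_of_notMem (fun hc => hk ?_) _
      exact (passCell_eq hw hh hv hc.1 hc.2).symm
  · rw [cellTest, if_neg hp]
    symm
    rw [ENNReal.tsum_eq_zero]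
    intro k
    refine indicator_of_notMem ?_ _
    intro hc
    exact hp ⟨_, hc.2⟩

/-- The level integral of the discretised test function, path by path. -/
lemma lintegral_cellTest {q l a₁ a₂ b₁ b₂ : ℝ} {h : ℝ≥0} {w : ℝ≥0 → ℝ × ℝ} (hl : 0 < l)
    (hw : IsRegularPath w) (hh : 0 < h) :
    ∫⁻ v in Ioi (0 : ℝ), ENNReal.ofReal (Real.exp (-(l * v))) * cellTest q a₁ a₂ b₁ b₂ h w v =
      ∑' k : ℕ, ENNReal.ofReal (Real.exp (-(q * ((k + 1 : ℕ) * h)))) *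
        (ENNReal.ofReal (Real.exp (-(a₁ * (w (k * h)).1) - (a₂ + l) * (w (k * h)).2)) *
        ENNReal.ofReal (Real.exp (-(b₁ * (w ((k + 1 : ℕ) * h) - w (k * h)).1) -
          b₂ * (w ((k + 1 : ℕ) * h) - w (k * h)).2) *
          (1 - Real.exp (-(l * (w ((k + 1 : ℕ) * h) - w (k * h)).2))) / l)) := by
  rw [Measure.restrict_congr_set Ioi_ae_eq_Ici,
    setLIntegral_congr_fun measurableSet_Ici (g := fun v => ∑' k : ℕ,
      (Ico (w (k * h)).2 (w ((k + 1 : ℕ) * h)).2).indicator (fun v =>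
        ENNReal.ofReal (Real.exp (-(q * ((k + 1 : ℕ) * h))) *
          expTest a₁ a₂ b₁ b₂ (w (k * h)) (w ((k + 1 : ℕ) * h) - w (k * h))) *
        ENNReal.ofReal (Real.exp (-(l * v)))) v)]
  · rw [lintegral_tsum (fun k => (Measurable.indicator (by fun_prop)
      measurableSet_Ico).aemeasurable)]
    refine tsum_congr fun k => ?_
    have hmono : (w (k * h)).2 ≤ (w ((k + 1 : ℕ) * h)).2 := hw.mono_snd (by gcongr; simp)
    have hsub : Ico (w (k * h)).2 (w ((k + 1 : ℕ) * h)).2 ⊆ Ici 0 := fun v hv =>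
      (hw.nonneg_snd _).trans hv.1
    rw [lintegral_indicator measurableSet_Ico, Measure.restrict_restrict measurableSet_Ico,
      inter_eq_left.2 hsub, lintegral_const_mul _ (by fun_prop), lintegral_exp_Ico hl hmono,
      ← ENNReal.ofReal_mul (by unfold expTest; positivity),
      ← ENNReal.ofReal_mul (Real.exp_pos _).le, ← ENNReal.ofReal_mul (Real.exp_pos _).le]
    congr 1
    simp only [expTest, Prod.fst_sub, Prod.snd_sub]
    have e1 : Real.exp (-(l * (w (k * h)).2)) - Real.exp (-(l * (w ((k + 1 : ℕ) * h)).2)) =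
        Real.exp (-(l * (w (k * h)).2)) *
          (1 - Real.exp (-(l * ((w ((k + 1 : ℕ) * h)).2 - (w (k * h)).2)))) := by
      rw [mul_sub, mul_one, ← Real.exp_add]
      congr 2
      ring
    have e2 : Real.exp (-(a₁ * (w (k * h)).1) - (a₂ + l) * (w (k * h)).2) =
        Real.exp (-(a₁ * (w (k * h)).1) - a₂ * (w (k * h)).2) *
          Real.exp (-(l * (w (k * h)).2)) := by
      rw [← Real.exp_add]
      congr 1
      ring
    rw [e1, e2, Real.exp_add]
    ring
  · intro v hv
    dsimp only
    rw [cellTest_eq_tsum hw hh hv, ← ENNReal.tsum_mul_left]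
    refine tsum_congr fun k => ?_
    by_cases hm : v ∈ Ico (w (k * h)).2 (w ((k + 1 : ℕ) * h)).2
    · rw [indicator_of_mem hm, indicator_of_mem hm, mul_comm]
    · rw [indicator_of_notMem hm, indicator_of_notMem hm, mul_zero]

section Transform

variable {Ω : Type*} [MeasurableSpace Ω] {P : Measure Ω} [IsProbabilityMeasure P]
  {Z Y : ℝ≥0 → Ω → ℝ}

namespace Subordinator

lemma lintegral_exp_mul_one_sub (h : IsBivariateSubordinator P Z Y) {b₁ b₂ l : ℝ} (hb₁ : 0 ≤ b₁)
    (hb₂ : 0 ≤ b₂) (hl : 0 < l) (s : ℝ≥0) :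
    ∫⁻ ω, ENNReal.ofReal (Real.exp (-(b₁ * Z s ω) - b₂ * Y s ω) *
      (1 - Real.exp (-(l * Y s ω))) / l) ∂P =
    ENNReal.ofReal ((Real.exp (-(s * laplaceExponent P Z Y b₁ b₂)) -
      Real.exp (-(s * laplaceExponent P Z Y b₁ (b₂ + l)))) / l) := by
  have hm1 := (measurable_exp_lin b₁ b₂).comp (measurable_pair h s)
  have hm2 := (measurable_exp_lin b₁ (b₂ + l)).comp (measurable_pair h s)
  have i2 := lintegral_exp h hb₁ (add_nonneg hb₂ hl.le) s
  have e : ∀ ω, ENNReal.ofReal (Real.exp (-(b₁ * Z s ω) - b₂ * Y s ω) *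
      (1 - Real.exp (-(l * Y s ω))) / l) =
      (ENNReal.ofReal (Real.exp (-(b₁ * Z s ω) - b₂ * Y s ω)) -
        ENNReal.ofReal (Real.exp (-(b₁ * Z s ω) - (b₂ + l) * Y s ω))) * ENNReal.ofReal l⁻¹ := by
    intro ω
    rw [← ENNReal.ofReal_sub _ (Real.exp_pos _).le, ← ENNReal.ofReal_mul' (inv_pos.2 hl).le]
    congr 1
    have : Real.exp (-(b₁ * Z s ω) - (b₂ + l) * Y s ω) =
        Real.exp (-(b₁ * Z s ω) - b₂ * Y s ω) * Real.exp (-(l * Y s ω)) := by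
      rw [← Real.exp_add]; congr 1; ring
    rw [this]
    ring
  simp_rw [e]
  have hsub := lintegral_sub (μ := P) hm2 (f := (fun p : ℝ × ℝ =>
      ENNReal.ofReal (Real.exp (-(b₁ * p.1) - b₂ * p.2))) ∘ fun ω => (Z s ω, Y s ω))
    (by
      change ∫⁻ ω, ENNReal.ofReal (Real.exp (-(b₁ * Z s ω) - (b₂ + l) * Y s ω)) ∂P ≠ ∞
      rw [i2]; exact ENNReal.ofReal_ne_top)
    (by
      filter_upwards [ae_nonneg h] with ω hω
      refine ENNReal.ofReal_le_ofReal (Real.exp_le_exp.2 ?_)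
      have := mul_nonneg hl.le (hω s).2
      dsimp only
      linarith)
  rw [lintegral_mul_const' _ _ ENNReal.ofReal_ne_top]
  have hsub' : ∫⁻ ω, (ENNReal.ofReal (Real.exp (-(b₁ * Z s ω) - b₂ * Y s ω)) -
        ENNReal.ofReal (Real.exp (-(b₁ * Z s ω) - (b₂ + l) * Y s ω))) ∂P =
      ENNReal.ofReal (Real.exp (-(s * laplaceExponent P Z Y b₁ b₂))) -
      ENNReal.ofReal (Real.exp (-(s * laplaceExponent P Z Y b₁ (b₂ + l)))) := by
    rw [← lintegral_exp h hb₁ hb₂ s, ← i2]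
    exact hsub
  rw [hsub', ← ENNReal.ofReal_sub _ (Real.exp_pos _).le, ← ENNReal.ofReal_mul' (inv_pos.2 hl).le,
    div_eq_mul_inv]

/-- The Laplace transform, in the level and in the passage data of a grid of mesh `h`. -/
lemma lintegral_lintegral_cellTest (h : IsBivariateSubordinator P Z Y) {q l a₁ a₂ b₁ b₂ : ℝ}
    (hl : 0 < l) (ha₁ : 0 ≤ a₁) (ha₂ : 0 ≤ a₂) (hb₁ : 0 ≤ b₁) (hb₂ : 0 ≤ b₂) {δ : ℝ≥0}
    (hδ : 0 < δ) :
    ∫⁻ ω, (∫⁻ v in Ioi (0 : ℝ), ENNReal.ofReal (Real.exp (-(l * v))) *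
      cellTest q a₁ a₂ b₁ b₂ δ (path Z Y ω) v) ∂P =
    ENNReal.ofReal (Real.exp (-(q * δ))) *
      ENNReal.ofReal ((Real.exp (-(δ * laplaceExponent P Z Y b₁ b₂)) -
        Real.exp (-(δ * laplaceExponent P Z Y b₁ (b₂ + l)))) / l) *
      (1 - ENNReal.ofReal (Real.exp (-(δ * (q + laplaceExponent P Z Y a₁ (a₂ + l))))))⁻¹ := by
  have hmg : Measurable fun r : ℝ × ℝ => ENNReal.ofReal (Real.exp (-(b₁ * r.1) - b₂ * r.2) *
      (1 - Real.exp (-(l * r.2))) / l) := by fun_prop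
  have hterm : ∀ k : ℕ, Measurable fun ω =>
      ENNReal.ofReal (Real.exp (-(a₁ * (path Z Y ω (k * δ)).1) -
        (a₂ + l) * (path Z Y ω (k * δ)).2)) *
      ENNReal.ofReal (Real.exp (-(b₁ * (path Z Y ω ((k + 1 : ℕ) * δ) - path Z Y ω (k * δ)).1) -
          b₂ * (path Z Y ω ((k + 1 : ℕ) * δ) - path Z Y ω (k * δ)).2) *
          (1 - Real.exp (-(l * (path Z Y ω ((k + 1 : ℕ) * δ) - path Z Y ω (k * δ)).2))) / l) :=
    fun k => ((measurable_exp_lin a₁ (a₂ + l)).comp (measurable_pair h _)).mul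
      (hmg.comp ((measurable_pair h _).sub (measurable_pair h _)))
  rw [lintegral_congr_ae ((ae_isRegularPath h).mono fun ω hω => lintegral_cellTest hl hω hδ),
    lintegral_tsum fun k => ((hterm k).const_mul _).aemeasurable]
  have e : ∀ k : ℕ, ∫⁻ ω, ENNReal.ofReal (Real.exp (-(q * ((k + 1 : ℕ) * δ)))) *
      (ENNReal.ofReal (Real.exp (-(a₁ * (path Z Y ω (k * δ)).1) -
        (a₂ + l) * (path Z Y ω (k * δ)).2)) *
      ENNReal.ofReal (Real.exp (-(b₁ * (path Z Y ω ((k + 1 : ℕ) * δ) - path Z Y ω (k * δ)).1) -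
          b₂ * (path Z Y ω ((k + 1 : ℕ) * δ) - path Z Y ω (k * δ)).2) *
          (1 - Real.exp (-(l * (path Z Y ω ((k + 1 : ℕ) * δ) - path Z Y ω (k * δ)).2))) / l)) ∂P =
      ENNReal.ofReal (Real.exp (-(q * δ))) *
      ENNReal.ofReal ((Real.exp (-(δ * laplaceExponent P Z Y b₁ b₂)) -
        Real.exp (-(δ * laplaceExponent P Z Y b₁ (b₂ + l)))) / l) *
      ENNReal.ofReal (Real.exp (-(δ * (q + laplaceExponent P Z Y a₁ (a₂ + l))))) ^ k := by
    intro k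
    rw [lintegral_const_mul _ (hterm k)]
    have h1 := lintegral_mul_increment h (k * δ) δ (measurable_exp_lin a₁ (a₂ + l)) hmg
    have h2 : (k : ℝ≥0) * δ + δ = (k + 1 : ℕ) * δ := by push_cast; ring
    rw [h2] at h1
    have h3 := h1.trans (congrArg₂ (· * ·)
      (lintegral_exp h ha₁ (add_nonneg ha₂ hl.le) (k * δ))
      (lintegral_exp_mul_one_sub h hb₁ hb₂ hl δ))
    refine (congrArg _ h3).trans ?_
    rw [← ENNReal.ofReal_pow (Real.exp_pos _).le, ← Real.exp_nat_mul, ← mul_assoc,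
      ← ENNReal.ofReal_mul (Real.exp_pos _).le, ← Real.exp_add, mul_comm,
      mul_comm (ENNReal.ofReal (Real.exp (-(q * δ)))), mul_assoc,
      ← ENNReal.ofReal_mul (Real.exp_pos _).le, ← Real.exp_add]
    congr 3
    push_cast
    ring_nf
  simp_rw [e]
  rw [ENNReal.tsum_mul_left, ENNReal.tsum_geometric]

end Subordinator

end Transform

/-- Weight and passage data are, almost surely, jointly measurable in level and `ω`. -/
lemma Subordinator.exists_measurable_passWeight {Ω : Type*} [MeasurableSpace Ω] {P : Measure Ω}
    {Z Y : ℝ≥0 → Ω → ℝ} (h : IsBivariateSubordinator P Z Y) (q : ℝ) :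
    ∃ (W : ℝ × Ω → ℝ≥0∞) (A : ℝ × Ω → (ℝ × ℝ) × (ℝ × ℝ)), Measurable W ∧ Measurable A ∧
      ∀ ω, IsRegularPath (path Z Y ω) → ∀ v, 0 ≤ v →
        W (v, ω) = passWeight q (path Z Y ω) v ∧
        A (v, ω) = (prePassage (path Z Y ω) v, passJump (path Z Y ω) v) := by
  obtain ⟨S, hS, hS'⟩ := exists_measurableSet_passes
  obtain ⟨D, hD, hD'⟩ := exists_measurable_passData
  have hpath : Measurable fun x : ℝ × Ω => (x.1, path Z Y x.2) :=
    measurable_fst.prodMk ((Subordinator.measurable_path h).comp measurable_snd)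
  refine ⟨fun x => S.indicator (fun y => ENNReal.ofReal (Real.exp (-(q * (D y).1))))
    (x.1, path Z Y x.2), fun x => (D (x.1, path Z Y x.2)).2,
    (Measurable.indicator (by fun_prop) hS).comp hpath, (hD.comp hpath).snd, ?_⟩
  intro ω hω v hv
  refine ⟨?_, congrArg Prod.snd (hD' _ hω v hv)⟩
  dsimp only
  unfold passWeight
  by_cases hp : Passes (path Z Y ω) v
  · rw [indicator_of_mem ((hS' _ hω _).2 hp), if_pos hp, hD' _ hω v hv]; rfl
  · rw [indicator_of_notMem (fun hc => hp ((hS' _ hω _).1 hc)), if_neg hp]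

section Master

variable {Ω : Type*} [MeasurableSpace Ω] {P : Measure Ω} [IsProbabilityMeasure P]
  {Z Y : ℝ≥0 → Ω → ℝ} {q dZ dY : ℝ} {ν : Measure (ℝ × ℝ)}

lemma cellTest_le_one {q a₁ a₂ b₁ b₂ v : ℝ} {δ : ℝ≥0} {w : ℝ≥0 → ℝ × ℝ} (hw : IsRegularPath w)
    (hq : 0 ≤ q) (ha₁ : 0 ≤ a₁) (ha₂ : 0 ≤ a₂) (hb₁ : 0 ≤ b₁) (hb₂ : 0 ≤ b₂) :
    cellTest q a₁ a₂ b₁ b₂ δ w v ≤ 1 := by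
  unfold cellTest
  split_ifs
  · rw [← ENNReal.ofReal_one]
    refine ENNReal.ofReal_le_ofReal ?_
    unfold expTest
    rw [← Real.exp_add, Real.exp_le_one_iff]
    simp only [cellData, Prod.fst_sub, Prod.snd_sub]
    set k := passCell δ w v
    have hle : (k : ℝ≥0) * δ ≤ (k + 1 : ℕ) * δ := by gcongr; simp
    have h1 := mul_nonneg ha₁ (hw.nonneg_fst (k * δ))
    have h2 := mul_nonneg ha₂ (hw.nonneg_snd (k * δ))
    have h3 := mul_nonneg hb₁ (sub_nonneg.2 (hw.mono_fst hle))
    have h4 := mul_nonneg hb₂ (sub_nonneg.2 (hw.mono_snd hle))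
    have h5 := mul_nonneg hq (NNReal.coe_nonneg ((k + 1 : ℕ) * δ))
    simp only [NNReal.coe_mul] at h5 ⊢
    linarith
  · exact zero_le

lemma tendsto_cellTest {q a₁ a₂ b₁ b₂ v : ℝ} {w : ℝ≥0 → ℝ × ℝ} (hw : IsRegularPath w)
    (hv : 0 ≤ v) :
    Tendsto (fun n => cellTest q a₁ a₂ b₁ b₂ (mesh n) w v) atTop
      (𝓝 (passWeight q w v *
        ENNReal.ofReal (expTest a₁ a₂ b₁ b₂ (prePassage w v) (passJump w v)))) := by
  unfold cellTest passWeight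
  by_cases hp : Passes w v
  · simp only [if_pos hp]
    rw [← ENNReal.ofReal_mul (Real.exp_pos _).le]
    have hc : Continuous fun d : ℝ≥0 × (ℝ × ℝ) × (ℝ × ℝ) =>
        ENNReal.ofReal (Real.exp (-(q * d.1)) * expTest a₁ a₂ b₁ b₂ d.2.1 d.2.2) := by
      unfold expTest
      exact ENNReal.continuous_ofReal.comp (by fun_prop)
    exact (hc.tendsto (passData w v)).comp (tendsto_cellData hw hv)
  · simp only [if_neg hp, zero_mul]
    exact tendsto_const_nhds

namespace Subordinator

lemma ae_prod_isRegularPath (h : IsBivariateSubordinator P Z Y) :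
    ∀ᵐ x ∂(volume.restrict (Ioi (0 : ℝ))).prod P, 0 < x.1 ∧ IsRegularPath (path Z Y x.2) := by
  have h1 : ∀ᵐ x ∂(volume.restrict (Ioi (0 : ℝ))).prod P, 0 < x.1 :=
    Measure.quasiMeasurePreserving_fst.ae (ae_restrict_mem measurableSet_Ioi)
  have h2 : ∀ᵐ x ∂(volume.restrict (Ioi (0 : ℝ))).prod P, IsRegularPath (path Z Y x.2) :=
    Measure.quasiMeasurePreserving_snd.ae (ae_isRegularPath h)
  exact h1.and h2

/-- The joint Laplace transform of the passage data, with the level integrated out. -/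
lemma lintegral_passWeight_expTest (h : IsBivariateSubordinator P Z Y) {l a₁ a₂ b₁ b₂ : ℝ}
    (hq : 0 ≤ q) (hl : 0 < l) (ha₁ : 0 ≤ a₁) (ha₂ : 0 ≤ a₂) (hb₁ : 0 ≤ b₁) (hb₂ : 0 ≤ b₂)
    (hκ : 0 < q + laplaceExponent P Z Y a₁ (a₂ + l)) :
    ∫⁻ x, ENNReal.ofReal (Real.exp (-(l * x.1))) * (passWeight q (path Z Y x.2) x.1 *
        ENNReal.ofReal (expTest a₁ a₂ b₁ b₂ (prePassage (path Z Y x.2) x.1)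
          (passJump (path Z Y x.2) x.1))) ∂(volume.restrict (Ioi (0 : ℝ))).prod P =
      ENNReal.ofReal ((laplaceExponent P Z Y b₁ (b₂ + l) - laplaceExponent P Z Y b₁ b₂) /
        (l * (q + laplaceExponent P Z Y a₁ (a₂ + l)))) := by
  obtain ⟨S, hS, hS'⟩ := exists_measurableSet_passes
  have hpath : Measurable fun x : ℝ × Ω => (x.1, path Z Y x.2) :=
    measurable_fst.prodMk ((measurable_path h).comp measurable_snd)
  let H : ℕ → ℝ × Ω → ℝ≥0∞ := fun n x => ENNReal.ofReal (Real.exp (-(l * x.1))) *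
    S.indicator (fun y => ENNReal.ofReal (Real.exp (-(q * (cellData (mesh n) y.2 y.1).1)) *
      expTest a₁ a₂ b₁ b₂ (cellData (mesh n) y.2 y.1).2.1 (cellData (mesh n) y.2 y.1).2.2))
      (x.1, path Z Y x.2)
  have hmd : Measurable fun d : ℝ≥0 × (ℝ × ℝ) × (ℝ × ℝ) =>
      ENNReal.ofReal (Real.exp (-(q * d.1)) * expTest a₁ a₂ b₁ b₂ d.2.1 d.2.2) := by
    unfold expTest; fun_prop
  have hHm : ∀ n, Measurable (H n) := fun n =>
    Measurable.mul (by fun_prop)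
      (((hmd.comp (measurable_cellData (mesh n))).indicator hS).comp hpath)
  have hH : ∀ n x, IsRegularPath (path Z Y x.2) → H n x =
      ENNReal.ofReal (Real.exp (-(l * x.1))) *
        cellTest q a₁ a₂ b₁ b₂ (mesh n) (path Z Y x.2) x.1 := by
    intro n x hx
    simp only [H, cellTest]
    congr 1
    by_cases hp : Passes (path Z Y x.2) x.1
    · rw [indicator_of_mem ((hS' _ hx _).2 hp), if_pos hp]
    · rw [indicator_of_notMem (fun hc => hp ((hS' _ hx _).1 hc)), if_neg hp]
  have hint : ∀ n, ∫⁻ x, H n x ∂(volume.restrict (Ioi (0 : ℝ))).prod P =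
      ENNReal.ofReal (Real.exp (-(q * mesh n))) *
      ENNReal.ofReal ((Real.exp (-(mesh n * laplaceExponent P Z Y b₁ b₂)) -
        Real.exp (-(mesh n * laplaceExponent P Z Y b₁ (b₂ + l)))) / l) *
      (1 - ENNReal.ofReal (Real.exp (-(mesh n * (q + laplaceExponent P Z Y a₁ (a₂ + l))))))⁻¹ := by
    intro n
    rw [← lintegral_lintegral_cellTest h hl ha₁ ha₂ hb₁ hb₂ (mesh_pos n),
      lintegral_prod_symm _ (hHm n).aemeasurable]
    refine lintegral_congr_ae ?_
    filter_upwards [ae_isRegularPath h] with ω hω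
    exact lintegral_congr fun v => hH n (v, ω) hω
  have hbound : ∫⁻ x : ℝ × Ω, ENNReal.ofReal (Real.exp (-(l * x.1)))
      ∂(volume.restrict (Ioi (0 : ℝ))).prod P ≠ ∞ := by
    rw [lintegral_prod _ (by fun_prop)]
    simp only [lintegral_const, measure_univ, mul_one]
    have e : ∀ v : ℝ, Real.exp (-(l * v)) = Real.exp (-l * v) := fun v => by rw [neg_mul]
    simp_rw [e]
    rw [← ofReal_integral_eq_lintegral_ofReal (integrableOn_exp_mul_Ioi (by linarith) 0)
      (Eventually.of_forall fun _ => (Real.exp_pos _).le)]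
    exact ENNReal.ofReal_ne_top
  have hlim := tendsto_lintegral_of_dominated_convergence
    (μ := (volume.restrict (Ioi (0 : ℝ))).prod P) (F := H)
    (f := fun x => ENNReal.ofReal (Real.exp (-(l * x.1))) * (passWeight q (path Z Y x.2) x.1 *
        ENNReal.ofReal (expTest a₁ a₂ b₁ b₂ (prePassage (path Z Y x.2) x.1)
          (passJump (path Z Y x.2) x.1))))
    (fun x => ENNReal.ofReal (Real.exp (-(l * x.1)))) hHm (fun n => ?_) hbound ?_
  · simp_rw [hint] at hlim
    exact tendsto_nhds_unique hlim (tendsto_grid_transform hl hκ)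
  · filter_upwards [ae_prod_isRegularPath h] with x hx
    rw [hH n x hx.2]
    exact mul_le_of_le_one_right' (cellTest_le_one hx.2 hq ha₁ ha₂ hb₁ hb₂)
  · filter_upwards [ae_prod_isRegularPath h] with x hx
    simp_rw [fun n => hH n x hx.2]
    exact ENNReal.Tendsto.const_mul (tendsto_cellTest hx.2 hx.1.le)
      (Or.inr ENNReal.ofReal_ne_top)

/-- The corresponding transform of `V(dp) ν(dr) dv` on the jump gaps `p₂ ≤ v < p₂ + r₂`, plus the
drift part. -/
lemma lintegral_renewal_levy_expTest (h : IsBivariateSubordinator P Z Y)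
    (hν : HasDriftAndLevyMeasure P Z Y q dZ dY ν) {l a₁ a₂ b₁ b₂ : ℝ}
    (hl : 0 < l) (ha₁ : 0 ≤ a₁) (ha₂ : 0 ≤ a₂) (hb₁ : 0 ≤ b₁) (hb₂ : 0 ≤ b₂)
    (hκ : 0 < q + laplaceExponent P Z Y a₁ (a₂ + l)) :
    ∫⁻ p, ((∫⁻ r, (∫⁻ v in Ico p.2 (p.2 + r.2), ENNReal.ofReal (Real.exp (-(l * v))) *
        ENNReal.ofReal (expTest a₁ a₂ b₁ b₂ p r)) ∂ν) +
      ENNReal.ofReal dY * (ENNReal.ofReal (Real.exp (-(l * p.2))) *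
        ENNReal.ofReal (expTest a₁ a₂ b₁ b₂ p 0))) ∂renewalMeasure P Z Y q =
      ENNReal.ofReal ((laplaceExponent P Z Y b₁ (b₂ + l) - laplaceExponent P Z Y b₁ b₂) /
        (l * (q + laplaceExponent P Z Y a₁ (a₂ + l)))) := by
  have inner : ∀ p : ℝ × ℝ, (∫⁻ r, (∫⁻ v in Ico p.2 (p.2 + r.2),
      ENNReal.ofReal (Real.exp (-(l * v))) * ENNReal.ofReal (expTest a₁ a₂ b₁ b₂ p r)) ∂ν) =
      ENNReal.ofReal (Real.exp (-(a₁ * p.1) - (a₂ + l) * p.2)) * (ENNReal.ofReal l⁻¹ *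
        ∫⁻ r, ENNReal.ofReal (Real.exp (-(b₁ * r.1) - b₂ * r.2) *
          (1 - Real.exp (-(l * r.2)))) ∂ν) := by
    intro p
    rw [← lintegral_const_mul _ (by fun_prop), ← lintegral_const_mul _ (by fun_prop)]
    refine lintegral_congr_ae ?_
    filter_upwards [HasDriftAndLevyMeasure.ae_support hν] with r hr
    rw [lintegral_mul_const _ (by fun_prop), lintegral_exp_Ico hl (by linarith [hr.2.1]),
      ← ENNReal.ofReal_mul (inv_pos.2 hl).le, ← ENNReal.ofReal_mul (Real.exp_pos _).le,
      ← ENNReal.ofReal_mul' (by unfold expTest; positivity)]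
    congr 1
    have e1 : Real.exp (-(l * (p.2 + r.2))) = Real.exp (-(l * p.2)) * Real.exp (-(l * r.2)) := by
      rw [← Real.exp_add]; congr 1; ring
    have e2 : Real.exp (-(a₁ * p.1) - (a₂ + l) * p.2) =
        Real.exp (-(a₁ * p.1) - a₂ * p.2) * Real.exp (-(l * p.2)) := by
      rw [← Real.exp_add]; congr 1; ring
    unfold expTest
    rw [e1, e2, Real.exp_add]
    ring
  have drift : ∀ p : ℝ × ℝ, ENNReal.ofReal dY * (ENNReal.ofReal (Real.exp (-(l * p.2))) *
        ENNReal.ofReal (expTest a₁ a₂ b₁ b₂ p 0)) =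
      ENNReal.ofReal (Real.exp (-(a₁ * p.1) - (a₂ + l) * p.2)) *
        (ENNReal.ofReal l⁻¹ * ENNReal.ofReal (dY * l)) := by
    intro p
    rw [← ENNReal.ofReal_mul (inv_pos.2 hl).le, ← ENNReal.ofReal_mul (Real.exp_pos _).le,
      ← ENNReal.ofReal_mul (Real.exp_pos _).le, ← ENNReal.ofReal_mul hν.drift_snd_nonneg]
    congr 1
    have e2 : Real.exp (-(a₁ * p.1) - (a₂ + l) * p.2) =
        Real.exp (-(l * p.2)) * Real.exp (-(a₁ * p.1) - a₂ * p.2) := by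
      rw [← Real.exp_add]; congr 1; ring
    rw [e2]
    unfold expTest
    simp only [Prod.fst_zero, Prod.snd_zero, mul_zero, neg_zero, sub_zero, add_zero]
    field_simp
  simp_rw [inner, drift, ← mul_add]
  rw [HasDriftAndLevyMeasure.lintegral_exp_mul hν hb₁ hb₂ hl.le,
    lintegral_mul_const _ (measurable_exp_lin _ _),
    lintegral_exp_renewalMeasure h ha₁ (add_nonneg ha₂ hl.le) hκ,
    ← ENNReal.ofReal_mul (inv_pos.2 hl).le, ← ENNReal.ofReal_mul (by positivity)]
  congr 1
  field_simp

end Subordinator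

lemma measurableSet_inOrthant : MeasurableSet {x | InOrthant x} := by
  have h : ∀ g : ℝ × (ℝ × ℝ) × (ℝ × ℝ) → ℝ, Measurable g → MeasurableSet {x | 0 ≤ g x} :=
    fun g hg => measurableSet_le measurable_const hg
  exact (h (fun x => x.1) (by fun_prop)).inter
    (((h (fun x => x.2.1.1) (by fun_prop)).inter (h (fun x => x.2.1.2) (by fun_prop))).inter
      ((h (fun x => x.2.2.1) (by fun_prop)).inter (h (fun x => x.2.2.2) (by fun_prop))))

/-- A measure with the same finite exponential density with respect to two measures. -/
lemma eq_of_withDensity_eq {α : Type*} [MeasurableSpace α] {μ ρ : Measure α} {f : α → ℝ≥0∞}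
    (hf : Measurable f) (h0 : ∀ x, f x ≠ 0) (ht : ∀ x, f x ≠ ∞)
    (h : μ.withDensity f = ρ.withDensity f) : μ = ρ := by
  rw [← withDensity_inv_same (μ := μ) hf (Eventually.of_forall h0) (Eventually.of_forall ht), h,
    withDensity_inv_same hf (Eventually.of_forall h0) (Eventually.of_forall ht)]

namespace Subordinator

/-- **Passage data with the level integrated out.** If `Y` is not trivial then, with `T` the
first passage time over `v`, the measure `dv E[e^{-qT}; X_{T-} ∈ dp, ΔX_T ∈ dr]` is
`V(dp) ν(dr) dv` on `p₂ ≤ v < p₂ + r₂` plus `d_Y V(dp) δ_{p₂}(dv) δ₀(dr)`. -/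
theorem lintegral_passWeight (h : IsBivariateSubordinator P Z Y)
    (hν : HasDriftAndLevyMeasure P Z Y q dZ dY ν) (hq : 0 ≤ q)
    (hpos : 0 < laplaceExponent P Z Y 0 1) {F : ℝ × (ℝ × ℝ) × (ℝ × ℝ) → ℝ≥0∞}
    (hF : Measurable F) :
    ∫⁻ v in Ioi (0 : ℝ), (∫⁻ ω, passWeight q (path Z Y ω) v *
        F (v, prePassage (path Z Y ω) v, passJump (path Z Y ω) v) ∂P) =
      ∫⁻ p, ((∫⁻ r, (∫⁻ v in Ico p.2 (p.2 + r.2), F (v, p, r)) ∂ν) +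
        ENNReal.ofReal dY * F (p.2, p, 0)) ∂renewalMeasure P Z Y q := by
  obtain ⟨W, A, hW, hA, hWA⟩ := exists_measurable_passWeight h q
  have hκ : ∀ a₁ a₂ l : ℝ, 0 ≤ a₁ → 0 ≤ a₂ → 1 ≤ l →
      0 < q + laplaceExponent P Z Y a₁ (a₂ + l) := fun a₁ a₂ l h1 h2 h3 => by
    have := laplaceExponent_mono h le_rfl zero_le_one h1 (by linarith : (1 : ℝ) ≤ a₂ + l)
    linarith
  have : SFinite ν := HasDriftAndLevyMeasure.sFinite hν
  have : SFinite (renewalMeasure P Z Y q) := sFinite_renewalMeasure h (by linarith)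
  set V := renewalMeasure P Z Y q
  set base := (volume.restrict (Ioi (0 : ℝ))).prod P
  let Ψ₁ : ℝ × Ω → ℝ × (ℝ × ℝ) × (ℝ × ℝ) := fun x => (x.1, A x)
  have hΨ₁ : Measurable Ψ₁ := measurable_fst.prodMk hA
  -- The two sides are integrals with respect to measures `M₁` and `M₂` on the orthant, which are
  -- identified by their Laplace transforms.
  let M₁ := (base.withDensity W).map Ψ₁
  let J : Set ((ℝ × ℝ) × (ℝ × ℝ) × ℝ) := {z | z.2.2 ∈ Ico z.1.2 (z.1.2 + z.2.1.2)}
  have hJ : MeasurableSet J :=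
    (measurableSet_le (f := fun z : (ℝ × ℝ) × (ℝ × ℝ) × ℝ => z.1.2) (by fun_prop)
      (by fun_prop)).inter
      (measurableSet_lt (f := fun z : (ℝ × ℝ) × (ℝ × ℝ) × ℝ => z.2.2) (by fun_prop) (by fun_prop))
  let Ψ₂ : (ℝ × ℝ) × (ℝ × ℝ) × ℝ → ℝ × (ℝ × ℝ) × (ℝ × ℝ) := fun z => (z.2.2, z.1, z.2.1)
  have hΨ₂ : Measurable Ψ₂ := by fun_prop
  let Ψ₃ : ℝ × ℝ → ℝ × (ℝ × ℝ) × (ℝ × ℝ) := fun p => (p.2, p, 0)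
  have hΨ₃ : Measurable Ψ₃ := by fun_prop
  let M₂ := ((V.prod (ν.prod volume)).restrict J).map Ψ₂ + ENNReal.ofReal dY • V.map Ψ₃
  have int₁ : ∀ G : ℝ × (ℝ × ℝ) × (ℝ × ℝ) → ℝ≥0∞, Measurable G → ∫⁻ x, G x ∂M₁ =
      ∫⁻ x, passWeight q (path Z Y x.2) x.1 * G (x.1, prePassage (path Z Y x.2) x.1,
        passJump (path Z Y x.2) x.1) ∂base := by
    intro G hG
    have hGm : Measurable fun x => G (Ψ₁ x) := hG.comp hΨ₁
    rw [lintegral_map hG hΨ₁, lintegral_withDensity_eq_lintegral_mul _ hW hGm]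
    refine lintegral_congr_ae ?_
    filter_upwards [ae_prod_isRegularPath h] with x hx
    obtain ⟨e1, e2⟩ := hWA x.2 hx.2 x.1 hx.1.le
    simp only [Pi.mul_apply, Ψ₁]
    rw [← e1, e2]
  have int₂ : ∀ G : ℝ × (ℝ × ℝ) × (ℝ × ℝ) → ℝ≥0∞, Measurable G → ∫⁻ x, G x ∂M₂ =
      ∫⁻ p, ((∫⁻ r, (∫⁻ v in Ico p.2 (p.2 + r.2), G (v, p, r)) ∂ν) +
        ENNReal.ofReal dY * G (p.2, p, 0)) ∂V := by
    intro G hG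
    have hG2 : Measurable fun x => G (Ψ₂ x) := hG.comp hΨ₂
    have hG3 : Measurable fun x => G (Ψ₃ x) := hG.comp hΨ₃
    rw [lintegral_add_measure, lintegral_smul_measure, lintegral_map hG hΨ₂,
      lintegral_map hG hΨ₃, ← lintegral_indicator hJ,
      lintegral_prod _ (hG2.indicator hJ).aemeasurable,
      lintegral_add_right _ (hG3.const_mul _), lintegral_const_mul _ hG3]
    congr 1
    refine lintegral_congr fun p => ?_
    have hm : Measurable fun z : (ℝ × ℝ) × ℝ => J.indicator (fun a => G (Ψ₂ a)) (p, z) :=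
      ((hG.comp hΨ₂).indicator hJ).comp measurable_prodMk_left
    rw [lintegral_prod _ hm.aemeasurable]
    refine lintegral_congr fun r => ?_
    rw [← lintegral_indicator measurableSet_Ico]
    rfl
  have supp₁ : ∀ᵐ x ∂M₁, InOrthant x := by
    rw [ae_map_iff hΨ₁.aemeasurable measurableSet_inOrthant]
    refine (withDensity_absolutelyContinuous _ _).ae_le ?_
    filter_upwards [ae_prod_isRegularPath h] with x hx
    obtain ⟨-, e2⟩ := hWA x.2 hx.2 x.1 hx.1.le
    simp only [Ψ₁, InOrthant, e2]
    exact ⟨hx.1.le, ⟨hx.2.prePassage_fst_nonneg, hx.2.prePassage_snd_nonneg⟩,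
      hx.2.passJump_fst_nonneg, hx.2.passJump_snd_nonneg⟩
  have supp₂ : ∀ᵐ x ∂M₂, InOrthant x := by
    rw [ae_add_measure_iff]
    constructor
    · rw [ae_map_iff hΨ₂.aemeasurable measurableSet_inOrthant]
      have h1 : ∀ᵐ z : (ℝ × ℝ) × (ℝ × ℝ) × ℝ ∂V.prod (ν.prod volume), 0 ≤ z.1.1 ∧ 0 ≤ z.1.2 :=
        Measure.quasiMeasurePreserving_fst.ae (renewalMeasure_ae_nonneg h q)
      have h2 : ∀ᵐ z : (ℝ × ℝ) × (ℝ × ℝ) × ℝ ∂V.prod (ν.prod volume),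
          0 ≤ z.2.1.1 ∧ 0 ≤ z.2.1.2 ∧ z.2.1 ≠ (0, 0) :=
        Measure.quasiMeasurePreserving_snd.ae
          (Measure.quasiMeasurePreserving_fst.ae (HasDriftAndLevyMeasure.ae_support hν))
      filter_upwards [ae_restrict_of_ae h1, ae_restrict_of_ae h2, ae_restrict_mem hJ]
        with z hz1 hz2 hz3
      exact ⟨hz1.2.trans hz3.1, hz1, hz2.1, hz2.2.1⟩
    · refine Measure.ae_smul_measure ?_ _
      rw [ae_map_iff hΨ₃.aemeasurable measurableSet_inOrthant]
      filter_upwards [renewalMeasure_ae_nonneg h q] with p hp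
      exact ⟨hp.2, hp, le_rfl, le_rfl⟩
  -- Both measures are infinite in general; the weight `e^{-v}` makes them finite.
  let f : ℝ × (ℝ × ℝ) × (ℝ × ℝ) → ℝ≥0∞ := fun x => ENNReal.ofReal (Real.exp (-x.1))
  have hf : Measurable f := by fun_prop
  have hf0 : ∀ x, f x ≠ 0 := fun x => (ENNReal.ofReal_pos.2 (Real.exp_pos _)).ne'
  have hexp : ∀ c a₁ a₂ b₁ b₂ : ℕ, ∀ x : ℝ × (ℝ × ℝ) × (ℝ × ℝ),
      f x * ENNReal.ofReal (Real.exp (-(c * x.1) +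
        ((-(a₁ * x.2.1.1) - a₂ * x.2.1.2) + (-(b₁ * x.2.2.1) - b₂ * x.2.2.2)))) =
      ENNReal.ofReal (Real.exp (-(((c : ℝ) + 1) * x.1))) *
        ENNReal.ofReal (expTest a₁ a₂ b₁ b₂ x.2.1 x.2.2) := by
    intro c a₁ a₂ b₁ b₂ x
    simp only [f, expTest]
    rw [← ENNReal.ofReal_mul (Real.exp_pos _).le, ← ENNReal.ofReal_mul (Real.exp_pos _).le,
      ← Real.exp_add, ← Real.exp_add]
    congr 2
    ring
  have lap₁ : ∀ c a₁ a₂ b₁ b₂ : ℕ,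
      ∫⁻ x, ENNReal.ofReal (Real.exp (-(c * x.1) +
        ((-(a₁ * x.2.1.1) - a₂ * x.2.1.2) + (-(b₁ * x.2.2.1) - b₂ * x.2.2.2))))
        ∂M₁.withDensity f =
      ENNReal.ofReal ((laplaceExponent P Z Y b₁ (b₂ + (c + 1)) - laplaceExponent P Z Y b₁ b₂) /
        ((c + 1) * (q + laplaceExponent P Z Y a₁ (a₂ + (c + 1))))) := by
    intro c a₁ a₂ b₁ b₂
    rw [lintegral_withDensity_eq_lintegral_mul _ hf (by fun_prop)]
    simp only [Pi.mul_apply, hexp]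
    rw [int₁ _ (by unfold expTest; fun_prop),
      ← lintegral_passWeight_expTest h hq (by positivity) a₁.cast_nonneg a₂.cast_nonneg
        b₁.cast_nonneg b₂.cast_nonneg (hκ _ _ _ a₁.cast_nonneg a₂.cast_nonneg (by simp))]
    refine lintegral_congr fun x => ?_
    ring
  have lap₂ : ∀ c a₁ a₂ b₁ b₂ : ℕ,
      ∫⁻ x, ENNReal.ofReal (Real.exp (-(c * x.1) +
        ((-(a₁ * x.2.1.1) - a₂ * x.2.1.2) + (-(b₁ * x.2.2.1) - b₂ * x.2.2.2))))
        ∂M₂.withDensity f =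
      ENNReal.ofReal ((laplaceExponent P Z Y b₁ (b₂ + (c + 1)) - laplaceExponent P Z Y b₁ b₂) /
        ((c + 1) * (q + laplaceExponent P Z Y a₁ (a₂ + (c + 1))))) := by
    intro c a₁ a₂ b₁ b₂
    rw [lintegral_withDensity_eq_lintegral_mul _ hf (by fun_prop)]
    simp only [Pi.mul_apply, hexp]
    rw [int₂ _ (by unfold expTest; fun_prop),
      ← lintegral_renewal_levy_expTest h hν (by positivity) a₁.cast_nonneg a₂.cast_nonneg
        b₁.cast_nonneg b₂.cast_nonneg (hκ _ _ _ a₁.cast_nonneg a₂.cast_nonneg (by simp))]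
  have fin : ∀ M : Measure (ℝ × (ℝ × ℝ) × (ℝ × ℝ)),
      ∫⁻ x, ENNReal.ofReal (Real.exp (-(((0 : ℕ) : ℝ) * x.1) + ((-(((0 : ℕ) : ℝ) * x.2.1.1) -
        ((0 : ℕ) : ℝ) * x.2.1.2) + (-(((0 : ℕ) : ℝ) * x.2.2.1) - ((0 : ℕ) : ℝ) * x.2.2.2))))
        ∂M.withDensity f ≠ ∞ → IsFiniteMeasure (M.withDensity f) := by
    intro M hM
    refine ⟨lt_top_iff_ne_top.2 ?_⟩
    simpa using hM
  have : IsFiniteMeasure (M₁.withDensity f) := fin _ (by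
    rw [lap₁]; exact ENNReal.ofReal_ne_top)
  have : IsFiniteMeasure (M₂.withDensity f) := fin _ (by
    rw [lap₂]; exact ENNReal.ofReal_ne_top)
  have hM : M₁ = M₂ := eq_of_withDensity_eq hf hf0 (fun _ => ENNReal.ofReal_ne_top)
    (ext_of_laplace_prod ((withDensity_absolutelyContinuous _ _).ae_le supp₁)
      ((withDensity_absolutelyContinuous _ _).ae_le supp₂)
      (fun c a₁ a₂ b₁ b₂ => by rw [lap₁, lap₂]))
  rw [← int₂ F hF, ← hM, int₁ F hF, lintegral_prod]
  refine AEMeasurable.congr (f := fun x => W x * F (Ψ₁ x))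
    (hW.mul (hF.comp hΨ₁)).aemeasurable ?_
  filter_upwards [ae_prod_isRegularPath h] with x hx
  obtain ⟨e1, e2⟩ := hWA x.2 hx.2 x.1 hx.1.le
  simp only [Ψ₁]
  rw [← e1, e2]

end Subordinator

end Master

/-! ### Compensation at the first passage over a fixed level -/

section Compensation

variable {Ω : Type*} [MeasurableSpace Ω] {P : Measure Ω} [IsProbabilityMeasure P]
  {Z Y : ℝ≥0 → Ω → ℝ} {q dZ dY : ℝ} {ν : Measure (ℝ × ℝ)}

namespace Subordinator

lemma aemeasurable_prod_passWeight_mul (h : IsBivariateSubordinator P Z Y)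
    {F : ℝ × (ℝ × ℝ) × (ℝ × ℝ) → ℝ≥0∞} (hF : Measurable F) :
    AEMeasurable (fun x : ℝ × Ω => passWeight q (path Z Y x.2) x.1 *
      F (x.1, prePassage (path Z Y x.2) x.1, passJump (path Z Y x.2) x.1))
      ((volume.restrict (Ioi (0 : ℝ))).prod P) := by
  obtain ⟨W, A, hW, hA, hWA⟩ := exists_measurable_passWeight h q
  refine AEMeasurable.congr (f := fun x => W x * F (x.1, A x))
    (hW.mul (hF.comp (measurable_fst.prodMk hA))).aemeasurable ?_
  filter_upwards [ae_prod_isRegularPath h] with x hx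
  obtain ⟨e1, e2⟩ := hWA x.2 hx.2 x.1 hx.1.le
  rw [← e1, ← Prod.mk.eta (p := A x)] at *
  rw [e2]

lemma aemeasurable_passWeight (h : IsBivariateSubordinator P Z Y) {v : ℝ} (hv : 0 ≤ v) :
    AEMeasurable (fun ω => passWeight q (path Z Y ω) v) P := by
  obtain ⟨W, A, hW, hA, hWA⟩ := exists_measurable_passWeight h q
  refine AEMeasurable.congr (hW.comp (measurable_prodMk_left (x := v))).aemeasurable ?_
  filter_upwards [ae_isRegularPath h] with ω hω
  exact (hWA ω hω v hv).1

lemma aemeasurable_passData (h : IsBivariateSubordinator P Z Y) {v : ℝ} (hv : 0 ≤ v) :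
    AEMeasurable (fun ω => (prePassage (path Z Y ω) v, passJump (path Z Y ω) v)) P := by
  obtain ⟨W, A, hW, hA, hWA⟩ := exists_measurable_passWeight h 0
  refine AEMeasurable.congr (hA.comp (measurable_prodMk_left (x := v))).aemeasurable ?_
  filter_upwards [ae_isRegularPath h] with ω hω
  exact (hWA ω hω v hv).2

lemma laplaceExponent_zero (P : Measure Ω) [IsProbabilityMeasure P] (Z Y : ℝ≥0 → Ω → ℝ) :
    laplaceExponent P Z Y 0 0 = 0 := by
  simp [laplaceExponent]

/-- If `ψ(0, 1) = 0` then `Y` vanishes identically. -/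
lemma ae_eq_zero_of_trivial (h : IsBivariateSubordinator P Z Y)
    (htriv : laplaceExponent P Z Y 0 1 = 0) : ∀ᵐ ω ∂P, ∀ s, Y s ω = 0 := by
  have h1 : ∀ n : ℕ, ∀ᵐ ω ∂P, Y n ω = 0 := by
    intro n
    have e := lintegral_exp h le_rfl zero_le_one n
    rw [htriv, mul_zero, neg_zero, Real.exp_zero, ENNReal.ofReal_one] at e
    have hm : Measurable fun ω => ENNReal.ofReal (Real.exp (-(0 * Z n ω) - 1 * Y n ω)) :=
      (measurable_exp_lin 0 1).comp (measurable_pair h n)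
    have hle : (fun ω => ENNReal.ofReal (Real.exp (-(0 * Z n ω) - 1 * Y n ω))) ≤ᵐ[P]
        fun _ => 1 := by
      filter_upwards [ae_nonneg h] with ω hω
      rw [← ENNReal.ofReal_one]
      refine ENNReal.ofReal_le_ofReal (Real.exp_le_one_iff.2 ?_)
      have := (hω n).2
      linarith
    have := (ae_eq_of_ae_le_of_lintegral_le hle (by rw [e]; simp) (by fun_prop) (by
      rw [e]; simp))
    filter_upwards [this] with ω hω
    rw [ENNReal.ofReal_eq_one, Real.exp_eq_one_iff] at hω
    linarith
  filter_upwards [ae_all_iff.2 h1, h.monotone, ae_nonneg h] with ω hω hm h0 s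
  obtain ⟨n, hn⟩ := exists_nat_ge s
  exact le_antisymm ((hm.2 hn).trans (hω n).le) (h0 s).2

lemma not_passes_of_trivial (h : IsBivariateSubordinator P Z Y)
    (htriv : laplaceExponent P Z Y 0 1 = 0) {u : ℝ} (hu : 0 ≤ u) :
    ∀ᵐ ω ∂P, ¬ Passes (path Z Y ω) u := by
  filter_upwards [ae_eq_zero_of_trivial h htriv] with ω hω
  rintro ⟨s, hs⟩
  simp only [path, hω] at hs
  exact absurd hs (not_lt.2 hu)

lemma levy_snd_eq_zero_of_trivial (hν : HasDriftAndLevyMeasure P Z Y q dZ dY ν)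
    (htriv : laplaceExponent P Z Y 0 1 = 0) : ∀ᵐ r ∂ν, r.2 = 0 := by
  have e := HasDriftAndLevyMeasure.lintegral_exp_mul hν le_rfl le_rfl zero_le_one
  rw [zero_add, htriv, laplaceExponent_zero, sub_zero, ENNReal.ofReal_zero, add_eq_zero,
    lintegral_eq_zero_iff (by fun_prop)] at e
  filter_upwards [e.1, HasDriftAndLevyMeasure.ae_support hν] with r hr hs
  simp only [zero_mul, neg_zero, sub_zero, Real.exp_zero, one_mul, Pi.zero_apply,
    ENNReal.ofReal_eq_zero, sub_nonpos, Real.one_le_exp_iff, Left.nonneg_neg_iff] at hr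
  exact le_antisymm hr hs.2.1

/-- The test function that spreads a function of the passage data uniformly over the jump gap. -/
noncomputable def gapAverage (f : (ℝ × ℝ) × (ℝ × ℝ) → ℝ≥0∞) (x : ℝ × (ℝ × ℝ) × (ℝ × ℝ)) : ℝ≥0∞ :=
  {x : ℝ × (ℝ × ℝ) × (ℝ × ℝ) | x.1 ∈ Ico x.2.1.2 (x.2.1.2 + x.2.2.2)}.indicator
    (fun x => f x.2 * ENNReal.ofReal x.2.2.2⁻¹) x

lemma measurable_gapAverage {f : (ℝ × ℝ) × (ℝ × ℝ) → ℝ≥0∞} (hf : Measurable f) :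
    Measurable (gapAverage f) := by
  refine Measurable.indicator (by fun_prop) ?_
  exact (measurableSet_le (f := fun x : ℝ × (ℝ × ℝ) × (ℝ × ℝ) => x.2.1.2)
    (g := fun x => x.1) (by fun_prop) (by fun_prop)).inter
    (measurableSet_lt (f := fun x : ℝ × (ℝ × ℝ) × (ℝ × ℝ) => x.1)
    (g := fun x => x.2.1.2 + x.2.2.2) (by fun_prop) (by fun_prop))

lemma gapAverage_of_mem {f : (ℝ × ℝ) × (ℝ × ℝ) → ℝ≥0∞} {v : ℝ} {p r : ℝ × ℝ}
    (hv : v ∈ Ico p.2 (p.2 + r.2)) :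
    gapAverage f (v, p, r) = f (p, r) * ENNReal.ofReal r.2⁻¹ :=
  indicator_of_mem (s := {x : ℝ × (ℝ × ℝ) × (ℝ × ℝ) | x.1 ∈ Ico x.2.1.2 (x.2.1.2 + x.2.2.2)})
    (a := (v, p, r)) hv _

lemma lintegral_gapAverage (h : IsBivariateSubordinator P Z Y)
    (hν : HasDriftAndLevyMeasure P Z Y q dZ dY ν) (hq : 0 ≤ q)
    (hpos : 0 < laplaceExponent P Z Y 0 1) {f : (ℝ × ℝ) × (ℝ × ℝ) → ℝ≥0∞} (hf : Measurable f)
    (hf0 : ∀ p r, f (p, r) ≠ 0 → 0 < r.2) :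
    ∫⁻ ω, (∫⁻ v in Ioi (0 : ℝ), passWeight q (path Z Y ω) v *
      gapAverage f (v, prePassage (path Z Y ω) v, passJump (path Z Y ω) v)) ∂P =
      ∫⁻ p, (∫⁻ r, f (p, r) ∂ν) ∂renewalMeasure P Z Y q := by
  have hm := measurable_gapAverage hf
  rw [lintegral_lintegral_swap, lintegral_passWeight h hν hq hpos hm]
  · refine lintegral_congr fun p => ?_
    have h0 : gapAverage f (p.2, p, 0) = 0 := by
      refine indicator_of_notMem ?_ _
      simp
    rw [h0, mul_zero, add_zero]
    refine lintegral_congr fun r => ?_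
    have e : ∀ v ∈ Ico p.2 (p.2 + r.2), gapAverage f (v, p, r) =
        f (p, r) * ENNReal.ofReal r.2⁻¹ := fun v hv => gapAverage_of_mem hv
    rw [setLIntegral_congr_fun measurableSet_Ico e, lintegral_const,
      Measure.restrict_apply_univ, Real.volume_Ico, add_sub_cancel_left]
    by_cases hfr : f (p, r) = 0
    · simp [hfr]
    · have hr := hf0 p r hfr
      rw [mul_assoc, ← ENNReal.ofReal_mul (inv_pos.2 hr).le, inv_mul_cancel₀ hr.ne',
        ENNReal.ofReal_one, mul_one]
  · exact (aemeasurable_prod_passWeight_mul h hm).prod_swap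

end Subordinator

/-- For levels `v` in the gap left by the jump at the passage over `u`, the passage data agree. -/
lemma passData_eq_of_mem_gap {w : ℝ≥0 → ℝ × ℝ} (hw : IsRegularPath w) {u v : ℝ}
    (hp : Passes w u)
    (hv : v ∈ Ico (prePassage w u).2 ((prePassage w u).2 + (passJump w u).2)) :
    passWeight q w v = passWeight q w u ∧ prePassage w v = prePassage w u ∧
      passJump w v = passJump w u := by
  rw [← Prod.snd_add, IsRegularPath.prePassage_add_passJump] at hv
  obtain ⟨h1, h2⟩ := hw.passTime_eq_of_mem_gap hv.1 hv.2
  refine ⟨?_, ?_, ?_⟩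
  · simp [passWeight, h1, hp, h2]
  · simp [prePassage, h2]
  · simp [passJump, prePassage, h2]

lemma lintegral_gap_eq {w : ℝ≥0 → ℝ × ℝ} (hw : IsRegularPath w) {u : ℝ} {c : ℝ≥0∞}
    (hr : 0 < (passJump w u).2) :
    ∫⁻ v in Ioi (0 : ℝ), (Ico (prePassage w u).2 ((prePassage w u).2 +
      (passJump w u).2)).indicator (fun _ => c * ENNReal.ofReal (passJump w u).2⁻¹) v = c := by
  have hsub : Ico (prePassage w u).2 ((prePassage w u).2 + (passJump w u).2) ⊆ Ici 0 :=
    fun v hv => hw.prePassage_snd_nonneg.trans hv.1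
  rw [Measure.restrict_congr_set Ioi_ae_eq_Ici, lintegral_indicator measurableSet_Ico,
    Measure.restrict_restrict measurableSet_Ico, inter_eq_left.2 hsub, lintegral_const,
    Measure.restrict_apply_univ, Real.volume_Ico, add_sub_cancel_left, mul_assoc,
    ← ENNReal.ofReal_mul (inv_pos.2 hr).le, inv_mul_cancel₀ hr.ne', ENNReal.ofReal_one, mul_one]

lemma le_lintegral_gapAverage {w : ℝ≥0 → ℝ × ℝ} (hw : IsRegularPath w) {u : ℝ}
    {f : (ℝ × ℝ) × (ℝ × ℝ) → ℝ≥0∞} (hf0 : ∀ p r, f (p, r) ≠ 0 → 0 < r.2) :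
    passWeight q w u * f (prePassage w u, passJump w u) ≤
      ∫⁻ v in Ioi (0 : ℝ), passWeight q w v *
        Subordinator.gapAverage f (v, prePassage w v, passJump w v) := by
  by_cases hp : Passes w u
  · by_cases hf : f (prePassage w u, passJump w u) = 0
    · simp [hf]
    · rw [← lintegral_gap_eq hw (c := passWeight q w u * f (prePassage w u, passJump w u))
        (hf0 _ _ hf)]
      refine lintegral_mono fun v => ?_
      by_cases hv : v ∈ Ico (prePassage w u).2 ((prePassage w u).2 + (passJump w u).2)
      · obtain ⟨e1, e2, e3⟩ := passData_eq_of_mem_gap (q := q) hw hp hv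
        rw [indicator_of_mem hv, e1, e2, e3, Subordinator.gapAverage_of_mem hv,
          mul_assoc]
      · rw [indicator_of_notMem hv]
        exact zero_le
  · simp [passWeight, hp]

lemma eq_lintegral_gapAverage {w : ℝ≥0 → ℝ × ℝ} (hw : IsRegularPath w) {u : ℝ}
    {f : (ℝ × ℝ) × (ℝ × ℝ) → ℝ≥0∞}
    (hf0 : ∀ p r, f (p, r) ≠ 0 → u ∈ Ico p.2 (p.2 + r.2)) :
    passWeight q w u * f (prePassage w u, passJump w u) =
      ∫⁻ v in Ioi (0 : ℝ), passWeight q w v *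
        Subordinator.gapAverage f (v, prePassage w v, passJump w v) := by
  have hf1 : ∀ p r, f (p, r) ≠ 0 → 0 < r.2 := fun p r hpr => by
    have := hf0 p r hpr
    linarith [this.1, this.2]
  refine le_antisymm (le_lintegral_gapAverage hw hf1) ?_
  -- Only levels `v` whose jump gap contains both `v` and `u` contribute.
  have key : ∀ v, passWeight q w v *
      Subordinator.gapAverage f (v, prePassage w v, passJump w v) ≠ 0 →
      Passes w u ∧ f (prePassage w u, passJump w u) ≠ 0 ∧
        v ∈ Ico (prePassage w u).2 ((prePassage w u).2 + (passJump w u).2) := by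
    intro v hv
    have hp : Passes w v := by
      by_contra hc
      simp [passWeight, hc] at hv
    have hg := right_ne_zero_of_mul hv
    unfold Subordinator.gapAverage at hg
    have hmem := mem_of_indicator_ne_zero hg
    rw [indicator_of_mem hmem] at hg
    have hf := left_ne_zero_of_mul hg
    have hu := hf0 _ _ hf
    obtain ⟨-, e2, e3⟩ := passData_eq_of_mem_gap (q := q) hw hp hu
    have hpu : Passes w u := by
      rw [← Prod.snd_add, IsRegularPath.prePassage_add_passJump] at hu
      exact ⟨_, hu.2⟩
    rw [← e2, ← e3] at hf hmem
    exact ⟨hpu, hf, hmem⟩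
  by_cases hpf : Passes w u ∧ f (prePassage w u, passJump w u) ≠ 0
  · rw [← lintegral_gap_eq hw (c := passWeight q w u * f (prePassage w u, passJump w u))
      (hf1 _ _ hpf.2)]
    refine lintegral_mono fun v => ?_
    by_cases hv : passWeight q w v *
      Subordinator.gapAverage f (v, prePassage w v, passJump w v) = 0
    · simp only [hv]; exact zero_le
    · have hm := (key v hv).2.2
      obtain ⟨e1, e2, e3⟩ := passData_eq_of_mem_gap (q := q) hw hpf.1 hm
      rw [indicator_of_mem hm, e1, e2, e3, Subordinator.gapAverage_of_mem hm,
          mul_assoc]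
  · have : ∀ v, passWeight q w v *
        Subordinator.gapAverage f (v, prePassage w v, passJump w v) = 0 := fun v => by
      by_contra hc
      exact hpf ⟨(key v hc).1, (key v hc).2.1⟩
    simp [this]

namespace Subordinator

/-- A bound for the passage over `u` by a jump of `Y`, valid for every level `u > 0`: the
passages over all levels of the gap of that jump share its data, so the bound may be averaged
over the gap. -/
theorem lintegral_passJump_le (h : IsBivariateSubordinator P Z Y)
    (hν : HasDriftAndLevyMeasure P Z Y q dZ dY ν) (hq : 0 ≤ q) {u : ℝ} (hu : 0 ≤ u)
    {f : (ℝ × ℝ) × (ℝ × ℝ) → ℝ≥0∞} (hf : Measurable f)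
    (hf0 : ∀ p r, f (p, r) ≠ 0 → 0 < r.2) :
    ∫⁻ ω, passWeight q (path Z Y ω) u *
      f (prePassage (path Z Y ω) u, passJump (path Z Y ω) u) ∂P ≤
      ∫⁻ p, (∫⁻ r, f (p, r) ∂ν) ∂renewalMeasure P Z Y q := by
  rcases (laplaceExponent_nonneg h le_rfl zero_le_one).eq_or_lt with htriv | hpos
  · calc _ = ∫⁻ _, 0 ∂P := by
          refine lintegral_congr_ae ?_
          filter_upwards [not_passes_of_trivial h htriv.symm hu] with ω hω
          simp [passWeight, hω]
      _ ≤ _ := by simp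
  · rw [← lintegral_gapAverage h hν hq hpos hf hf0]
    refine lintegral_mono_ae ?_
    filter_upwards [ae_isRegularPath h] with ω hω
    exact le_lintegral_gapAverage hω hf0

/-- The law of the passage over `u` by a jump of `Y` across `u`, for every level `u`. -/
theorem lintegral_passJump_eq (h : IsBivariateSubordinator P Z Y)
    (hν : HasDriftAndLevyMeasure P Z Y q dZ dY ν) (hq : 0 ≤ q) {u : ℝ} (hu : 0 ≤ u)
    {f : (ℝ × ℝ) × (ℝ × ℝ) → ℝ≥0∞} (hf : Measurable f)
    (hf0 : ∀ p r, f (p, r) ≠ 0 → u ∈ Ico p.2 (p.2 + r.2)) :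
    ∫⁻ ω, passWeight q (path Z Y ω) u *
      f (prePassage (path Z Y ω) u, passJump (path Z Y ω) u) ∂P =
      ∫⁻ p, (∫⁻ r, f (p, r) ∂ν) ∂renewalMeasure P Z Y q := by
  have hf1 : ∀ p r, f (p, r) ≠ 0 → 0 < r.2 := fun p r hpr => by
    have := hf0 p r hpr
    linarith [this.1, this.2]
  rcases (laplaceExponent_nonneg h le_rfl zero_le_one).eq_or_lt with htriv | hpos
  · refine le_antisymm (lintegral_passJump_le h hν hq hu hf hf1) ?_
    have : ∀ p, ∫⁻ r, f (p, r) ∂ν = 0 := fun p => by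
      refine (lintegral_eq_zero_iff (hf.comp measurable_prodMk_left)).2 ?_
      filter_upwards [levy_snd_eq_zero_of_trivial hν htriv.symm] with r hr
      by_contra hc
      exact absurd hr (hf1 p r hc).ne'
    simp [this]
  · rw [← lintegral_gapAverage h hν hq hpos hf hf1]
    refine lintegral_congr_ae ?_
    filter_upwards [ae_isRegularPath h] with ω hω
    exact eq_lintegral_gapAverage hω hf0

end Subordinator

end Compensation

/-! ### The strong Markov property at a first passage time -/

/-- The increments of the path after time `t`, observed at rational times. -/
def shiftPath (w : ℝ≥0 → ℝ × ℝ) (t : ℝ≥0) : ℚ≥0 → ℝ × ℝ := fun s => w (t + s) - w t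

lemma tendsto_shiftPath {w : ℝ≥0 → ℝ × ℝ} {v : ℝ} (hw : IsRegularPath w) (hv : 0 ≤ v)
    (hp : Passes w v) :
    Tendsto (fun n => shiftPath w ((passCell (mesh n) w v + 1 : ℕ) * mesh n)) atTop
      (𝓝 (shiftPath w (passTime w v))) := by
  refine tendsto_pi_nhds.2 fun s => Tendsto.sub ?_ (tendsto_eval_passCell_right hw hv hp)
  refine (hw.rightCont (passTime w v + s)).tendsto.comp (tendsto_nhdsWithin_iff.2
    ⟨(tendsto_passCell_right hw hv hp).add_const _, Eventually.of_forall fun n => ?_⟩)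
  have := passTime_le_passCell hw (mesh_pos n) hp
  simp only [mem_Ici]
  gcongr

section StrongMarkov

variable {Ω : Type*} [MeasurableSpace Ω] {P : Measure Ω}
  {Z Y : ℝ≥0 → Ω → ℝ}

namespace Subordinator

lemma measurable_shiftPath (h : IsBivariateSubordinator P Z Y) (δ : ℝ≥0) (v : ℝ) :
    Measurable fun ω => (path Z Y ω ((passCell δ (path Z Y ω) v + 1 : ℕ) * δ),
      shiftPath (path Z Y ω) ((passCell δ (path Z Y ω) v + 1 : ℕ) * δ)) := by
  have hp := measurable_path h
  have hc : Measurable fun ω => (path Z Y ω, passCell δ (path Z Y ω) v) :=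
    hp.prodMk ((measurable_passCell δ).comp (measurable_const.prodMk hp))
  have he : ∀ s : ℝ≥0, Measurable fun p : (ℝ≥0 → ℝ × ℝ) × ℕ => p.1 ((p.2 + 1 : ℕ) * δ + s) :=
    fun s => measurable_from_prod_countable_left fun k =>
      measurable_pi_apply (((k + 1 : ℕ) : ℝ≥0) * δ + s)
  have h0 := (he 0).comp hc
  simp only [add_zero] at h0
  refine h0.prodMk (measurable_pi_lambda _ fun s => ((he s).comp hc).sub h0)

variable [IsProbabilityMeasure P]

/-- The Markov property at the grid time following the first passage over `v`. -/
lemma lintegral_passCell_shiftPath (h : IsBivariateSubordinator P Z Y) {δ : ℝ≥0} (hδ : 0 < δ)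
    {v : ℝ} (hv : 0 ≤ v) (hpass : ∀ᵐ ω ∂P, Passes (path Z Y ω) v)
    {Ψ : (ℝ × ℝ) × (ℚ≥0 → ℝ × ℝ) → ℝ≥0∞} (hΨ : Measurable Ψ) :
    ∫⁻ ω, Ψ (path Z Y ω ((passCell δ (path Z Y ω) v + 1 : ℕ) * δ),
      shiftPath (path Z Y ω) ((passCell δ (path Z Y ω) v + 1 : ℕ) * δ)) ∂P =
    ∫⁻ ω, (∫⁻ ω', Ψ (path Z Y ω ((passCell δ (path Z Y ω) v + 1 : ℕ) * δ),
      fun s => path Z Y ω' s) ∂P) ∂P := by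
  have hp := measurable_path h
  have hev : ∀ s : ℝ≥0, Measurable fun ω => path Z Y ω s := fun s => measurable_pair h s
  let C : ℕ → Set (ℝ≥0 → ℝ × ℝ) := fun k => {w | (w (k * δ)).2 ≤ v ∧ v < (w ((k + 1 : ℕ) * δ)).2}
  have hE : ∀ t : ℝ≥0, Measurable fun w : ℝ≥0 → ℝ × ℝ => (w t).2 := fun t =>
    (measurable_pi_apply t).snd
  have hC : ∀ k, MeasurableSet (C k) := fun k =>
    (measurableSet_le (hE _) measurable_const).inter (measurableSet_lt measurable_const (hE _))
  -- Splitting along the value of the cell.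
  have split : ∀ f : ℝ≥0 → Ω → ℝ≥0∞,
      ∫⁻ ω, f ((passCell δ (path Z Y ω) v + 1 : ℕ) * δ) ω ∂P =
        ∫⁻ ω, ∑' k : ℕ, (C k).indicator (fun _ => f ((k + 1 : ℕ) * δ) ω) (path Z Y ω) ∂P := by
    intro f
    refine lintegral_congr_ae ?_
    filter_upwards [ae_isRegularPath h, hpass] with ω hω hpω
    have h1 : path Z Y ω ∈ C (passCell δ (path Z Y ω) v) :=
      ⟨passCell_le hω hv, lt_of_passCell hω hδ hpω⟩
    rw [tsum_eq_single (passCell δ (path Z Y ω) v), indicator_of_mem h1]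
    intro k hk
    refine indicator_of_notMem (fun hc => hk ?_) _
    exact (passCell_eq hω hδ hv hc.1 hc.2).symm
  have hΨ1 : Measurable fun x : (ℝ × ℝ) × Ω => Ψ (x.1, fun s : ℚ≥0 => path Z Y x.2 s) :=
    hΨ.comp (measurable_fst.prodMk (measurable_pi_lambda _ fun s => (hev s).comp measurable_snd))
  have hsh : ∀ t : ℝ≥0, Measurable fun ω => Ψ (path Z Y ω t, shiftPath (path Z Y ω) t) := fun t =>
    hΨ.comp ((hev t).prodMk (measurable_pi_lambda _ fun s => (hev _).sub (hev _)))
  have hin : ∀ t : ℝ≥0, Measurable fun ω => ∫⁻ ω', Ψ (path Z Y ω t, fun s => path Z Y ω' s) ∂P :=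
    fun t => (hΨ1.lintegral_prod_right').comp (hev t)
  rw [split (fun t ω => Ψ (path Z Y ω t, shiftPath (path Z Y ω) t)),
    split (fun t ω => ∫⁻ ω', Ψ (path Z Y ω t, fun s => path Z Y ω' s) ∂P),
    lintegral_tsum, lintegral_tsum]
  rotate_left
  · intro k
    exact (((hin _).indicator (hp (hC k)))).aemeasurable
  · intro k
    exact ((hsh _).indicator (hp (hC k))).aemeasurable
  congr 1
  funext k
  set t : ℝ≥0 := (k + 1 : ℕ) * δ with ht
  have hmk : (k : ℝ≥0) * δ ≤ t := by rw [ht]; gcongr; simp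
  -- A functional of the stopped path and of the increments after `t`.
  let G : (ℝ≥0 → ℝ × ℝ) × (ℝ≥0 → ℝ × ℝ) → ℝ≥0∞ := fun x =>
    (C k).indicator (fun w => Ψ (w t, fun s : ℚ≥0 => x.2 s)) x.1
  have hG : Measurable G := by
    have : Measurable fun x : (ℝ≥0 → ℝ × ℝ) × (ℝ≥0 → ℝ × ℝ) => Ψ (x.1 t, fun s : ℚ≥0 => x.2 s) :=
      hΨ.comp (measurable_fst.eval.prodMk (measurable_pi_lambda _ fun s => measurable_snd.eval))
    exact this.indicator (measurable_fst (hC k))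
  have e := map_past_future (X := fun s ω => (Z s ω, Y s ω)) (P := P) (measurable_pair h)
    (ae_zero h) h.indep (map_increment h) t
  have m1 : Measurable fun ω => ((fun r => path Z Y ω (min r t)), fun r => path Z Y ω (t + r) -
      path Z Y ω t) :=
    (measurable_pi_lambda _ fun r => hev _).prodMk
      (measurable_pi_lambda _ fun r => (hev _).sub (hev _))
  have e1 := lintegral_map (μ := P) hG m1
  have e2 : ∫⁻ x, G x
        ∂((P.map fun ω r => path Z Y ω (min r t)).prod (P.map fun ω r => path Z Y ω r))
      = ∫⁻ ω, (∫⁻ ω', G (fun r => path Z Y ω (min r t), path Z Y ω') ∂P) ∂P := by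
    have hm1 : Measurable fun ω r => path Z Y ω (min r t) := measurable_pi_lambda _ fun r => hev _
    have := (Measure.isProbabilityMeasure_map (μ := P) hp.aemeasurable)
    rw [lintegral_prod _ hG.aemeasurable, lintegral_map hG.lintegral_prod_right' hm1]
    refine lintegral_congr fun ω => ?_
    exact lintegral_map (hG.comp measurable_prodMk_left) hp
  have e3 : P.map (fun ω => ((fun r => path Z Y ω (min r t)), fun r => path Z Y ω (t + r) -
      path Z Y ω t)) = (P.map fun ω r => path Z Y ω (min r t)).prod
      (P.map fun ω r => path Z Y ω r) := e
  rw [e3, e2] at e1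
  have hmin : ∀ ω, ((fun r => path Z Y ω (min r t)) ∈ C k) ↔ path Z Y ω ∈ C k := fun ω => by
    simp only [C, mem_ofPred_eq, ← ht, min_eq_left hmk, min_self]
  calc _ = ∫⁻ ω, G (fun r => path Z Y ω (min r t), fun r => path Z Y ω (t + r) -
      path Z Y ω t) ∂P := by
        refine lintegral_congr fun ω => ?_
        simp only [G]
        by_cases hc : path Z Y ω ∈ C k
        · rw [indicator_of_mem hc, indicator_of_mem ((hmin ω).2 hc)]; simp only [min_self]; rfl
        · rw [indicator_of_notMem hc, indicator_of_notMem fun h' => hc ((hmin ω).1 h')]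
    _ = _ := by
        rw [← e1]
        refine lintegral_congr fun ω => ?_
        simp only [G]
        by_cases hc : path Z Y ω ∈ C k
        · rw [indicator_of_mem hc]
          refine lintegral_congr fun ω' => ?_
          rw [indicator_of_mem ((hmin ω).2 hc)]; simp only [min_self]
        · rw [indicator_of_notMem hc]
          simp_rw [indicator_of_notMem fun h' => hc ((hmin ω).1 h')]
          simp

lemma aemeasurable_shiftPath (h : IsBivariateSubordinator P Z Y) {v : ℝ} (hv : 0 ≤ v)
    (hpass : ∀ᵐ ω ∂P, Passes (path Z Y ω) v) :
    AEMeasurable (fun ω => (path Z Y ω (passTime (path Z Y ω) v),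
      shiftPath (path Z Y ω) (passTime (path Z Y ω) v))) P := by
  refine aemeasurable_of_tendsto_metrizable_ae atTop
    (fun n => (measurable_shiftPath h (mesh n) v).aemeasurable) ?_
  filter_upwards [ae_isRegularPath h, hpass] with ω hω hp
  exact (tendsto_eval_passCell_right hω hv hp).prodMk_nhds (tendsto_shiftPath hω hv hp)

/-- **The strong Markov property at the first passage over `v`.** The increments after the
passage are independent of the value at the passage, and distributed like the whole path. -/
theorem map_shiftPath (h : IsBivariateSubordinator P Z Y) {v : ℝ} (hv : 0 ≤ v)
    (hpass : ∀ᵐ ω ∂P, Passes (path Z Y ω) v) :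
    P.map (fun ω => (path Z Y ω (passTime (path Z Y ω) v),
      shiftPath (path Z Y ω) (passTime (path Z Y ω) v))) =
      (P.map fun ω => path Z Y ω (passTime (path Z Y ω) v)).prod
        (P.map fun ω (s : ℚ≥0) => path Z Y ω s) := by
  have hm := aemeasurable_shiftPath h hv hpass
  have hm1 : AEMeasurable (fun ω => path Z Y ω (passTime (path Z Y ω) v)) P := hm.fst
  have hm2 : Measurable fun ω (s : ℚ≥0) => path Z Y ω s :=
    measurable_pi_lambda _ fun s => measurable_pair h s
  have i1 := Measure.isProbabilityMeasure_map hm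
  have i2 := Measure.isProbabilityMeasure_map hm1
  have i3 := Measure.isProbabilityMeasure_map (μ := P) hm2.aemeasurable
  have : TopologicalSpace.PseudoMetrizableSpace ((ℝ × ℝ) × (ℚ≥0 → ℝ × ℝ)) := inferInstance
  refine ext_of_forall_lintegral_eq_of_IsFiniteMeasure fun f => ?_
  have hf : Measurable fun x => (f x : ℝ≥0∞) := f.continuous.measurable.coe_nnreal_ennreal
  rw [lintegral_map' hf.aemeasurable hm, lintegral_prod _ hf.aemeasurable,
    lintegral_map' hf.lintegral_prod_right'.aemeasurable hm1]
  have hbd : ∀ x, (f x : ℝ≥0∞) ≤ (nndist f 0 : ℝ≥0) := fun x => by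
    have := BoundedContinuousFunction.NNReal.upper_bound f x
    exact_mod_cast this
  have hf1 : Continuous fun x => (f x : ℝ≥0∞) := ENNReal.continuous_coe.comp f.continuous
  have l1 : Tendsto (fun n => ∫⁻ ω, (f (path Z Y ω ((passCell (mesh n) (path Z Y ω) v + 1 : ℕ) *
      mesh n), shiftPath (path Z Y ω) ((passCell (mesh n) (path Z Y ω) v + 1 : ℕ) * mesh n)) :
        ℝ≥0∞) ∂P) atTop (𝓝 (∫⁻ ω, (f (path Z Y ω (passTime (path Z Y ω) v),
      shiftPath (path Z Y ω) (passTime (path Z Y ω) v)) : ℝ≥0∞) ∂P)) := by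
    refine tendsto_lintegral_of_dominated_convergence (fun _ => (nndist f 0 : ℝ≥0))
      (fun n => hf.comp (measurable_shiftPath h (mesh n) v))
      (fun n => Eventually.of_forall fun ω => hbd _) (by simp) ?_
    filter_upwards [ae_isRegularPath h, hpass] with ω hω hp
    exact (hf1.tendsto _).comp
      ((tendsto_eval_passCell_right hω hv hp).prodMk_nhds (tendsto_shiftPath hω hv hp))
  refine tendsto_nhds_unique l1 ?_
  simp_rw [lintegral_passCell_shiftPath h (mesh_pos _) hv hpass hf]
  refine tendsto_lintegral_of_dominated_convergence (fun _ => (nndist f 0 : ℝ≥0))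
    (fun n => ?_) (fun n => Eventually.of_forall fun ω => ?_) (by simp) ?_
  · have hg : Measurable fun x : ℝ × ℝ => ∫⁻ ω', (f (x, fun s : ℚ≥0 => path Z Y ω' s) : ℝ≥0∞) ∂P :=
      (hf.comp (measurable_fst.prodMk (hm2.comp measurable_snd))).lintegral_prod_right'
    exact hg.comp (measurable_shiftPath h (mesh n) v).fst
  · exact (lintegral_mono fun ω' => hbd _).trans (by simp)
  · filter_upwards [ae_isRegularPath h, hpass] with ω hω hp
    have hf2 : Measurable fun y => (f (path Z Y ω (passTime (path Z Y ω) v), y) : ℝ≥0∞) :=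
      hf.comp measurable_prodMk_left
    rw [lintegral_map hf2 hm2]
    refine tendsto_lintegral_of_dominated_convergence (fun _ => (nndist f 0 : ℝ≥0))
      (fun n => ?_) (fun n => Eventually.of_forall fun ω => hbd _) (by simp) ?_
    · exact hf.comp (measurable_const.prodMk hm2)
    · refine Eventually.of_forall fun ω' => (hf1.tendsto _).comp ?_
      exact (tendsto_eval_passCell_right hω hv hp).prodMk_nhds tendsto_const_nhds

/-- The strong Markov property, for events. -/
lemma measure_shiftPath (h : IsBivariateSubordinator P Z Y) {v : ℝ} (hv : 0 ≤ v)
    (hpass : ∀ᵐ ω ∂P, Passes (path Z Y ω) v) {S : Set ((ℝ × ℝ) × (ℚ≥0 → ℝ × ℝ))}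
    (hS : MeasurableSet S) :
    P {ω | (path Z Y ω (passTime (path Z Y ω) v),
      shiftPath (path Z Y ω) (passTime (path Z Y ω) v)) ∈ S} =
      ∫⁻ ω, P {ω' | (path Z Y ω (passTime (path Z Y ω) v),
        fun s : ℚ≥0 => path Z Y ω' s) ∈ S} ∂P := by
  have hm := aemeasurable_shiftPath h hv hpass
  have hm2 : Measurable fun ω (s : ℚ≥0) => path Z Y ω s :=
    measurable_pi_lambda _ fun s => measurable_pair h s
  have i3 := Measure.isProbabilityMeasure_map (μ := P) hm2.aemeasurable
  have e := congrArg (fun μ => μ S) (map_shiftPath h hv hpass)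
  simp only [Measure.map_apply_of_aemeasurable hm hS, Measure.prod_apply hS] at e
  rw [lintegral_map' (measurable_measure_prodMk_left hS).aemeasurable hm.fst] at e
  refine e.trans (lintegral_congr fun ω => ?_)
  rw [Measure.map_apply hm2 (measurable_prodMk_left hS)]
  rfl

/-- A nontrivial subordinator exceeds every level. -/
lemma ae_passes (h : IsBivariateSubordinator P Z Y) (hpos : 0 < laplaceExponent P Z Y 0 1) :
    ∀ᵐ ω ∂P, ∀ v, Passes (path Z Y ω) v := by
  have key : ∀ m : ℕ, ∀ᵐ ω ∂P, Passes (path Z Y ω) m := by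
    intro m
    have hle : ∀ n : ℕ, P {ω | ¬ Passes (path Z Y ω) m} ≤
        ENNReal.ofReal (Real.exp (m - n * laplaceExponent P Z Y 0 1)) := by
      intro n
      have e := lintegral_exp h le_rfl zero_le_one n
      have hmeas : Measurable fun ω => ENNReal.ofReal (Real.exp (-(0 * Z n ω) - 1 * Y n ω)) :=
        (measurable_exp_lin 0 1).comp (measurable_pair h n)
      have hM := meas_ge_le_lintegral_div (μ := P) hmeas.aemeasurable
        (ε := ENNReal.ofReal (Real.exp (-m))) (ENNReal.ofReal_pos.2 (Real.exp_pos _)).ne'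
        ENNReal.ofReal_ne_top
      rw [e, ← ENNReal.ofReal_div_of_pos (Real.exp_pos _), ← Real.exp_sub] at hM
      refine (measure_mono fun ω hω => ?_).trans (hM.trans_eq ?_)
      · have : Y n ω ≤ m := by
          by_contra! hc
          exact hω ⟨n, hc⟩
        refine ENNReal.ofReal_le_ofReal (Real.exp_le_exp.2 ?_)
        linarith
      · congr 2
        push_cast
        ring
    have hlim : Tendsto (fun n : ℕ => ENNReal.ofReal
        (Real.exp (m - n * laplaceExponent P Z Y 0 1))) atTop (𝓝 0) := by
      rw [← ENNReal.ofReal_zero]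
      refine (ENNReal.continuous_ofReal.tendsto _).comp (Real.tendsto_exp_atBot.comp ?_)
      have := (tendsto_natCast_atTop_atTop (R := ℝ)).atTop_mul_const hpos
      exact tendsto_atBot_add_const_left _ _ (tendsto_neg_atTop_atBot.comp this)
    exact le_antisymm (ge_of_tendsto' hlim hle) zero_le
  filter_upwards [ae_all_iff.2 key] with ω hω v
  obtain ⟨m, hm⟩ := exists_nat_ge v
  exact (hω m).mono hm

end Subordinator

end StrongMarkov

/-! ### Strictly increasing paths versus paths with flat pieces -/

section Dichotomy

variable {Ω : Type*} [MeasurableSpace Ω] {P : Measure Ω}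
  {Z Y : ℝ≥0 → Ω → ℝ} {q dZ dY : ℝ} {ν : Measure (ℝ × ℝ)}

namespace Subordinator

lemma measurableSet_level (h : IsBivariateSubordinator P Z Y) (s : ℝ≥0) (w : ℝ) :
    MeasurableSet {ω | Y s ω = w} :=
  h.measurable_snd s (measurableSet_singleton w)

lemma measure_eq_zero_add (h : IsBivariateSubordinator P Z Y) (r s : ℝ≥0) :
    P {ω | Y (r + s) ω = 0} = P {ω | Y r ω = 0} * P {ω | Y s ω = 0} := by
  have hS : MeasurableSet {p : ℝ × ℝ | p.2 = 0} := measurable_snd (measurableSet_singleton 0)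
  have hm : ∀ t, MeasurableSet {ω | Y t ω = 0} := fun t => measurableSet_level h t 0
  have e := lintegral_mul_increment h r s (measurable_one.indicator hS)
    (measurable_one.indicator hS)
  have e1 : ∀ t, ∫⁻ ω, {p : ℝ × ℝ | p.2 = 0}.indicator (1 : ℝ × ℝ → ℝ≥0∞) (Z t ω, Y t ω) ∂P =
      P {ω | Y t ω = 0} := fun t => by
    rw [← lintegral_indicator_one (hm t)]; rfl
  rw [e1, e1] at e
  rw [← e, ← lintegral_indicator_one (hm _)]
  refine lintegral_congr_ae ?_
  filter_upwards [ae_nonneg h, h.monotone] with ω h0 hmono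
  have h1 := (h0 r).2
  have h2 : Y r ω ≤ Y (r + s) ω := hmono.2 le_self_add
  by_cases hc : Y (r + s) ω = 0
  · have hr : Y r ω = 0 := by linarith
    simp [indicator, hc, hr]
  · by_cases hr : Y r ω = 0
    · simp [indicator, hc, hr]
    · simp [indicator, hc, hr]

variable [IsProbabilityMeasure P]

lemma measure_eq_zero_nat_mul (h : IsBivariateSubordinator P Z Y) (n : ℕ) (s : ℝ≥0) :
    P {ω | Y (n * s) ω = 0} = P {ω | Y s ω = 0} ^ n := by
  induction n with
  | zero =>
    have : ∀ᵐ ω ∂P, Y 0 ω = 0 := h.zero.mono fun _ hω => hω.2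
    simpa using (prob_compl_eq_zero_iff (μ := P) (measurableSet_level h 0 0)).1 this
  | succ n ih =>
    rw [pow_succ, ← ih, ← measure_eq_zero_add h]
    push_cast
    ring_nf

/-- If `Y` may stay at `0` for a positive time, then it does not hit `u` at its first passage
over `u`: it would have to leave `u` immediately. -/
lemma ae_passValue_ne_of_flat (h : IsBivariateSubordinator P Z Y) (hflat : P {ω | Y 1 ω = 0} ≠ 0)
    {u : ℝ} (hu : 0 ≤ u) :
    ∀ᵐ ω ∂P, Passes (path Z Y ω) u → (path Z Y ω (passTime (path Z Y ω) u)).2 ≠ u := by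
  rcases (laplaceExponent_nonneg h le_rfl zero_le_one).eq_or_lt with htriv | hpos
  · filter_upwards [not_passes_of_trivial h htriv.symm hu] with ω hω hp using absurd hp hω
  have hpass : ∀ᵐ ω ∂P, Passes (path Z Y ω) u := (ae_passes h hpos).mono fun ω hω => hω u
  set x := P {ω | Passes (path Z Y ω) u ∧ (path Z Y ω (passTime (path Z Y ω) u)).2 = u} with hx
  -- On the event in question the increment over `[T, T + s]` is positive for every `s > 0`.
  have hle : ∀ s : ℚ≥0, 0 < s → x ≤ 1 - P {ω | Y s ω = 0} := by
    intro s hs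
    have hS : MeasurableSet {y : (ℝ × ℝ) × (ℚ≥0 → ℝ × ℝ) | (y.2 s).2 ≠ 0} :=
      (measurable_snd.eval.snd (measurableSet_singleton 0)).compl
    have e := measure_shiftPath h hu hpass hS
    have e1 : P {ω' | (path Z Y ω' s).2 ≠ 0} = 1 - P {ω | Y s ω = 0} := by
      rw [← prob_compl_eq_one_sub (measurableSet_level h s 0)]; rfl
    simp only [mem_ofPred_eq, e1, lintegral_const, measure_univ, mul_one] at e
    rw [← e]
    refine measure_mono_ae ?_
    filter_upwards [ae_isRegularPath h] with ω hω hω'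
    have h1 := hω.lt_of_passTime_lt hω'.1 (s := passTime (path Z Y ω) u + s)
      (lt_add_of_pos_right _ (by exact_mod_cast hs))
    simp only [shiftPath, Prod.snd_sub, ne_eq]
    change (path Z Y ω _).2 - (path Z Y ω _).2 ≠ 0
    rw [hω'.2]
    exact (sub_pos.2 h1).ne'
  have hx0 : x = 0 := by
    by_contra hne
    have hx1 : x ≤ 1 := prob_le_one
    have hlt : 1 - x < 1 := ENNReal.sub_lt_self ENNReal.one_ne_top one_ne_zero hne
    -- `P(Y_1 = 0)` is the `n`-th power of `P(Y_{1/n} = 0) ≤ 1 - x`.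
    have hb : ∀ n : ℕ, P {ω | Y 1 ω = 0} ≤ (1 - x) ^ (n + 1) := by
      intro n
      have h1 := hle ((n : ℚ≥0) + 1)⁻¹ (by positivity)
      have h2 := measure_eq_zero_nat_mul h (n + 1) ((n : ℝ≥0) + 1)⁻¹
      have h3 : (((n + 1 : ℕ) : ℝ≥0) * ((n : ℝ≥0) + 1)⁻¹) = 1 := by
        push_cast
        exact mul_inv_cancel₀ (by positivity)
      rw [h3] at h2
      rw [h2]
      gcongr
      push_cast at h1
      refine ENNReal.le_sub_of_add_le_left (ne_top_of_le_ne_top ENNReal.one_ne_top hx1) ?_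
      calc x + _ ≤ (1 - P {ω | Y ((n : ℝ≥0) + 1)⁻¹ ω = 0}) + P {ω | Y ((n : ℝ≥0) + 1)⁻¹ ω = 0} := by
            gcongr
        _ = 1 := tsub_add_cancel_of_le prob_le_one
    have hlim : Tendsto (fun n : ℕ => (1 - x) ^ (n + 1)) atTop (𝓝 0) :=
      (ENNReal.tendsto_pow_atTop_nhds_zero_of_lt_one hlt).comp (tendsto_add_atTop_nat 1)
    exact hflat (le_antisymm (ge_of_tendsto' hlim hb) zero_le)
  have : ∀ᵐ ω ∂P, ¬ (Passes (path Z Y ω) u ∧ (path Z Y ω (passTime (path Z Y ω) u)).2 = u) := by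
    rw [ae_iff]
    simpa using hx0
  filter_upwards [this] with ω hω hp hc using hω ⟨hp, hc⟩

/-- If `Y` leaves `0` immediately, its paths are strictly increasing. -/
lemma ae_strictMono (h : IsBivariateSubordinator P Z Y) (hY : P {ω | Y 1 ω = 0} = 0) :
    ∀ᵐ ω ∂P, StrictMono fun s => Y s ω := by
  have hmesh : ∀ n, P {ω | Y (mesh n) ω = 0} = 0 := by
    intro n
    have h2 := measure_eq_zero_nat_mul h (n + 1) (mesh n)
    have h3 : (((n + 1 : ℕ) : ℝ≥0) * mesh n) = 1 := by
      unfold mesh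
      push_cast
      exact mul_inv_cancel₀ (by positivity)
    rw [h3, hY] at h2
    exact pow_eq_zero_iff (Nat.succ_ne_zero n) |>.1 h2.symm
  have hstep : ∀ n k : ℕ, ∀ᵐ ω ∂P, Y (k * mesh n + mesh n) ω - Y (k * mesh n) ω ≠ 0 := by
    intro n k
    have e := DFunLike.congr_fun (map_increment h (k * mesh n) (mesh n)) {p : ℝ × ℝ | p.2 = 0}
    have hS : MeasurableSet {p : ℝ × ℝ | p.2 = 0} := measurable_snd (measurableSet_singleton 0)
    have hd : Measurable fun ω => (Z (k * mesh n + mesh n) ω, Y (k * mesh n + mesh n) ω) -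
        (Z (k * mesh n) ω, Y (k * mesh n) ω) := (measurable_pair h _).sub (measurable_pair h _)
    rw [Measure.map_apply hd hS,
      Measure.map_apply (measurable_pair h _) hS] at e
    have e2 := e.trans (hmesh n)
    rw [ae_iff]
    simpa using e2
  filter_upwards [ae_all_iff.2 fun n => ae_all_iff.2 (hstep n), h.monotone] with ω hω hm s t hst
  obtain ⟨n, hn⟩ := (tendsto_mesh.eventually_lt_const (show (0 : ℝ≥0) < (t - s) / 2 from
    div_pos (tsub_pos_of_lt hst) two_pos)).exists
  have hn0 := mesh_pos n
  set k := ⌈s / mesh n⌉₊ with hk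
  have h1 : s ≤ k * mesh n := by
    rw [← div_le_iff₀ hn0]; exact Nat.le_ceil _
  have h2 : (k : ℝ≥0) * mesh n + mesh n ≤ t := by
    have h3 : (k : ℝ≥0) < s / mesh n + 1 := Nat.ceil_lt_add_one zero_le
    have h4 : (k : ℝ≥0) * mesh n ≤ s + mesh n := by
      calc (k : ℝ≥0) * mesh n ≤ (s / mesh n + 1) * mesh n := by gcongr
        _ = s + mesh n := by rw [add_mul, div_mul_cancel₀ _ hn0.ne', one_mul]
    calc (k : ℝ≥0) * mesh n + mesh n ≤ s + mesh n + mesh n := by gcongr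
      _ ≤ s + (t - s) / 2 + (t - s) / 2 := by gcongr
      _ = t := by rw [add_assoc, add_halves, add_tsub_cancel_of_le hst.le]
  have h5 : Y (k * mesh n) ω < Y (k * mesh n + mesh n) ω :=
    lt_of_le_of_ne (hm.2 le_self_add) fun hc => hω n k (by rw [hc, sub_self])
  exact (hm.2 h1).trans_lt (h5.trans_le (hm.2 h2))

lemma laplaceExponent_pos (h : IsBivariateSubordinator P Z Y) (hY : P {ω | Y 1 ω = 0} = 0) :
    0 < laplaceExponent P Z Y 0 1 := by
  refine (laplaceExponent_nonneg h le_rfl zero_le_one).lt_of_ne fun hc => ?_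
  have h1 : ∀ᵐ ω ∂P, Y 1 ω = 0 := (ae_eq_zero_of_trivial h hc.symm).mono fun ω hω => hω 1
  have h2 : ∀ᵐ ω ∂P, Y 1 ω ≠ 0 := by
    rw [ae_iff]; simpa using hY
  obtain ⟨ω, h3, h4⟩ := (h1.and h2).exists
  exact h4 h3

/-- A positive drift forces the paths of `Y` to be strictly increasing. -/
lemma measure_eq_zero_of_drift_pos (h : IsBivariateSubordinator P Z Y)
    (hν : HasDriftAndLevyMeasure P Z Y q dZ dY ν) (hd : 0 < dY) : P {ω | Y 1 ω = 0} = 0 := by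
  have hle : ∀ b : ℕ, P {ω | Y 1 ω = 0} ≤ ENNReal.ofReal (Real.exp (-(dY * b))) := by
    intro b
    have e := lintegral_exp h le_rfl (Nat.cast_nonneg (α := ℝ) b) 1
    have hψ : dY * b ≤ laplaceExponent P Z Y 0 b := by
      rw [HasDriftAndLevyMeasure.exponent_eq hν le_rfl (Nat.cast_nonneg b)]
      have : 0 ≤ ∫ r, (1 - Real.exp (-((0 : ℝ) * r.1) - b * r.2)) ∂ν := by
        refine integral_nonneg_of_ae ?_
        filter_upwards [HasDriftAndLevyMeasure.ae_support hν] with r hr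
        have : 0 ≤ (b : ℝ) * r.2 := mul_nonneg (Nat.cast_nonneg b) hr.2.1
        simp only [Pi.zero_apply, sub_nonneg, Real.exp_le_one_iff]
        linarith
      linarith
    calc P {ω | Y 1 ω = 0} = ∫⁻ ω, {ω | Y 1 ω = 0}.indicator 1 ω ∂P :=
          (lintegral_indicator_one (measurableSet_level h 1 0)).symm
      _ ≤ ∫⁻ ω, ENNReal.ofReal (Real.exp (-(0 * Z 1 ω) - b * Y 1 ω)) ∂P := by
          refine lintegral_mono fun ω => ?_
          by_cases hc : Y 1 ω = 0
          · simp [indicator, hc]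
          · simp [indicator, hc]
      _ ≤ _ := by
          rw [e]
          refine ENNReal.ofReal_le_ofReal (Real.exp_le_exp.2 ?_)
          simpa using hψ
  have hlim : Tendsto (fun b : ℕ => ENNReal.ofReal (Real.exp (-(dY * b)))) atTop (𝓝 0) := by
    rw [← ENNReal.ofReal_zero]
    refine (ENNReal.continuous_ofReal.tendsto _).comp (Real.tendsto_exp_atBot.comp ?_)
    exact tendsto_neg_atTop_atBot.comp
      ((tendsto_natCast_atTop_atTop (R := ℝ)).const_mul_atTop hd)
  exact le_antisymm (ge_of_tendsto' hlim hle) zero_le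

/-- A strictly increasing process spends no time at a level. -/
lemma ae_time_measure_eq_zero (h : IsBivariateSubordinator P Z Y) (hY : P {ω | Y 1 ω = 0} = 0)
    (w : ℝ) : ∀ᵐ s : ℝ ∂volume.restrict (Ioi 0), P {ω | Y s.toNNReal ω = w} = 0 := by
  have hc : Set.Countable {s : ℝ≥0 | 0 < P {ω | Y s ω = w}} := by
    refine Measure.countable_meas_pos_of_disjoint_iUnion₀
      (fun s => (h.measurable_snd s (measurableSet_singleton w)).nullMeasurableSet) ?_
    intro s t hst
    have : ∀ᵐ ω ∂P, ¬ (Y s ω = w ∧ Y t ω = w) := by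
      filter_upwards [ae_strictMono h hY] with ω hω hc
      exact hst (hω.injective (hc.1.trans hc.2.symm))
    rw [ae_iff] at this
    simp only [not_not] at this
    exact this
  have h0 : ∀ᵐ s : ℝ, s ∉ (fun s : ℝ≥0 => (s : ℝ)) '' {s : ℝ≥0 | 0 < P {ω | Y s ω = w}} :=
    (hc.image _).ae_notMem _
  filter_upwards [ae_restrict_of_ae h0, ae_restrict_mem measurableSet_Ioi] with s hs hs0
  by_contra hne
  exact hs ⟨s.toNNReal, pos_iff_ne_zero.2 hne, Real.coe_toNNReal s (le_of_lt hs0)⟩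

lemma renewalMeasure_ae_snd_ne (h : IsBivariateSubordinator P Z Y) (hY : P {ω | Y 1 ω = 0} = 0)
    (w : ℝ) : ∀ᵐ p ∂renewalMeasure P Z Y q, p.2 ≠ w := by
  have hS : MeasurableSet {p : ℝ × ℝ | p.2 = w} := measurable_snd (measurableSet_singleton w)
  rw [ae_iff]
  simp only [ne_eq, not_not]
  rw [← lintegral_indicator_one hS, lintegral_renewalMeasure h q (measurable_one.indicator hS)]
  refine lintegral_eq_zero_of_ae_eq_zero ?_
  filter_upwards [ae_time_measure_eq_zero h hY w] with s hs
  have e : ∫⁻ ω, {p : ℝ × ℝ | p.2 = w}.indicator (1 : ℝ × ℝ → ℝ≥0∞)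
      (Z s.toNNReal ω, Y s.toNNReal ω) ∂P = P {ω | Y s.toNNReal ω = w} := by
    rw [← lintegral_indicator_one (measurableSet_level h _ w)]; rfl
  rw [e, hs, mul_zero]; rfl

lemma renewalMeasure_swap_ae_fst_ne (h : IsBivariateSubordinator P Z Y)
    (hY : P {ω | Y 1 ω = 0} = 0) (w : ℝ) : ∀ᵐ p ∂renewalMeasure P Y Z q, p.1 ≠ w := by
  have hS : MeasurableSet {p : ℝ × ℝ | p.1 = w} := measurable_fst (measurableSet_singleton w)
  rw [ae_iff]
  simp only [ne_eq, not_not]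
  rw [← lintegral_indicator_one hS,
    lintegral_renewalMeasure (swap h) q (measurable_one.indicator hS)]
  refine lintegral_eq_zero_of_ae_eq_zero ?_
  filter_upwards [ae_time_measure_eq_zero h hY w] with s hs
  have e : ∫⁻ ω, {p : ℝ × ℝ | p.1 = w}.indicator (1 : ℝ × ℝ → ℝ≥0∞)
      (Y s.toNNReal ω, Z s.toNNReal ω) ∂P = P {ω | Y s.toNNReal ω = w} := by
    rw [← lintegral_indicator_one (measurableSet_level h _ w)]; rfl
  rw [e, hs, mul_zero]; rfl

/-- A property of jumps that fails almost everywhere under `V ⊗ ν` almost surely fails for the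
jump at the first passage over a fixed level. -/
lemma ae_passJump_notMem (h : IsBivariateSubordinator P Z Y)
    (hν : HasDriftAndLevyMeasure P Z Y q dZ dY ν) (hq : 0 ≤ q) {u : ℝ} (hu : 0 ≤ u)
    {S : Set ((ℝ × ℝ) × (ℝ × ℝ))} (hS : MeasurableSet S) (hS0 : ∀ p r, (p, r) ∈ S → 0 < r.2)
    (hnull : ∫⁻ p, ν {r | (p, r) ∈ S} ∂renewalMeasure P Z Y q = 0) :
    ∀ᵐ ω ∂P, Passes (path Z Y ω) u →
      (prePassage (path Z Y ω) u, passJump (path Z Y ω) u) ∉ S := by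
  have hle := lintegral_passJump_le h hν hq hu (measurable_one.indicator hS)
    (f := S.indicator 1) (fun p r hpr => hS0 p r (mem_of_indicator_ne_zero hpr))
  have e : ∀ p, ∫⁻ r, S.indicator (1 : (ℝ × ℝ) × (ℝ × ℝ) → ℝ≥0∞) (p, r) ∂ν =
      ν {r | (p, r) ∈ S} := fun p => by
    exact lintegral_indicator_one (measurable_prodMk_left (x := p) hS)
  simp_rw [e, hnull] at hle
  have h0 := (lintegral_eq_zero_iff' ((aemeasurable_passWeight h hu).mul
    ((measurable_one.indicator hS).comp_aemeasurable (aemeasurable_passData h hu)))).1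
    (le_antisymm hle zero_le)
  filter_upwards [h0] with ω hω hp hmem
  simp only [Pi.mul_apply, Function.comp_apply, indicator_of_mem hmem, Pi.one_apply, mul_one,
    Pi.zero_apply, passWeight, if_pos hp, ENNReal.ofReal_eq_zero] at hω
  exact absurd (Real.exp_pos _) (not_lt.2 hω)

/-- A strictly increasing `Y` does not land on `u`, nor depart from `u`, by a jump. -/
lemma ae_gap_ne (h : IsBivariateSubordinator P Z Y)
    (hν : HasDriftAndLevyMeasure P Z Y q dZ dY ν) (hq : 0 ≤ q) (hY : P {ω | Y 1 ω = 0} = 0)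
    {u : ℝ} (hu : 0 ≤ u) :
    ∀ᵐ ω ∂P, Passes (path Z Y ω) u → 0 < (passJump (path Z Y ω) u).2 →
      (prePassage (path Z Y ω) u).2 ≠ u ∧
        (prePassage (path Z Y ω) u).2 + (passJump (path Z Y ω) u).2 ≠ u := by
  have hκ : 0 < q + laplaceExponent P Z Y 0 1 := by
    have := laplaceExponent_pos h hY
    linarith
  have := sFinite_renewalMeasure h hκ
  have := HasDriftAndLevyMeasure.sFinite hν
  have m1 : MeasurableSet {x : (ℝ × ℝ) × (ℝ × ℝ) | 0 < x.2.2} :=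
    measurableSet_lt measurable_const measurable_snd.snd
  have m2 : MeasurableSet {x : (ℝ × ℝ) × (ℝ × ℝ) | x.1.2 = u} :=
    measurable_fst.snd (measurableSet_singleton u)
  have m3 : MeasurableSet {x : (ℝ × ℝ) × (ℝ × ℝ) | x.1.2 + x.2.2 = u} :=
    (measurable_fst.snd.add measurable_snd.snd) (measurableSet_singleton u)
  have a1 := ae_passJump_notMem h hν hq hu (m1.inter m2) (fun p r hpr => hpr.1) (by
    refine lintegral_eq_zero_of_ae_eq_zero ?_
    filter_upwards [renewalMeasure_ae_snd_ne h hY u] with p hp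
    have : {r : ℝ × ℝ | (p, r) ∈ {x : (ℝ × ℝ) × (ℝ × ℝ) | 0 < x.2.2} ∩ {x | x.1.2 = u}} = ∅ :=
      eq_empty_of_forall_notMem fun r hr => hp hr.2
    rw [this, measure_empty]; rfl)
  have a2 := ae_passJump_notMem h hν hq hu (m1.inter m3) (fun p r hpr => hpr.1) (by
    -- For a fixed jump `r` only the level `u - r₂` before the jump leads to `u`.
    have e := Measure.prod_apply (μ := renewalMeasure P Z Y q) (ν := ν) (m1.inter m3)
    have e' := Measure.prod_apply_symm (μ := renewalMeasure P Z Y q) (ν := ν) (m1.inter m3)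
    refine (e.symm.trans e').trans ?_
    have : ∀ r : ℝ × ℝ, renewalMeasure P Z Y q ((fun p => (p, r)) ⁻¹'
        ({x : (ℝ × ℝ) × (ℝ × ℝ) | 0 < x.2.2} ∩ {x | x.1.2 + x.2.2 = u})) = 0 := fun r => by
      refine measure_mono_null (fun p hp => ?_) (ae_iff.1 (renewalMeasure_ae_snd_ne h hY (u - r.2)))
      have : p.2 + r.2 = u := hp.2
      simp only [ne_eq, not_not, mem_ofPred_eq]
      linarith
    simp_rw [this]
    simp)
  filter_upwards [a1, a2] with ω h1 h2 hp hj
  exact ⟨fun hc => h1 hp ⟨hj, hc⟩, fun hc => h2 hp ⟨hj, hc⟩⟩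

/-- At a continuous passage of `Y` over `u` the first coordinate does not jump: otherwise `Y`
would equal `u` just before the passage of `Z` over some rational level. -/
lemma ae_passJump_fst_eq_zero (h : IsBivariateSubordinator P Z Y)
    (hν : HasDriftAndLevyMeasure P Z Y q dZ dY ν) (hq : 0 ≤ q) (hY : P {ω | Y 1 ω = 0} = 0)
    (u : ℝ) :
    ∀ᵐ ω ∂P, (prePassage (path Z Y ω) u).2 = u → (passJump (path Z Y ω) u).1 = 0 := by
  have m1 : MeasurableSet {x : (ℝ × ℝ) × (ℝ × ℝ) | 0 < x.2.2} :=
    measurableSet_lt measurable_const measurable_snd.snd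
  have m2 : MeasurableSet {x : (ℝ × ℝ) × (ℝ × ℝ) | x.1.1 = u} :=
    measurable_fst.fst (measurableSet_singleton u)
  have a1 : ∀ v : ℚ, 0 ≤ (v : ℝ) → ∀ᵐ ω ∂P, Passes (path Y Z ω) v →
      (prePassage (path Y Z ω) v, passJump (path Y Z ω) v) ∉
        {x : (ℝ × ℝ) × (ℝ × ℝ) | 0 < x.2.2} ∩ {x | x.1.1 = u} := fun v hv =>
    ae_passJump_notMem (swap h) (HasDriftAndLevyMeasure.swap hν) hq hv (m1.inter m2)
      (fun p r hpr => hpr.1) (by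
        refine lintegral_eq_zero_of_ae_eq_zero ?_
        filter_upwards [renewalMeasure_swap_ae_fst_ne h hY u] with p hp
        have : {r : ℝ × ℝ | (p, r) ∈ {x : (ℝ × ℝ) × (ℝ × ℝ) | 0 < x.2.2} ∩ {x | x.1.1 = u}} = ∅ :=
          eq_empty_of_forall_notMem fun r hr => hp hr.2
        rw [this, measure_empty]; rfl)
  have a2 : ∀ᵐ ω ∂P, ∀ v : ℚ, 0 ≤ (v : ℝ) → Passes (path Y Z ω) v →
      (prePassage (path Y Z ω) v, passJump (path Y Z ω) v) ∉
        {x : (ℝ × ℝ) × (ℝ × ℝ) | 0 < x.2.2} ∩ {x | x.1.1 = u} :=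
    ae_all_iff.2 fun v => by
      by_cases hv : 0 ≤ (v : ℝ)
      · exact (a1 v hv).mono fun ω hω _ => hω
      · exact Eventually.of_forall fun ω hc => absurd hc hv
  filter_upwards [a2, ae_isRegularPath h, ae_isRegularPath (swap h)] with ω hω hr hr' hpre
  refine le_antisymm (not_lt.1 fun hj => ?_) hr.passJump_fst_nonneg
  have hlt : (prePassage (path Z Y ω) u).1 < (path Z Y ω (passTime (path Z Y ω) u)).1 := by
    simpa [passJump] using hj
  obtain ⟨v, hv1, hv2⟩ := exists_rat_btwn hlt
  have hv0 : 0 ≤ (v : ℝ) := hr.prePassage_fst_nonneg.trans hv1.le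
  obtain ⟨hp, ht⟩ := hr'.passTime_eq_of_mem_gap (t := passTime (path Z Y ω) u) (v := v)
    hv1.le hv2
  refine hω v hv0 hp ⟨?_, ?_⟩
  · simp only [mem_ofPred_eq, passJump, prePassage, ht, Prod.snd_sub]
    exact sub_pos.2 hlt
  · simp only [mem_ofPred_eq, prePassage, ht]
    exact hpre

/-- When a strictly increasing `Y` hits `u` at its passage over `u`, the pair passes
continuously. -/
lemma ae_creep (h : IsBivariateSubordinator P Z Y)
    (hν : HasDriftAndLevyMeasure P Z Y q dZ dY ν) (hq : 0 ≤ q) (hY : P {ω | Y 1 ω = 0} = 0)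
    {u : ℝ} (hu : 0 ≤ u) :
    ∀ᵐ ω ∂P, Passes (path Z Y ω) u →
      (prePassage (path Z Y ω) u).2 + (passJump (path Z Y ω) u).2 = u →
        (prePassage (path Z Y ω) u).2 = u ∧ passJump (path Z Y ω) u = 0 := by
  filter_upwards [ae_gap_ne h hν hq hY hu, ae_passJump_fst_eq_zero h hν hq hY u,
    ae_isRegularPath h] with ω h1 h2 hr hp he
  have hj : (passJump (path Z Y ω) u).2 = 0 :=
    le_antisymm (not_lt.1 fun hc => (h1 hp hc).2 he) hr.passJump_snd_nonneg
  have hpre : (prePassage (path Z Y ω) u).2 = u := by linarith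
  exact ⟨hpre, Prod.ext (h2 hpre) hj⟩

end Subordinator

end Dichotomy

/-! ### The killing time and the jump term -/

/-- The quadruple overshoot, undershoot, jump of `Z`, `Z` before the passage, in terms of the
value `p` before the passage and the jump `r`. -/
def quadruple (u : ℝ) (x : (ℝ × ℝ) × (ℝ × ℝ)) : ℝ × ℝ × ℝ × ℝ :=
  (x.1.2 + x.2.2 - u, u - x.1.2, x.2.1, x.1.1)

lemma measurable_quadruple (u : ℝ) : Measurable (quadruple u) := by
  unfold quadruple; fun_prop

lemma passageQuadruple_eq {Ω : Type*} {Z Y : ℝ≥0 → Ω → ℝ} {u : ℝ} (ω : Ω) :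
    passageQuadruple Z Y u ω =
      quadruple u (prePassage (path Z Y ω) u, passJump (path Z Y ω) u) := by
  have h1 : (passageTime Y u ω).toNNReal = passTime (path Z Y ω) u := rfl
  simp only [passageQuadruple, quadruple, valueAt, leftValueAt, h1, passJump, Prod.snd_sub,
    add_sub_cancel, Prod.fst_sub]
  rfl

section Killing

variable {Ω : Type*} [MeasurableSpace Ω] {P : Measure Ω} {Z Y : ℝ≥0 → Ω → ℝ} {q dZ dY : ℝ}
  {ν : Measure (ℝ × ℝ)}

namespace Subordinator

/-- The jump term of the quadruple law in terms of the renewal and the Lévy measure. -/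
lemma jumpTerm_eq (hν : HasDriftAndLevyMeasure P Z Y q dZ dY ν) (u : ℝ)
    {B : Set (ℝ × ℝ × ℝ × ℝ)} (hB : MeasurableSet B) :
    jumpTerm P Z Y q ν u B = ∫⁻ p, (∫⁻ r, {x : (ℝ × ℝ) × (ℝ × ℝ) |
      u ∈ Ico x.1.2 (x.1.2 + x.2.2) ∧ quadruple u x ∈ B}.indicator 1 (p, r) ∂ν)
        ∂renewalMeasure P Z Y q := by
  have := HasDriftAndLevyMeasure.sFinite hν
  have hm : ∀ y : ℝ, Measurable fun r : ℝ × ℝ => (r.1, r.2 - y) := fun y => by fun_prop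
  have hpos : MeasurableSet {r : ℝ × ℝ | 0 < r.2} :=
    measurableSet_lt measurable_const measurable_snd
  let C : Set ((ℝ × ℝ) × (ℝ × ℝ)) :=
    {x | (x.2.2 - x.1.2, x.1.2, x.2.1, x.1.1) ∈ B ∧ 0 < x.2.2 - x.1.2}
  have hC : MeasurableSet C := by
    have h1 : Measurable fun x : (ℝ × ℝ) × (ℝ × ℝ) => (x.2.2 - x.1.2, x.1.2, x.2.1, x.1.1) := by
      fun_prop
    have h2 : Measurable fun x : (ℝ × ℝ) × (ℝ × ℝ) => x.2.2 - x.1.2 := by fun_prop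
    exact (h1 hB).inter (measurableSet_lt measurable_const h2)
  have e1 : ∀ p : ℝ × ℝ, shiftedLevyMeasure ν p.2 {r | (r.2, p.2, r.1, p.1) ∈ B} =
      ν (Prod.mk p ⁻¹' C) := by
    intro p
    have hB' : MeasurableSet {r : ℝ × ℝ | (r.2, p.2, r.1, p.1) ∈ B} := by
      have : Measurable fun r : ℝ × ℝ => (r.2, p.2, r.1, p.1) := by fun_prop
      exact this hB
    rw [shiftedLevyMeasure, Measure.restrict_apply hB', Measure.map_apply (hm _) (hB'.inter hpos)]
    rfl
  have hu2 : MeasurableSet {p : ℝ × ℝ | p.2 ≤ u} := measurableSet_le measurable_snd measurable_const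
  have hI : MeasurableSet {x : (ℝ × ℝ) × (ℝ × ℝ) |
      u ∈ Ico x.1.2 (x.1.2 + x.2.2) ∧ quadruple u x ∈ B} := by
    have h3 : Measurable fun x : (ℝ × ℝ) × (ℝ × ℝ) => x.1.2 + x.2.2 := by fun_prop
    exact ((measurableSet_le measurable_fst.snd measurable_const).inter
      (measurableSet_lt measurable_const h3)).inter (measurable_quadruple u hB)
  unfold jumpTerm reflectedRenewalMeasure
  simp_rw [e1]
  rw [lintegral_map (measurable_measure_prodMk_left hC) (by fun_prop),
    ← lintegral_indicator hu2]
  refine lintegral_congr fun p => ?_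
  have e4 : ∫⁻ r, {x : (ℝ × ℝ) × (ℝ × ℝ) | u ∈ Ico x.1.2 (x.1.2 + x.2.2) ∧
      quadruple u x ∈ B}.indicator (1 : (ℝ × ℝ) × (ℝ × ℝ) → ℝ≥0∞) (p, r) ∂ν =
      ν (Prod.mk p ⁻¹' {x : (ℝ × ℝ) × (ℝ × ℝ) | u ∈ Ico x.1.2 (x.1.2 + x.2.2) ∧
        quadruple u x ∈ B}) :=
    lintegral_indicator_one (measurable_prodMk_left (x := p) hI)
  rw [e4]
  by_cases hp : p ∈ {p : ℝ × ℝ | p.2 ≤ u}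
  · rw [indicator_of_mem hp]
    congr 1
    ext r
    change ((r.2 - (u - p.2), u - p.2, r.1, p.1) ∈ B ∧ 0 < r.2 - (u - p.2)) ↔
      ((p.2 ≤ u ∧ u < p.2 + r.2) ∧ (p.2 + r.2 - u, u - p.2, r.1, p.1) ∈ B)
    have : r.2 - (u - p.2) = p.2 + r.2 - u := by ring
    have hp' : p.2 ≤ u := hp
    rw [this, sub_pos]
    tauto
  · rw [indicator_of_notMem hp]
    refine (measure_mono_null (fun r hr => ?_) measure_empty).symm
    exact hp hr.1.1

variable [IsProbabilityMeasure P]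

lemma aemeasurable_passWeight_mul (h : IsBivariateSubordinator P Z Y) {v : ℝ} (hv : 0 ≤ v)
    {f : (ℝ × ℝ) × (ℝ × ℝ) → ℝ≥0∞} (hf : Measurable f) :
    AEMeasurable (fun ω => passWeight q (path Z Y ω) v *
      f (prePassage (path Z Y ω) v, passJump (path Z Y ω) v)) P :=
  (aemeasurable_passWeight h hv).mul (hf.comp_aemeasurable (aemeasurable_passData h hv))

/-- The independent exponential time enters through the weight `e^{-q T}` only. -/
lemma measure_passage_lt (h : IsBivariateSubordinator P Z Y) {e : Ω → ℝ≥0∞}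
    (he : IsExponentialTime P q e) (hind : IndepFun e (path Z Y) P) {u : ℝ} (hu : 0 ≤ u)
    {B : Set (ℝ × ℝ × ℝ × ℝ)} (hB : MeasurableSet B) :
    P {ω | passageQuadruple Z Y u ω ∈ B ∧ passageTime Y u ω < e ω} =
      ∫⁻ ω, passWeight q (path Z Y ω) u * B.indicator 1
        (quadruple u (prePassage (path Z Y ω) u, passJump (path Z Y ω) u)) ∂P := by
  obtain ⟨S, hS, hS'⟩ := exists_measurableSet_passes
  obtain ⟨D, hD, hD'⟩ := exists_measurable_passData
  have hpath := measurable_path h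
  have m0 : Measurable fun x : (ℝ≥0 → ℝ × ℝ) × ℝ≥0∞ => (u, x.1) :=
    measurable_const.prodMk measurable_fst
  let C : Set ((ℝ≥0 → ℝ × ℝ) × ℝ≥0∞) :=
    {x | (u, x.1) ∈ S ∧ quadruple u (D (u, x.1)).2 ∈ B ∧ ((D (u, x.1)).1 : ℝ≥0∞) < x.2}
  have hC : MeasurableSet C := by
    refine (m0 hS).inter (((measurable_quadruple u).comp (hD.comp m0).snd hB).inter ?_)
    exact measurableSet_lt (hD.comp m0).fst.coe_nnreal_ennreal measurable_snd
  have e1 : P {ω | passageQuadruple Z Y u ω ∈ B ∧ passageTime Y u ω < e ω} =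
      P {ω | (path Z Y ω, e ω) ∈ C} := by
    refine measure_congr ?_
    filter_upwards [ae_isRegularPath h] with ω hω
    refine propext ?_
    change (passageQuadruple Z Y u ω ∈ B ∧ passageTime Y u ω < e ω) ↔
      ((u, path Z Y ω) ∈ S ∧ quadruple u (D (u, path Z Y ω)).2 ∈ B ∧
        ((D (u, path Z Y ω)).1 : ℝ≥0∞) < e ω)
    rw [hS' _ hω, hD' _ hω u hu, passageQuadruple_eq]
    change (_ ∧ firstPassage (fun s => (path Z Y ω s).2) u < e ω) ↔
      (_ ∧ _ ∧ (passTime (path Z Y ω) u : ℝ≥0∞) < e ω)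
    constructor
    · rintro ⟨h1, h2⟩
      have hp : Passes (path Z Y ω) u := firstPassage_ne_top_iff.1 (h2.trans_le le_top).ne
      exact ⟨hp, h1, hp.coe_passTime ▸ h2⟩
    · rintro ⟨hp, h1, h2⟩
      exact ⟨h1, hp.coe_passTime ▸ h2⟩
  have hmap := (indepFun_iff_map_prod_eq_prod_map_map hpath.aemeasurable he.1.aemeasurable).1
    hind.symm
  have i1 := Measure.isProbabilityMeasure_map (μ := P) hpath.aemeasurable
  have i2 := Measure.isProbabilityMeasure_map (μ := P) he.1.aemeasurable
  have e2 : P {ω | (path Z Y ω, e ω) ∈ C} = P.map (fun ω => (path Z Y ω, e ω)) C :=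
    (Measure.map_apply (hpath.prodMk he.1) hC).symm
  rw [e1, e2, hmap, Measure.prod_apply hC,
    lintegral_map (measurable_measure_prodMk_left hC) hpath]
  refine lintegral_congr_ae ?_
  filter_upwards [ae_isRegularPath h] with ω hω
  rw [Measure.map_apply he.1 (measurable_prodMk_left hC)]
  have e3 : e ⁻¹' (Prod.mk (path Z Y ω) ⁻¹' C) = {ω' | Passes (path Z Y ω) u ∧
      quadruple u (prePassage (path Z Y ω) u, passJump (path Z Y ω) u) ∈ B ∧
        (passTime (path Z Y ω) u : ℝ≥0∞) < e ω'} := by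
    ext ω'
    change ((u, path Z Y ω) ∈ S ∧ quadruple u (D (u, path Z Y ω)).2 ∈ B ∧
        ((D (u, path Z Y ω)).1 : ℝ≥0∞) < e ω') ↔ _
    rw [hS' _ hω, hD' _ hω u hu]
    rfl
  rw [e3]
  by_cases hp : Passes (path Z Y ω) u
  · by_cases hb : quadruple u (prePassage (path Z Y ω) u, passJump (path Z Y ω) u) ∈ B
    · simp only [hp, hb, true_and, indicator_of_mem, Pi.one_apply, mul_one, passWeight, if_true]
      exact he.2 _
    · simp [hb]
  · simp [hp, passWeight]

/-- The law of the quadruple is the jump term plus the contribution of the paths that hit `u`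
exactly at the passage. -/
lemma measure_passage_eq (h : IsBivariateSubordinator P Z Y)
    (hν : HasDriftAndLevyMeasure P Z Y q dZ dY ν) (hq : 0 ≤ q) {e : Ω → ℝ≥0∞}
    (he : IsExponentialTime P q e) (hind : IndepFun e (path Z Y) P) {u : ℝ} (hu : 0 ≤ u)
    {B : Set (ℝ × ℝ × ℝ × ℝ)} (hB : MeasurableSet B) :
    P {ω | passageQuadruple Z Y u ω ∈ B ∧ passageTime Y u ω < e ω} =
      jumpTerm P Z Y q ν u B + ∫⁻ ω, passWeight q (path Z Y ω) u *
        {x : (ℝ × ℝ) × (ℝ × ℝ) | x.1.2 + x.2.2 = u ∧ quadruple u x ∈ B}.indicator 1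
          (prePassage (path Z Y ω) u, passJump (path Z Y ω) u) ∂P := by
  have h3 : Measurable fun x : (ℝ × ℝ) × (ℝ × ℝ) => x.1.2 + x.2.2 := by fun_prop
  have hI : MeasurableSet {x : (ℝ × ℝ) × (ℝ × ℝ) |
      u ∈ Ico x.1.2 (x.1.2 + x.2.2) ∧ quadruple u x ∈ B} :=
    ((measurableSet_le measurable_fst.snd measurable_const).inter
      (measurableSet_lt measurable_const h3)).inter (measurable_quadruple u hB)
  rw [jumpTerm_eq hν u hB, ← lintegral_passJump_eq h hν hq hu (measurable_one.indicator hI)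
    (fun p r hpr => (mem_of_indicator_ne_zero hpr).1), measure_passage_lt h he hind hu hB,
    ← lintegral_add_left' (aemeasurable_passWeight_mul h hu (measurable_one.indicator hI))]
  refine lintegral_congr_ae ?_
  filter_upwards [ae_isRegularPath h] with ω hω
  by_cases hp : Passes (path Z Y ω) u
  · rw [← mul_add]
    congr 1
    have h1 := hω.prePassage_snd_le hu hp
    have h2 := hω.le_prePassage_add_passJump_snd hp
    by_cases hb : quadruple u (prePassage (path Z Y ω) u, passJump (path Z Y ω) u) ∈ B
    · rcases h2.eq_or_lt with h4 | h4
      · simp [indicator, hb, h1, ← h4]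
      · simp [indicator, hb, h1, h4, h4.ne']
    · simp [indicator, hb]
  · simp [passWeight, hp]

end Subordinator

end Killing

/-! ### The mass of the paths that hit a level at its passage -/

section Creep

variable {Ω : Type*} [MeasurableSpace Ω] {P : Measure Ω} [IsProbabilityMeasure P]
  {Z Y : ℝ≥0 → Ω → ℝ} {q dZ dY : ℝ} {ν : Measure (ℝ × ℝ)}

lemma passWeight_le_one (hq : 0 ≤ q) (w : ℝ≥0 → ℝ × ℝ) (v : ℝ) : passWeight q w v ≤ 1 := by
  unfold passWeight
  split_ifs
  · rw [← ENNReal.ofReal_one]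
    refine ENNReal.ofReal_le_ofReal (Real.exp_le_one_iff.2 ?_)
    have := mul_nonneg hq (passTime w v).2
    simp only [NNReal.val_eq_coe] at this
    linarith
  · exact zero_le

/-- The event `Z_{T-} ∈ A`, `Y_T ≤ v` for the passage data `x` at the level `v`; at a passage
`Y_T ≥ v`, so that the second condition says `Y_T = v`. -/
def creepSet (A : Set ℝ) (v : ℝ) : Set ((ℝ × ℝ) × (ℝ × ℝ)) :=
  {x | x.1.1 ∈ A ∧ x.1.2 + x.2.2 ≤ v}

/-- The mass `E[e^{-q T}; Z_{T-} ∈ A, Y_T = v]` for the first passage time `T` over `v`. -/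
noncomputable def creepMass (P : Measure Ω) (Z Y : ℝ≥0 → Ω → ℝ) (q : ℝ) (A : Set ℝ) (v : ℝ) :
    ℝ≥0∞ :=
  ∫⁻ ω, passWeight q (path Z Y ω) v *
    (creepSet A v).indicator 1 (prePassage (path Z Y ω) v, passJump (path Z Y ω) v) ∂P

lemma measurableSet_creepSet {A : Set ℝ} (hA : MeasurableSet A) (v : ℝ) :
    MeasurableSet (creepSet A v) := by
  have h3 : Measurable fun x : (ℝ × ℝ) × (ℝ × ℝ) => x.1.2 + x.2.2 := by fun_prop
  exact (measurable_fst.fst hA).inter (measurableSet_le h3 measurable_const)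

lemma creepMass_le_one (hq : 0 ≤ q) (A : Set ℝ) (v : ℝ) : creepMass P Z Y q A v ≤ 1 := by
  calc creepMass P Z Y q A v ≤ ∫⁻ _, 1 ∂P := by
        refine lintegral_mono fun ω => ?_
        refine mul_le_one' (passWeight_le_one hq _ _) ?_
        exact indicator_le_self' (fun _ _ => zero_le) _
    _ = 1 := by simp

namespace Subordinator

lemma measurable_creepTest {A : Set ℝ} (hA : MeasurableSet A) {I : Set ℝ} (hI : MeasurableSet I) :
    Measurable fun x : ℝ × (ℝ × ℝ) × (ℝ × ℝ) =>
      I.indicator (1 : ℝ → ℝ≥0∞) x.1 * (creepSet A x.1).indicator 1 x.2 := by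
  have h3 : Measurable fun x : ℝ × (ℝ × ℝ) × (ℝ × ℝ) => x.2.1.2 + x.2.2.2 := by fun_prop
  have hS : MeasurableSet {x : ℝ × (ℝ × ℝ) × (ℝ × ℝ) | x.2.1.1 ∈ A ∧ x.2.1.2 + x.2.2.2 ≤ x.1} :=
    (measurable_snd.fst.fst hA).inter (measurableSet_le h3 measurable_fst)
  exact ((measurable_one.indicator hI).comp measurable_fst).mul (measurable_one.indicator hS)

lemma aemeasurable_creepMass (h : IsBivariateSubordinator P Z Y) {A : Set ℝ}
    (hA : MeasurableSet A) :
    AEMeasurable (creepMass P Z Y q A) (volume.restrict (Ioi 0)) := by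
  have := (aemeasurable_prod_passWeight_mul (q := q) h
    (measurable_creepTest hA MeasurableSet.univ)).lintegral_prod_right'
  refine this.congr (Eventually.of_forall fun v => ?_)
  simp [creepMass]

/-- The renewal measure charges the levels hit at their passage only through the drift. -/
lemma lintegral_creepMass (h : IsBivariateSubordinator P Z Y)
    (hν : HasDriftAndLevyMeasure P Z Y q dZ dY ν) (hq : 0 ≤ q)
    (hpos : 0 < laplaceExponent P Z Y 0 1) {A : Set ℝ} (hA : MeasurableSet A) {I : Set ℝ}
    (hI : MeasurableSet I) :
    ∫⁻ v in Ioi (0 : ℝ), I.indicator 1 v * creepMass P Z Y q A v =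
      ENNReal.ofReal dY * renewalMeasure P Z Y q (A ×ˢ I) := by
  have e := lintegral_passWeight h hν hq hpos (measurable_creepTest hA hI)
  have e1 : ∀ p r : ℝ × ℝ, ∫⁻ v in Ico p.2 (p.2 + r.2), I.indicator (1 : ℝ → ℝ≥0∞) v *
      (creepSet A v).indicator 1 (p, r) = 0 := fun p r => by
    refine (setLIntegral_congr_fun measurableSet_Ico fun v hv => ?_).trans lintegral_zero
    have : (p, r) ∉ creepSet A v := fun hc => absurd hv.2 (not_lt.2 hc.2)
    simp [this]
  have e2 : ∀ p : ℝ × ℝ, I.indicator (1 : ℝ → ℝ≥0∞) p.2 *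
      (creepSet A p.2).indicator 1 (p, (0 : ℝ × ℝ)) = (A ×ˢ I).indicator 1 p := fun p => by
    by_cases h1 : p.1 ∈ A <;> by_cases h2 : p.2 ∈ I <;> simp [indicator, creepSet, h1, h2]
  simp only [e1, e2, lintegral_zero, zero_add] at e
  rw [lintegral_const_mul _ (measurable_one.indicator (hA.prod hI)),
    lintegral_indicator_one (hA.prod hI)] at e
  rw [← e]
  refine setLIntegral_congr_fun measurableSet_Ioi fun v hv => ?_
  simp only [creepMass]
  rw [← lintegral_const_mul'' _ (aemeasurable_passWeight_mul h (le_of_lt hv)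
    (measurable_one.indicator (measurableSet_creepSet hA v)))]
  refine lintegral_congr fun ω => ?_
  ring

/-- The passage over `v` either hits `v` or jumps across it. -/
lemma creepMass_add (h : IsBivariateSubordinator P Z Y)
    (hν : HasDriftAndLevyMeasure P Z Y q dZ dY ν) (hq : 0 ≤ q) {A : Set ℝ} (hA : MeasurableSet A)
    {v : ℝ} (hv : 0 ≤ v) :
    creepMass P Z Y q A v + ∫⁻ p, ν {r | p.1 ∈ A ∧ v ∈ Ico p.2 (p.2 + r.2)}
      ∂renewalMeasure P Z Y q =
    ∫⁻ ω, passWeight q (path Z Y ω) v * A.indicator 1 (prePassage (path Z Y ω) v).1 ∂P := by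
  have h3 : Measurable fun x : (ℝ × ℝ) × (ℝ × ℝ) => x.1.2 + x.2.2 := by fun_prop
  have hI : MeasurableSet {x : (ℝ × ℝ) × (ℝ × ℝ) | x.1.1 ∈ A ∧ v ∈ Ico x.1.2 (x.1.2 + x.2.2)} :=
    (measurable_fst.fst hA).inter ((measurableSet_le measurable_fst.snd measurable_const).inter
      (measurableSet_lt measurable_const h3))
  have e := lintegral_passJump_eq h hν hq hv (measurable_one.indicator hI)
    (fun p r hpr => (mem_of_indicator_ne_zero hpr).2)
  have e4 : ∀ p, ∫⁻ r, {x : (ℝ × ℝ) × (ℝ × ℝ) | x.1.1 ∈ A ∧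
      v ∈ Ico x.1.2 (x.1.2 + x.2.2)}.indicator (1 : (ℝ × ℝ) × (ℝ × ℝ) → ℝ≥0∞) (p, r) ∂ν =
      ν {r | p.1 ∈ A ∧ v ∈ Ico p.2 (p.2 + r.2)} := fun p =>
    lintegral_indicator_one (measurable_prodMk_left (x := p) hI)
  simp_rw [e4] at e
  rw [← e, creepMass, ← lintegral_add_left' (aemeasurable_passWeight_mul h hv
    (measurable_one.indicator (measurableSet_creepSet hA v)))]
  refine lintegral_congr_ae ?_
  filter_upwards [ae_isRegularPath h] with ω hω
  by_cases hp : Passes (path Z Y ω) v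
  · rw [← mul_add]
    congr 1
    have h1 := hω.prePassage_snd_le hv hp
    by_cases hb : (prePassage (path Z Y ω) v).1 ∈ A
    · rcases le_or_gt ((prePassage (path Z Y ω) v).2 + (passJump (path Z Y ω) v).2) v with h4 | h4
      · simp [indicator, creepSet, hb, h4, h4.not_gt]
      · simp [indicator, creepSet, hb, h1, h4, h4.not_ge]
    · simp [indicator, creepSet, hb]
  · simp [passWeight, hp]

/-- The renewal function is finite. -/
lemma renewalMeasure_prod_Iic_lt_top (h : IsBivariateSubordinator P Z Y)
    (hκ : 0 < q + laplaceExponent P Z Y 0 1) (A : Set ℝ) (v : ℝ) :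
    renewalMeasure P Z Y q (A ×ˢ Iic v) < ∞ := by
  have e := lintegral_exp_renewalMeasure h le_rfl zero_le_one hκ
  have hM := meas_ge_le_lintegral_div (μ := renewalMeasure P Z Y q)
    (measurable_exp_lin 0 1).aemeasurable
    (ε := ENNReal.ofReal (Real.exp (-v))) (ENNReal.ofReal_pos.2 (Real.exp_pos _)).ne'
    ENNReal.ofReal_ne_top
  refine (measure_mono fun p hp => ?_).trans_lt (hM.trans_lt ?_)
  · have : p.2 ≤ v := hp.2
    refine ENNReal.ofReal_le_ofReal (Real.exp_le_exp.2 ?_)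
    linarith
  · rw [e]
    exact ENNReal.div_lt_top ENNReal.ofReal_ne_top (ENNReal.ofReal_pos.2 (Real.exp_pos _)).ne'

end Subordinator

end Creep

/-! ### Left continuity in the level -/

section LeftContinuity

variable {w : ℝ≥0 → ℝ × ℝ} {u t q : ℝ}

/-- Along a strictly increasing path the passage time is left-continuous in the level. -/
lemma eventually_lt_passTime (hw : IsRegularPath w) (hs : StrictMono fun s => (w s).2)
    (hp : Passes w u) {s : ℝ≥0} (hst : s < passTime w u) :
    ∀ᶠ v in 𝓝[≤] u, s < passTime w v := by
  obtain ⟨r, hr1, hr2⟩ := exists_between hst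
  obtain ⟨r', hr1', hr2'⟩ := exists_between hr2
  have hlt : (w r).2 < u := (hs hr1').trans_le (hw.le_of_lt_passTime hp hr2')
  filter_upwards [self_mem_nhdsWithin, mem_nhdsWithin_of_mem_nhds (Ioi_mem_nhds hlt)] with v h1 h2
  exact hr1.trans_le (hw.le_passTime (hp.mono h1) (le_of_lt h2))

lemma passTime_mono {v : ℝ} (hp : Passes w u) (hvu : v ≤ u) :
    passTime w v ≤ passTime w u := by
  have h1 := firstPassage_mono (y := fun s => (w s).2) hvu
  rw [← hp.coe_passTime, ← (hp.mono hvu).coe_passTime] at h1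
  exact_mod_cast h1

lemma tendsto_passTime (hw : IsRegularPath w) (hs : StrictMono fun s => (w s).2)
    (hp : Passes w u) : Tendsto (passTime w) (𝓝[≤] u) (𝓝 (passTime w u)) := by
  refine tendsto_order.2 ⟨fun s hst => eventually_lt_passTime hw hs hp hst, fun s hst => ?_⟩
  filter_upwards [self_mem_nhdsWithin] with v hv
  exact (passTime_mono hp hv).trans_lt hst

/-- Along a strictly increasing path, weight and first coordinate before the passage depend
left-continuously on the level. -/
lemma tendsto_passWeight_mul_indicator (hw : IsRegularPath w) (hs : StrictMono fun s => (w s).2)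
    (hp : Passes w u) (hu : 0 < u) :
    Tendsto (fun v => passWeight q w v * (Iic t).indicator 1 (prePassage w v).1) (𝓝[≤] u)
      (𝓝 (passWeight q w u * (Iic t).indicator 1 (prePassage w u).1)) := by
  have h1 : Tendsto (fun v => passWeight q w v) (𝓝[≤] u) (𝓝 (passWeight q w u)) := by
    have h2 : Tendsto (fun v => ENNReal.ofReal (Real.exp (-(q * passTime w v)))) (𝓝[≤] u)
        (𝓝 (passWeight q w u)) := by
      rw [passWeight, if_pos hp]
      refine ((ENNReal.continuous_ofReal.comp
        (f := fun s : ℝ≥0 => Real.exp (-(q * s))) (by fun_prop)).tendsto _).comp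
        (tendsto_passTime hw hs hp)
    refine h2.congr' ?_
    filter_upwards [self_mem_nhdsWithin] with v hv
    rw [passWeight, if_pos (hp.mono hv)]
  have hpos := hw.passTime_pos hu hp
  have hlim : ∀ᶠ v in 𝓝[≤] u, (Iic t).indicator (1 : ℝ → ℝ≥0∞) (prePassage w v).1 =
      (Iic t).indicator 1 (prePassage w u).1 := by
    rcases le_or_gt (prePassage w u).1 t with hle | hlt
    · filter_upwards [self_mem_nhdsWithin] with v hv
      have h3 : (prePassage w v).1 ≤ (prePassage w u).1 :=
        hw.mono_fst.leftLim (passTime_mono hp hv)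
      simp [indicator, h3.trans hle, hle]
    · have hf : Fact (0 < passTime w u) := ⟨hpos⟩
      have h4 : ∀ᶠ s in 𝓝[<] passTime w u, t < (w s).1 :=
        (hw.mono_fst.tendsto_leftLim (passTime w u)).eventually_const_lt hlt
      obtain ⟨s, hs1, hs2⟩ := (h4.and self_mem_nhdsWithin).exists
      filter_upwards [eventually_lt_passTime hw hs hp hs2] with v hv
      have h5 : t < (prePassage w v).1 := hs1.trans_le (hw.mono_fst.le_leftLim hv)
      simp [indicator, not_le.2 h5, not_le.2 hlt]
  refine (ENNReal.Tendsto.mul_const h1 (Or.inr ?_)).congr' ?_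
  · exact ne_top_of_le_ne_top ENNReal.one_ne_top (indicator_le_self' (fun _ _ => zero_le) _)
  · filter_upwards [hlim] with v hv
    rw [hv]

end LeftContinuity

/-! ### The left derivative of the renewal function -/

section Derivative

variable {Ω : Type*} [MeasurableSpace Ω] {P : Measure Ω} [IsProbabilityMeasure P]
  {Z Y : ℝ≥0 → Ω → ℝ} {q dZ dY : ℝ} {ν : Measure (ℝ × ℝ)}

namespace Subordinator

/-- The creep mass is a measure in the set `A`. -/
lemma exists_measure_eq_creepMass (h : IsBivariateSubordinator P Z Y) (hq : 0 ≤ q) {u : ℝ}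
    (hu : 0 ≤ u) : ∃ μ : Measure ℝ, IsFiniteMeasure μ ∧
      ∀ A, MeasurableSet A → μ A = creepMass P Z Y q A u := by
  obtain ⟨W, D, hW, hD, hWD⟩ := exists_measurable_passWeight h q
  have hWu : Measurable fun ω => W (u, ω) := hW.comp measurable_prodMk_left
  have hDu : Measurable fun ω => D (u, ω) := hD.comp measurable_prodMk_left
  have hS := measurableSet_creepSet MeasurableSet.univ u
  let ρ : Measure Ω := P.withDensity fun ω => W (u, ω) * (creepSet univ u).indicator 1 (D (u, ω))
  have key : ∀ A, MeasurableSet A → ρ.map (fun ω => (D (u, ω)).1.1) A = creepMass P Z Y q A u := by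
    intro A hA
    rw [Measure.map_apply hDu.fst.fst hA, withDensity_apply _ (hDu.fst.fst hA),
      ← lintegral_indicator (hDu.fst.fst hA)]
    refine lintegral_congr_ae ?_
    filter_upwards [ae_isRegularPath h] with ω hω
    obtain ⟨e1, e2⟩ := hWD ω hω u hu
    by_cases hc : (prePassage (path Z Y ω) u).1 ∈ A <;> simp [indicator, creepSet, e1, e2, hc]
  refine ⟨ρ.map fun ω => (D (u, ω)).1.1, ⟨?_⟩, key⟩
  rw [key _ MeasurableSet.univ]
  exact (creepMass_le_one hq _ _).trans_lt ENNReal.one_lt_top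

/-- For a strictly increasing `Y`, the passage is left-continuous in the level. -/
lemma tendsto_lintegral_passWeight (h : IsBivariateSubordinator P Z Y) (hq : 0 ≤ q)
    (hY : P {ω | Y 1 ω = 0} = 0) {u : ℝ} (hu : 0 < u) (t : ℝ) :
    Tendsto (fun v => ∫⁻ ω, passWeight q (path Z Y ω) v *
      (Iic t).indicator 1 (prePassage (path Z Y ω) v).1 ∂P) (𝓝[≤] u)
      (𝓝 (∫⁻ ω, passWeight q (path Z Y ω) u *
        (Iic t).indicator 1 (prePassage (path Z Y ω) u).1 ∂P)) := by
  obtain ⟨W, D, hW, hD, hWD⟩ := exists_measurable_passWeight h q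
  have hnn : ∀ᶠ v in 𝓝[≤] u, 0 ≤ v := mem_nhdsWithin_of_mem_nhds (Ici_mem_nhds hu)
  have hcongr : ∀ v, 0 ≤ v → ∀ᵐ ω ∂P, W (v, ω) * (Iic t).indicator 1 (D (v, ω)).1.1 =
      passWeight q (path Z Y ω) v * (Iic t).indicator 1 (prePassage (path Z Y ω) v).1 := by
    intro v hv
    filter_upwards [ae_isRegularPath h] with ω hω
    obtain ⟨e1, e2⟩ := hWD ω hω v hv
    rw [e1, e2]
  have hlim : Tendsto (fun v => ∫⁻ ω, W (v, ω) * (Iic t).indicator 1 (D (v, ω)).1.1 ∂P) (𝓝[≤] u)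
      (𝓝 (∫⁻ ω, passWeight q (path Z Y ω) u *
        (Iic t).indicator 1 (prePassage (path Z Y ω) u).1 ∂P)) := by
    refine tendsto_lintegral_filter_of_dominated_convergence (fun _ => 1)
      (Eventually.of_forall fun v => ?_) ?_ (by simp) ?_
    · exact (hW.comp measurable_prodMk_left).mul ((measurable_one.indicator measurableSet_Iic).comp
        (hD.comp measurable_prodMk_left).fst.fst)
    · filter_upwards [hnn] with v hv
      filter_upwards [hcongr v hv] with ω hω
      rw [hω]
      exact mul_le_one' (passWeight_le_one hq _ _) (indicator_le_self' (fun _ _ => zero_le) _)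
    · filter_upwards [ae_isRegularPath h, ae_strictMono h hY,
        ae_passes h (laplaceExponent_pos h hY)]
        with ω hω hs hp
      refine (tendsto_passWeight_mul_indicator hω hs (hp u) hu).congr' ?_
      filter_upwards [hnn] with v hv
      obtain ⟨e1, e2⟩ := hWD ω hω v hv
      rw [e1, e2]
  refine hlim.congr' ?_
  filter_upwards [hnn] with v hv using lintegral_congr_ae (hcongr v hv)

/-- With a positive drift the renewal measure has bounded density in the second coordinate. -/
lemma renewalMeasure_prod_Ioc_le (h : IsBivariateSubordinator P Z Y)
    (hν : HasDriftAndLevyMeasure P Z Y q dZ dY ν) (hq : 0 ≤ q) (hd : 0 < dY) {A : Set ℝ}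
    (hA : MeasurableSet A) (a b : ℝ) :
    renewalMeasure P Z Y q (A ×ˢ Ioc a b) ≤ ENNReal.ofReal ((b - a) / dY) := by
  have hY := measure_eq_zero_of_drift_pos h hν hd
  have e := lintegral_creepMass h hν hq (laplaceExponent_pos h hY) hA (measurableSet_Ioc (a := a)
    (b := b))
  have hle : ENNReal.ofReal dY * renewalMeasure P Z Y q (A ×ˢ Ioc a b) ≤
      ENNReal.ofReal (b - a) := by
    rw [← e]
    calc _ ≤ ∫⁻ v in Ioi (0 : ℝ), (Ioc a b).indicator 1 v := by
          refine lintegral_mono fun v => ?_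
          exact mul_le_of_le_one_right' (creepMass_le_one hq _ _)
      _ ≤ ∫⁻ v, (Ioc a b).indicator 1 v := lintegral_mono' Measure.restrict_le_self le_rfl
      _ = ENNReal.ofReal (b - a) := by
        rw [lintegral_indicator_one measurableSet_Ioc, Real.volume_Ioc]
  rw [ENNReal.ofReal_div_of_pos hd]
  rwa [ENNReal.le_div_iff_mul_le (Or.inl (ENNReal.ofReal_pos.2 hd).ne')
    (Or.inl ENNReal.ofReal_ne_top), mul_comm]

/-- The mass of the passages by a jump across the level is continuous in the level. -/
lemma tendsto_jumpMass (h : IsBivariateSubordinator P Z Y)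
    (hν : HasDriftAndLevyMeasure P Z Y q dZ dY ν) (hq : 0 ≤ q) (hd : 0 < dY) {A : Set ℝ}
    (hA : MeasurableSet A) (u : ℝ) :
    Tendsto (fun v => ∫⁻ p, ν {r | p.1 ∈ A ∧ v ∈ Ico p.2 (p.2 + r.2)} ∂renewalMeasure P Z Y q)
      (𝓝[≤] u) (𝓝 (∫⁻ p, ν {r | p.1 ∈ A ∧ u ∈ Ico p.2 (p.2 + r.2)} ∂renewalMeasure P Z Y q)) := by
  have hY := measure_eq_zero_of_drift_pos h hν hd
  have hκ : 0 < q + laplaceExponent P Z Y 0 1 := by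
    have := laplaceExponent_pos h hY
    linarith
  have i1 := sFinite_renewalMeasure h hκ
  have i2 := HasDriftAndLevyMeasure.sFinite hν
  set V := renewalMeasure P Z Y q with hV
  have h3 : Measurable fun x : (ℝ × ℝ) × (ℝ × ℝ) => x.1.2 + x.2.2 := by fun_prop
  have hI : ∀ v : ℝ, MeasurableSet {x : (ℝ × ℝ) × (ℝ × ℝ) | x.1.1 ∈ A ∧
      v ∈ Ico x.1.2 (x.1.2 + x.2.2)} := fun v =>
    (measurable_fst.fst hA).inter ((measurableSet_le measurable_fst.snd measurable_const).inter
      (measurableSet_lt measurable_const h3))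
  have hsec : ∀ (v : ℝ) (r : ℝ × ℝ), ((fun p => (p, r)) ⁻¹' {x : (ℝ × ℝ) × (ℝ × ℝ) | x.1.1 ∈ A ∧
      v ∈ Ico x.1.2 (x.1.2 + x.2.2)}) = A ×ˢ Ioc (v - r.2) v := by
    intro v r
    ext p
    simp only [mem_preimage, mem_ofPred_eq, mem_Ico, mem_prod, mem_Ioc, sub_lt_iff_lt_add]
    tauto
  -- Integrating first over the position before the jump.
  have hsymm : ∀ v, ∫⁻ p, ν {r | p.1 ∈ A ∧ v ∈ Ico p.2 (p.2 + r.2)} ∂V =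
      ∫⁻ r, V (A ×ˢ Ioc (v - r.2) v) ∂ν := by
    intro v
    have e := Measure.prod_apply (μ := V) (ν := ν) (hI v)
    have e' := Measure.prod_apply_symm (μ := V) (ν := ν) (hI v)
    simp_rw [hsec] at e'
    exact e.symm.trans e'
  simp_rw [hsymm]
  have hfin : ∀ x, V (A ×ˢ Iic x) ≠ ∞ := fun x => (renewalMeasure_prod_Iic_lt_top h hκ A x).ne
  let G : ℝ → ℝ := fun x => (V (A ×ˢ Iic x)).toReal
  have hG : ∀ a b, a ≤ b → V (A ×ˢ Ioc a b) = ENNReal.ofReal (G b - G a) := by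
    intro a b hab
    have hs : A ×ˢ Iic b = A ×ˢ Iic a ∪ A ×ˢ Ioc a b := by
      rw [← prod_union, Iic_union_Ioc_eq_Iic hab]
    have hdis : Disjoint (A ×ˢ Iic a) (A ×ˢ Ioc a b) :=
      Disjoint.set_prod_right (Iic_disjoint_Ioc le_rfl) _ _
    have e : V (A ×ˢ Iic b) = V (A ×ˢ Iic a) + V (A ×ˢ Ioc a b) := by
      rw [hs, measure_union hdis (hA.prod measurableSet_Ioc)]
    have hne : V (A ×ˢ Ioc a b) ≠ ∞ :=
      ne_top_of_le_ne_top (hfin b) (e ▸ le_add_self)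
    simp only [G]
    rw [e, ENNReal.toReal_add (hfin a) hne, add_sub_cancel_left, ENNReal.ofReal_toReal hne]
  have hGlip : ∀ a b, a ≤ b → |G b - G a| ≤ (b - a) / dY := by
    intro a b hab
    have h1 := renewalMeasure_prod_Ioc_le h hν hq hd hA a b
    rw [← hV, hG a b hab, ENNReal.ofReal_le_ofReal_iff (div_nonneg (sub_nonneg.2 hab) hd.le)] at h1
    have h2 : G a ≤ G b := ENNReal.toReal_mono (hfin b) (measure_mono (prod_mono_right
      (Iic_subset_Iic.2 hab)))
    rwa [abs_of_nonneg (sub_nonneg.2 h2)]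
  have hGc : Continuous G := by
    refine (LipschitzWith.of_dist_le_mul (K := ⟨1 / dY, by positivity⟩) fun x y => ?_).continuous
    rw [Real.dist_eq, Real.dist_eq]
    change |G x - G y| ≤ 1 / dY * |x - y|
    rcases le_total x y with hxy | hxy
    · have := hGlip x y hxy
      rw [abs_sub_comm (G x), abs_sub_comm x, abs_of_nonneg (sub_nonneg.2 hxy)]
      linarith [this, div_eq_mul_one_div (y - x) dY, mul_comm (y - x) (1 / dY)]
    · have := hGlip y x hxy
      rw [abs_of_nonneg (sub_nonneg.2 hxy)]
      linarith [this, div_eq_mul_one_div (x - y) dY, mul_comm (x - y) (1 / dY)]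
  -- The dominating function combines the density bound for small jumps with the finite mass below
  -- the level for large ones.
  let C : ℝ≥0∞ := max (ENNReal.ofReal (1 / dY)) (V (A ×ˢ Iic u))
  have hC : C ≠ ∞ := (max_lt ENNReal.ofReal_lt_top (hfin u).lt_top).ne
  refine tendsto_lintegral_filter_of_dominated_convergence
    (fun r => C * ENNReal.ofReal (min 1 (r.1 + r.2))) (Eventually.of_forall fun v => ?_) ?_ ?_ ?_
  · have := measurable_measure_prodMk_right (μ := V) (hI v)
    simp_rw [hsec] at this
    exact this
  · filter_upwards [self_mem_nhdsWithin] with v hv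
    filter_upwards [HasDriftAndLevyMeasure.ae_support hν] with r hr
    rcases le_total 1 (r.1 + r.2) with h1 | h1
    · rw [min_eq_left h1, ENNReal.ofReal_one, mul_one]
      refine le_trans ?_ (le_max_right _ _)
      exact measure_mono (prod_mono_right fun x hx => hx.2.trans hv)
    · rw [min_eq_right h1]
      have h2 := renewalMeasure_prod_Ioc_le h hν hq hd hA (v - r.2) v
      rw [sub_sub_cancel] at h2
      refine h2.trans ?_
      calc ENNReal.ofReal (r.2 / dY) ≤ ENNReal.ofReal (1 / dY * (r.1 + r.2)) := by
            refine ENNReal.ofReal_le_ofReal ?_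
            rw [div_eq_mul_one_div, mul_comm]
            have := hr.1
            gcongr
            linarith
        _ = ENNReal.ofReal (1 / dY) * ENNReal.ofReal (r.1 + r.2) :=
            ENNReal.ofReal_mul (by positivity)
        _ ≤ _ := by gcongr; exact le_max_left _ _
  · rw [lintegral_const_mul _ (by fun_prop)]
    exact ENNReal.mul_ne_top hC hν.integrable.ne
  · filter_upwards [HasDriftAndLevyMeasure.ae_support hν] with r hr
    have e : ∀ v, V (A ×ˢ Ioc (v - r.2) v) = ENNReal.ofReal (G v - G (v - r.2)) := fun v =>
      hG _ _ (by linarith [hr.2.1])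
    simp_rw [e]
    refine ((ENNReal.continuous_ofReal.comp (?_ : Continuous fun v => G v - G (v - r.2))).tendsto
      u).mono_left nhdsWithin_le_nhds
    exact hGc.sub (hGc.comp (continuous_id.sub continuous_const))

/-- The creep mass is left-continuous in the level. -/
lemma tendsto_creepMass (h : IsBivariateSubordinator P Z Y)
    (hν : HasDriftAndLevyMeasure P Z Y q dZ dY ν) (hq : 0 ≤ q) (hd : 0 < dY) {u : ℝ}
    (hu : 0 < u) (t : ℝ) :
    Tendsto (creepMass P Z Y q (Iic t)) (𝓝[≤] u) (𝓝 (creepMass P Z Y q (Iic t) u)) := by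
  have hY := measure_eq_zero_of_drift_pos h hν hd
  have hle : ∀ v, ∫⁻ ω, passWeight q (path Z Y ω) v *
      (Iic t).indicator 1 (prePassage (path Z Y ω) v).1 ∂P ≤ 1 := fun v => by
    calc _ ≤ ∫⁻ _, 1 ∂P := by
          refine lintegral_mono fun ω => ?_
          exact mul_le_one' (passWeight_le_one hq _ _) (indicator_le_self' (fun _ _ => zero_le) _)
      _ = 1 := by simp
  have hsub : ∀ v, 0 ≤ v → creepMass P Z Y q (Iic t) v =
      (∫⁻ ω, passWeight q (path Z Y ω) v * (Iic t).indicator 1 (prePassage (path Z Y ω) v).1 ∂P) -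
        ∫⁻ p, ν {r | p.1 ∈ Iic t ∧ v ∈ Ico p.2 (p.2 + r.2)} ∂renewalMeasure P Z Y q := by
    intro v hv
    have e := creepMass_add h hν hq (measurableSet_Iic (a := t)) hv
    refine ENNReal.eq_sub_of_add_eq ?_ e
    exact ne_top_of_le_ne_top ENNReal.one_ne_top ((le_add_self.trans e.le).trans (hle v))
  rw [hsub u hu.le]
  refine (ENNReal.Tendsto.sub (tendsto_lintegral_passWeight h hq hY hu t)
    (tendsto_jumpMass h hν hq hd measurableSet_Iic u) (Or.inl ?_)).congr' ?_
  · exact ne_top_of_le_ne_top ENNReal.one_ne_top (hle u)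
  · filter_upwards [mem_nhdsWithin_of_mem_nhds (Ici_mem_nhds hu)] with v hv
    exact (hsub v hv).symm

/-- The left derivative of the renewal function is the creep mass divided by the drift. -/
theorem hasDerivWithinAt_renewal (h : IsBivariateSubordinator P Z Y)
    (hν : HasDriftAndLevyMeasure P Z Y q dZ dY ν) (hq : 0 ≤ q) (hd : 0 < dY) {u : ℝ}
    (hu : 0 < u) (t : ℝ) :
    HasDerivWithinAt (fun v => (renewalMeasure P Z Y q (Iic t ×ˢ Iic v)).toReal)
      (dY⁻¹ * (creepMass P Z Y q (Iic t) u).toReal) (Iic u) u := by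
  have hY := measure_eq_zero_of_drift_pos h hν hd
  -- By `lintegral_creepMass` the renewal function is the integral over the level of the creep mass
  -- divided by the drift; its integrand is left-continuous.
  set c : ℝ → ℝ := fun v => (creepMass P Z Y q (Iic t) v).toReal with hc
  have hctop : ∀ v, creepMass P Z Y q (Iic t) v < ∞ := fun v =>
    (creepMass_le_one hq _ _).trans_lt ENNReal.one_lt_top
  have hcm := aemeasurable_creepMass (q := q) h (measurableSet_Iic (a := t))
  have hcsm : ∀ v, AEStronglyMeasurable c (volume.restrict (Ioc 0 v)) := fun v =>
    (hcm.ennreal_toReal.mono_measure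
      (Measure.restrict_mono Ioc_subset_Ioi_self le_rfl)).aestronglyMeasurable
  have hint : IntervalIntegrable c volume 0 u := by
    rw [intervalIntegrable_iff_integrableOn_Ioc_of_le hu.le]
    refine Integrable.mono' (integrable_const (1 : ℝ)) (hcsm u)
      (Eventually.of_forall fun v => ?_)
    rw [Real.norm_of_nonneg ENNReal.toReal_nonneg]
    exact ENNReal.toReal_mono ENNReal.one_ne_top (creepMass_le_one hq _ _)
  have hcont : ContinuousWithinAt c (Iic u) u :=
    (ENNReal.tendsto_toReal (hctop u).ne).comp (tendsto_creepMass h hν hq hd hu t)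
  have hmeas : StronglyMeasurableAtFilter c (𝓝[≤] u) volume :=
    ⟨Ioc 0 u, Ioc_mem_nhdsLE hu, hcsm u⟩
  have hder := (intervalIntegral.integral_hasDerivWithinAt_right (s := Iic u) hint hmeas
    hcont).const_mul dY⁻¹
  have heq : ∀ v, 0 ≤ v → (renewalMeasure P Z Y q (Iic t ×ˢ Iic v)).toReal =
      dY⁻¹ * ∫ x in (0)..v, c x := by
    intro v hv
    have e := lintegral_creepMass h hν hq (laplaceExponent_pos h hY) (measurableSet_Iic (a := t))
      (measurableSet_Iic (a := v))
    have e1 : ∫⁻ x in Ioi (0 : ℝ), (Iic v).indicator 1 x * creepMass P Z Y q (Iic t) x =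
        ∫⁻ x in Ioc 0 v, creepMass P Z Y q (Iic t) x := by
      rw [← Ioi_inter_Iic, inter_comm, ← Measure.restrict_restrict measurableSet_Iic,
        ← lintegral_indicator measurableSet_Iic]
      refine lintegral_congr fun x => ?_
      by_cases hx : x ∈ Iic v
      · rw [indicator_of_mem hx, indicator_of_mem hx, Pi.one_apply, one_mul]
      · rw [indicator_of_notMem hx, indicator_of_notMem hx, zero_mul]
    rw [intervalIntegral.integral_of_le hv, hc, integral_toReal
      (hcm.mono_measure (Measure.restrict_mono Ioc_subset_Ioi_self le_rfl))
      (Eventually.of_forall hctop), ← e1, e, ENNReal.toReal_mul, ENNReal.toReal_ofReal hd.le,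
      inv_mul_cancel_left₀ hd.ne']
  refine hder.congr_of_eventuallyEq ?_ (heq u hu.le)
  filter_upwards [mem_nhdsWithin_of_mem_nhds (Ici_mem_nhds hu)] with v hv using heq v hv

end Subordinator

end Derivative

/-! ### Without drift, fixed levels are not hit -/

/-- The closure of the range of the second coordinate, observed at rational times. -/
def hitSet (x : ℚ≥0 → ℝ × ℝ) : Set ℝ := closure (range fun s => (x s).2)

lemma measurableSet_hitSet : MeasurableSet {y : ℝ × (ℚ≥0 → ℝ × ℝ) | y.1 ∈ hitSet y.2} := by
  have e : {y : ℝ × (ℚ≥0 → ℝ × ℝ) | y.1 ∈ hitSet y.2} =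
      ⋂ m : ℕ, ⋃ s : ℚ≥0, {y | dist y.1 (y.2 s).2 < 1 / ((m : ℝ) + 1)} := by
    ext y
    simp only [hitSet, mem_ofPred_eq, Metric.mem_closure_range_iff, mem_iInter, mem_iUnion]
    constructor
    · exact fun hy m => hy _ (by positivity)
    · intro hy ε hε
      obtain ⟨m, hm⟩ := exists_nat_one_div_lt hε
      obtain ⟨s, hs⟩ := hy m
      exact ⟨s, hs.trans hm⟩
  rw [e]
  refine MeasurableSet.iInter fun m => MeasurableSet.iUnion fun s => ?_
  exact measurableSet_lt (measurable_fst.dist (measurable_snd.eval.snd)) measurable_const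

section HitPath

variable {w : ℝ≥0 → ℝ × ℝ} {v : ℝ}

/-- The values at all times lie in the closure of the values at rational times. -/
lemma mem_hitSet_shiftPath (hw : IsRegularPath w) (t s : ℝ≥0) :
    (w (t + s)).2 - (w t).2 ∈ hitSet (shiftPath w t) := by
  obtain ⟨x, hx1, hx2⟩ : ∃ x : ℕ → ℚ≥0, (∀ n, s < x n) ∧
      Tendsto (fun n => (x n : ℝ≥0)) atTop (𝓝 s) := by
    have hex : ∀ n : ℕ, ∃ x : ℚ≥0, s < x ∧ (x : ℝ≥0) < s + mesh n := by
      intro n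
      have hlt : (s : ℝ) < (s + mesh n : ℝ≥0) := by
        exact_mod_cast lt_add_of_pos_right s (mesh_pos n)
      obtain ⟨x, hx1, hx2⟩ := exists_rat_btwn hlt
      have hx0 : 0 ≤ x := by exact_mod_cast s.2.trans hx1.le
      lift x to ℚ≥0 using hx0
      refine ⟨x, ?_, ?_⟩
      · rw [← NNReal.coe_lt_coe]; exact_mod_cast hx1
      · rw [← NNReal.coe_lt_coe]; exact_mod_cast hx2
    choose x hx1 hx2 using hex
    refine ⟨x, hx1, ?_⟩
    have h0 : Tendsto (fun n => s + mesh n) atTop (𝓝 s) := by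
      simpa using tendsto_const_nhds.add tendsto_mesh
    exact tendsto_of_tendsto_of_tendsto_of_le_of_le tendsto_const_nhds h0
      (fun n => (hx1 n).le) fun n => (hx2 n).le
  have hlim : Tendsto (fun n => (w (t + x n)).2 - (w t).2) atTop
      (𝓝 ((w (t + s)).2 - (w t).2)) := by
    refine Tendsto.sub_const ?_ _
    refine ((hw.rightCont (t + s)).tendsto.comp (tendsto_nhdsWithin_iff.2
      ⟨hx2.const_add t, Eventually.of_forall fun n => ?_⟩)).snd_nhds
    simp only [mem_Ici]
    have := (hx1 n).le
    gcongr
  refine mem_closure_of_tendsto hlim (Eventually.of_forall fun n => ⟨x n, rfl⟩)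

lemma shiftPath_zero (hw : IsRegularPath w) : shiftPath w 0 = fun s : ℚ≥0 => w s := by
  funext s
  simp [shiftPath, hw.zero]

lemma mem_hitSet (hw : IsRegularPath w) (s : ℝ≥0) : (w s).2 ∈ hitSet fun s : ℚ≥0 => w s := by
  have := mem_hitSet_shiftPath hw 0 s
  rwa [shiftPath_zero hw, hw.zero, zero_add, Prod.snd_zero, sub_zero] at this

/-- Strictly above the current value, the range of the path is that of its future. -/
lemma mem_hitSet_shiftPath_iff (hw : IsRegularPath w) (t : ℝ≥0) {b : ℝ} (hb : 0 < b) :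
    b ∈ hitSet (shiftPath w t) ↔ (w t).2 + b ∈ hitSet fun s : ℚ≥0 => w s := by
  constructor
  · intro h
    have hmap : MapsTo (fun y => (w t).2 + y) (range fun s => (shiftPath w t s).2)
        (hitSet fun s : ℚ≥0 => w s) := by
      rintro _ ⟨s, rfl⟩
      have : (w t).2 + (shiftPath w t s).2 = (w (t + s)).2 := by simp [shiftPath]
      simp only [this]
      exact mem_hitSet hw _
    have := hmap.closure (by fun_prop) h
    rwa [hitSet, closure_closure] at this
  · intro h
    refine Metric.mem_closure_iff.2 fun ε hε => ?_
    obtain ⟨_, ⟨s, rfl⟩, hs⟩ := Metric.mem_closure_iff.1 h (min b (ε / 2))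
      (lt_min hb (half_pos hε))
    rw [Real.dist_eq, abs_lt] at hs
    have hts : t ≤ s := by
      by_contra! hc
      have := hw.mono_snd hc.le
      have := hs.2.trans_le (min_le_left _ _)
      simp only at this
      linarith
    obtain ⟨r, hr⟩ := exists_add_of_le hts
    obtain ⟨z, hz1, hz2⟩ := Metric.mem_closure_iff.1 (mem_hitSet_shiftPath hw t r) (ε / 2)
      (half_pos hε)
    refine ⟨z, hz1, ?_⟩
    rw [← hr] at hz2
    calc dist b z ≤ dist b ((w s).2 - (w t).2) + dist ((w s).2 - (w t).2) z := dist_triangle _ _ _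
      _ < ε / 2 + ε / 2 := by
          refine add_lt_add ?_ hz2
          have h1 := min_le_right b (ε / 2)
          rw [Real.dist_eq, abs_lt]
          constructor <;> linarith [hs.1, hs.2]
      _ = ε := add_halves ε

/-- A level strictly inside a jump gap is away from the range. -/
lemma notMem_hitSet (h1 : Monotone fun s => (w s).2) (hp : (prePassage w v).2 < v)
    (hv : v < (w (passTime w v)).2) : v ∉ hitSet fun s : ℚ≥0 => w s := by
  intro hc
  obtain ⟨_, hz, s, rfl⟩ := mem_closure_iff.1 hc (Ioo (prePassage w v).2 (w (passTime w v)).2)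
    isOpen_Ioo ⟨hp, hv⟩
  rcases lt_or_ge (s : ℝ≥0) (passTime w v) with h | h
  · exact absurd hz.1 (not_lt.2 (h1.le_leftLim h))
  · exact absurd hz.2 (not_lt.2 (h1 h))

end HitPath

section Polarity

variable {Ω : Type*} [MeasurableSpace Ω] {P : Measure Ω}
  {Z Y : ℝ≥0 → Ω → ℝ} {q dZ dY : ℝ} {ν : Measure (ℝ × ℝ)}

/-- The probability that the level `v` lies in the closed range of `Y`. -/
noncomputable def hitProb (P : Measure Ω) (Z Y : ℝ≥0 → Ω → ℝ) (v : ℝ) : ℝ≥0∞ :=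
  P {ω | v ∈ hitSet fun s : ℚ≥0 => path Z Y ω s}

namespace Subordinator

lemma measurableSet_mem_hitSet (h : IsBivariateSubordinator P Z Y) (v : ℝ) :
    MeasurableSet {ω | v ∈ hitSet fun s : ℚ≥0 => path Z Y ω s} := by
  have : Measurable fun ω => (v, fun s : ℚ≥0 => path Z Y ω s) :=
    measurable_const.prodMk (measurable_pi_lambda _ fun s => measurable_pair h s)
  exact this measurableSet_hitSet

variable [IsProbabilityMeasure P]

/-- For a strictly increasing `Y`, a level is in the closed range if and only if it is attained
at its first passage. -/
lemma ae_mem_hitSet_iff (h : IsBivariateSubordinator P Z Y)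
    (hν : HasDriftAndLevyMeasure P Z Y q dZ dY ν) (hq : 0 ≤ q) (hY : P {ω | Y 1 ω = 0} = 0)
    {v : ℝ} (hv : 0 ≤ v) :
    ∀ᵐ ω ∂P, (v ∈ hitSet fun s : ℚ≥0 => path Z Y ω s) ↔
      (path Z Y ω (passTime (path Z Y ω) v)).2 = v := by
  filter_upwards [ae_isRegularPath h, ae_passes h (laplaceExponent_pos h hY),
    ae_gap_ne h hν hq hY hv] with ω hω hp hg
  constructor
  · intro hmem
    by_contra hne
    have h1 := hω.le_passValue (hp v)
    have h2 := hω.prePassage_snd_le hv (hp v)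
    have hlt : v < (path Z Y ω (passTime (path Z Y ω) v)).2 := lt_of_le_of_ne h1 (Ne.symm hne)
    have hj : 0 < (passJump (path Z Y ω) v).2 := by
      simp only [passJump, Prod.snd_sub]; linarith
    exact notMem_hitSet hω.mono_snd (lt_of_le_of_ne h2 (hg (hp v) hj).1) hlt hmem
  · intro he
    have := mem_hitSet hω (passTime (path Z Y ω) v)
    rwa [he] at this

/-- The regenerative property of the range. -/
lemma measure_hitSet_inter (h : IsBivariateSubordinator P Z Y)
    (hν : HasDriftAndLevyMeasure P Z Y q dZ dY ν) (hq : 0 ≤ q) (hY : P {ω | Y 1 ω = 0} = 0)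
    {a b : ℝ} (ha : 0 ≤ a) (hb : 0 < b) :
    P ({ω | a ∈ hitSet fun s : ℚ≥0 => path Z Y ω s} ∩
      {ω | a + b ∈ hitSet fun s : ℚ≥0 => path Z Y ω s}) = hitProb P Z Y a * hitProb P Z Y b := by
  have hpass := (ae_passes h (laplaceExponent_pos h hY)).mono fun ω hω => hω a
  have hS : MeasurableSet {y : (ℝ × ℝ) × (ℚ≥0 → ℝ × ℝ) | y.1.2 = a ∧ b ∈ hitSet y.2} := by
    have : Measurable fun y : (ℝ × ℝ) × (ℚ≥0 → ℝ × ℝ) => (b, y.2) :=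
      measurable_const.prodMk measurable_snd
    exact (measurable_fst.snd (measurableSet_singleton a)).inter (this measurableSet_hitSet)
  have e := measure_shiftPath h ha hpass hS
  have e1 : P ({ω | a ∈ hitSet fun s : ℚ≥0 => path Z Y ω s} ∩
      {ω | a + b ∈ hitSet fun s : ℚ≥0 => path Z Y ω s}) =
      P {ω | (path Z Y ω (passTime (path Z Y ω) a),
      shiftPath (path Z Y ω) (passTime (path Z Y ω) a)) ∈
        {y : (ℝ × ℝ) × (ℚ≥0 → ℝ × ℝ) | y.1.2 = a ∧ b ∈ hitSet y.2}} := by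
    refine measure_congr ?_
    filter_upwards [ae_mem_hitSet_iff h hν hq hY ha, ae_isRegularPath h] with ω h1 hω
    refine propext ?_
    change ((a ∈ hitSet fun s : ℚ≥0 => path Z Y ω s) ∧
      (a + b ∈ hitSet fun s : ℚ≥0 => path Z Y ω s)) ↔
      ((path Z Y ω (passTime (path Z Y ω) a)).2 = a ∧
        b ∈ hitSet (shiftPath (path Z Y ω) (passTime (path Z Y ω) a)))
    rw [mem_hitSet_shiftPath_iff hω _ hb, h1]
    refine and_congr_right fun h2 => ?_
    rw [h2]
  have hT : NullMeasurableSet {ω | a ∈ hitSet fun s : ℚ≥0 => path Z Y ω s} P :=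
    (measurableSet_mem_hitSet h a).nullMeasurableSet
  rw [e1, e]
  have e2 : ∀ᵐ ω ∂P, P {ω' | (path Z Y ω (passTime (path Z Y ω) a),
      fun s : ℚ≥0 => path Z Y ω' s) ∈
        {y : (ℝ × ℝ) × (ℚ≥0 → ℝ × ℝ) | y.1.2 = a ∧ b ∈ hitSet y.2}} =
      {ω | a ∈ hitSet fun s : ℚ≥0 => path Z Y ω s}.indicator (fun _ => hitProb P Z Y b) ω := by
    filter_upwards [ae_mem_hitSet_iff h hν hq hY ha] with ω h1
    by_cases hc : (path Z Y ω (passTime (path Z Y ω) a)).2 = a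
    · rw [indicator_of_mem (by exact h1.2 hc)]
      simp [hc, hitProb]
    · rw [indicator_of_notMem (by exact fun h' => hc (h1.1 h'))]
      simp [hc]
  rw [lintegral_congr_ae e2, lintegral_indicator (measurableSet_mem_hitSet h a), lintegral_const,
    Measure.restrict_apply_univ, mul_comm]
  rfl

/-- Just below a level `u` of the closed range there are points of the range, from which `u` is
reached with the probability of reaching the distance. -/
lemma hitProb_le_mul (h : IsBivariateSubordinator P Z Y)
    (hν : HasDriftAndLevyMeasure P Z Y q dZ dY ν) (hq : 0 ≤ q) (hY : P {ω | Y 1 ω = 0} = 0)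
    {u v : ℝ} (hv : 0 ≤ v) (hvu : v < u) {c : ℝ≥0∞}
    (hc : ∀ x, 0 < x → x ≤ u - v → hitProb P Z Y x ≤ c) :
    hitProb P Z Y u ≤
      c * P {ω | (path Z Y ω (passTime (path Z Y ω) v)).2 < u} := by
  have hall := ae_passes h (laplaceExponent_pos h hY)
  have hpass := hall.mono fun ω hω => hω v
  have hS : MeasurableSet {y : (ℝ × ℝ) × (ℚ≥0 → ℝ × ℝ) | y.1.2 < u ∧ u - y.1.2 ∈ hitSet y.2} := by
    have : Measurable fun y : (ℝ × ℝ) × (ℚ≥0 → ℝ × ℝ) => (u - y.1.2, y.2) := by fun_prop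
    exact (measurableSet_lt measurable_fst.snd measurable_const).inter (this measurableSet_hitSet)
  have e := measure_shiftPath h hv hpass hS
  calc hitProb P Z Y u ≤ P {ω | (path Z Y ω (passTime (path Z Y ω) v),
      shiftPath (path Z Y ω) (passTime (path Z Y ω) v)) ∈
        {y : (ℝ × ℝ) × (ℚ≥0 → ℝ × ℝ) | y.1.2 < u ∧ u - y.1.2 ∈ hitSet y.2}} := by
        refine measure_mono_ae ?_
        filter_upwards [ae_isRegularPath h, hall, ae_strictMono h hY,
          ae_mem_hitSet_iff h hν hq hY (hv.trans hvu.le), ae_gap_ne h hν hq hY (hv.trans hvu.le)]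
          with ω hω hp hs h1 h2 hmem
        have hu : (path Z Y ω (passTime (path Z Y ω) u)).2 = u := h1.1 hmem
        have hle := passTime_mono (hp u) hvu.le
        have hlt : (path Z Y ω (passTime (path Z Y ω) v)).2 < u := by
          rcases hle.lt_or_eq with hlt | heq
          · exact (hs hlt).trans_eq hu
          · -- Passing `v` and `u` at once means to land on `u` by a jump.
            exfalso
            have hpre := hω.prePassage_snd_le hv (hp v)
            have hpre' : (prePassage (path Z Y ω) u).2 ≤ v := by
              simpa only [prePassage, heq] using hpre
            have hadd := congrArg Prod.snd
              (IsRegularPath.prePassage_add_passJump (path Z Y ω) u)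
            rw [Prod.snd_add, hu] at hadd
            exact (h2 (hp u) (by linarith)).2 hadd
        refine ⟨hlt, ?_⟩
        rw [mem_hitSet_shiftPath_iff hω _ (sub_pos.2 hlt), add_sub_cancel]
        exact hmem
    _ = _ := e
    _ ≤ ∫⁻ ω, c * {ω | (path Z Y ω (passTime (path Z Y ω) v)).2 < u}.indicator 1 ω ∂P := by
        refine lintegral_mono_ae ?_
        filter_upwards [ae_isRegularPath h, hpass] with ω hω hp
        by_cases hlt : (path Z Y ω (passTime (path Z Y ω) v)).2 < u
        · have hm : ω ∈ {ω | (path Z Y ω (passTime (path Z Y ω) v)).2 < u} := hlt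
          rw [indicator_of_mem hm, Pi.one_apply, mul_one]
          refine le_trans (measure_mono fun ω' hω' => hω'.2) (hc _ (sub_pos.2 hlt) ?_)
          have := hω.le_passValue hp
          change u - (path Z Y ω (passTime (path Z Y ω) v)).2 ≤ u - v
          linarith
        · exact (measure_mono_null (fun ω' hω' => hlt hω'.1) measure_empty).le.trans zero_le
    _ = c * P {ω | (path Z Y ω (passTime (path Z Y ω) v)).2 < u} := by
        have hnm : NullMeasurableSet {ω | (path Z Y ω (passTime (path Z Y ω) v)).2 < u} P :=
          nullMeasurableSet_lt (aemeasurable_shiftPath h hv hpass).fst.snd aemeasurable_const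
        rw [lintegral_const_mul'' _ (AEMeasurable.indicator₀ (f := 1) aemeasurable_const hnm),
          lintegral_indicator_one₀ hnm]

end Subordinator

end Polarity

section Polarity

variable {Ω : Type*} [MeasurableSpace Ω] {P : Measure Ω} [IsProbabilityMeasure P]
  {Z Y : ℝ≥0 → Ω → ℝ} {q dZ dY : ℝ} {ν : Measure (ℝ × ℝ)}

namespace Subordinator

/-- If the values at the passages over levels `v n` increasing to `u` are all below `u`, they
converge to `u`, which is then in the closed range. -/
lemma tendsto_measure_passValue_lt (h : IsBivariateSubordinator P Z Y)
    (hY : P {ω | Y 1 ω = 0} = 0) {u : ℝ} {v : ℕ → ℝ} (hv0 : ∀ n, 0 ≤ v n)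
    (hmono : Monotone v) (hlim : Tendsto v atTop (𝓝 u)) :
    ∃ c ≤ hitProb P Z Y u, Tendsto
      (fun n => P {ω | (path Z Y ω (passTime (path Z Y ω) (v n))).2 < u}) atTop (𝓝 c) := by
  have hall := ae_passes h (laplaceExponent_pos h hY)
  have hnm : ∀ n, NullMeasurableSet {ω | (path Z Y ω (passTime (path Z Y ω) (v n))).2 < u} P :=
    fun n => nullMeasurableSet_lt (aemeasurable_shiftPath h (hv0 n)
      (hall.mono fun ω hω => hω (v n))).fst.snd aemeasurable_const
  refine ⟨P (⋂ n, {ω | (path Z Y ω (passTime (path Z Y ω) (v n))).2 < u}), ?_, ?_⟩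
  · refine measure_mono_ae ?_
    filter_upwards [ae_isRegularPath h, hall] with ω hω hp hmem
    have hlt : ∀ n, (path Z Y ω (passTime (path Z Y ω) (v n))).2 < u := fun n =>
      mem_iInter.1
        (show ω ∈ ⋂ n, {ω | (path Z Y ω (passTime (path Z Y ω) (v n))).2 < u} from hmem) n
    have hlim' : Tendsto (fun n => (path Z Y ω (passTime (path Z Y ω) (v n))).2) atTop (𝓝 u) :=
      tendsto_of_tendsto_of_tendsto_of_le_of_le hlim tendsto_const_nhds
        (fun n => hω.le_passValue (hp _)) fun n => (hlt n).le
    exact isClosed_closure.mem_of_tendsto hlim' (Eventually.of_forall fun n => mem_hitSet hω _)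
  · refine (tendsto_measure_iInter_le hnm ⟨0, measure_ne_top _ _⟩).congr fun n => ?_
    refine measure_congr ?_
    filter_upwards [ae_isRegularPath h, hall] with ω hω hp
    refine propext ⟨fun hmem => mem_iInter₂.1 hmem n le_rfl, fun hmem => ?_⟩
    refine mem_iInter₂.2 fun j hj => ?_
    exact (hω.mono_snd (passTime_mono (hp _) (hmono hj))).trans_lt hmem

/-- If some level is hit with positive probability, then arbitrarily small levels are hit with
probability close to `1`. -/
lemma exists_hitProb_gt (h : IsBivariateSubordinator P Z Y)
    (hν : HasDriftAndLevyMeasure P Z Y q dZ dY ν) (hq : 0 ≤ q) (hY : P {ω | Y 1 ω = 0} = 0)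
    {u : ℝ} (hu : 0 < u) (hpos : hitProb P Z Y u ≠ 0) {δ : ℝ} (hδ : 0 < δ) {c : ℝ≥0∞}
    (hc : c < 1) : ∃ x, 0 < x ∧ x < δ ∧ c < hitProb P Z Y x := by
  by_contra! hcon
  let m := min u δ / 2
  have hm : 0 < m := half_pos (lt_min hu hδ)
  have hmu : m ≤ u := (half_le_self (lt_min hu hδ).le).trans (min_le_left _ _)
  have hmδ : m < δ := (half_lt_self (lt_min hu hδ)).trans_le (min_le_right _ _)
  let v : ℕ → ℝ := fun n => u - m * (1 / ((n : ℝ) + 1))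
  have hfrac : ∀ n : ℕ, 0 < 1 / ((n : ℝ) + 1) ∧ 1 / ((n : ℝ) + 1) ≤ 1 := fun n =>
    ⟨by positivity, by rw [div_le_one (by positivity)]; linarith [(Nat.cast_nonneg n : (0:ℝ) ≤ n)]⟩
  have hv0 : ∀ n, 0 ≤ v n := fun n => by
    have := mul_le_mul_of_nonneg_left (hfrac n).2 hm.le
    simp only [v]; linarith
  have hvu : ∀ n, v n < u := fun n => by
    have := mul_pos hm (hfrac n).1
    simp only [v]; linarith
  have hmono : Monotone v := fun i j hij => by
    have : 1 / ((j : ℝ) + 1) ≤ 1 / ((i : ℝ) + 1) := by gcongr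
    have := mul_le_mul_of_nonneg_left this hm.le
    simp only [v]; linarith
  have hlim : Tendsto v atTop (𝓝 u) := by
    have := (tendsto_one_div_add_atTop_nhds_zero_nat (𝕜 := ℝ)).const_mul m
    simpa [v] using tendsto_const_nhds.sub this
  obtain ⟨b, hb, hlim'⟩ := tendsto_measure_passValue_lt h hY hv0 hmono hlim
  have hle : ∀ n, hitProb P Z Y u ≤
      c * P {ω | (path Z Y ω (passTime (path Z Y ω) (v n))).2 < u} := fun n =>
    hitProb_le_mul h hν hq hY (hv0 n) (hvu n) fun x hx0 hx => hcon x hx0 (by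
      have := mul_le_mul_of_nonneg_left (hfrac n).2 hm.le
      simp only [v] at hx; linarith)
  have hctop : c ≠ ∞ := (hc.trans ENNReal.one_lt_top).ne
  have h1 : hitProb P Z Y u ≤ c * b :=
    ge_of_tendsto' (ENNReal.Tendsto.const_mul hlim' (Or.inr hctop)) hle
  have h2 : c * hitProb P Z Y u < 1 * hitProb P Z Y u := by
    gcongr
    exact measure_ne_top _ _
  rw [one_mul] at h2
  exact absurd (h1.trans (mul_le_mul_right hb c)) (not_le.2 h2)

/-- The probability of hitting a level is upper semicontinuous. -/
lemma le_hitProb_of_tendsto (h : IsBivariateSubordinator P Z Y) {y : ℝ} {v : ℕ → ℝ}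
    (hv : Tendsto v atTop (𝓝 y)) {c : ℝ≥0∞} (hc : ∀ n, c ≤ hitProb P Z Y (v n)) :
    c ≤ hitProb P Z Y y := by
  let A : ℕ → Set Ω := fun n => {ω | v n ∈ hitSet fun s : ℚ≥0 => path Z Y ω s}
  have hA : ∀ n, MeasurableSet (⋃ m ≥ n, A m) := fun n =>
    MeasurableSet.iUnion fun m => MeasurableSet.iUnion fun _ => measurableSet_mem_hitSet h _
  have hanti : Antitone fun n => ⋃ m ≥ n, A m := fun i j hij =>
    biUnion_subset_biUnion_left fun m hm => le_trans hij hm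
  have hlim := tendsto_measure_iInter_atTop (μ := P) (fun n => (hA n).nullMeasurableSet) hanti
    ⟨0, measure_ne_top _ _⟩
  refine (ge_of_tendsto' hlim fun n => ?_).trans (measure_mono fun ω hω => ?_)
  · exact (hc n).trans (measure_mono (subset_biUnion_of_mem (u := A) (show n ∈ {m | m ≥ n} from
      le_refl n)))
  · change y ∈ hitSet fun s : ℚ≥0 => path Z Y ω s
    refine IsClosed.mem_of_frequently_of_tendsto isClosed_closure ?_ hv
    rw [frequently_atTop]
    intro n
    obtain ⟨m, hm, hmem⟩ := mem_iUnion₂.1 (mem_iInter.1 hω n)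
    exact ⟨m, hm, hmem⟩

/-- Without drift, almost every level is hit with probability zero. -/
lemma ae_hitProb_eq_zero (h : IsBivariateSubordinator P Z Y)
    (hν : HasDriftAndLevyMeasure P Z Y q dZ 0 ν) (hq : 0 ≤ q) (hY : P {ω | Y 1 ω = 0} = 0) :
    ∀ᵐ v : ℝ ∂volume.restrict (Ioi 0), hitProb P Z Y v = 0 := by
  have hpos := laplaceExponent_pos h hY
  have e := lintegral_creepMass h hν hq hpos MeasurableSet.univ MeasurableSet.univ
  simp only [indicator_univ, Pi.one_apply, one_mul, ENNReal.ofReal_zero, zero_mul] at e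
  rw [lintegral_eq_zero_iff' (aemeasurable_creepMass h MeasurableSet.univ)] at e
  filter_upwards [e, ae_restrict_mem measurableSet_Ioi] with v hv hv0
  have hv0' : 0 ≤ v := le_of_lt hv0
  rw [Pi.zero_apply, creepMass, lintegral_eq_zero_iff' (aemeasurable_passWeight_mul h hv0'
    (measurable_one.indicator (measurableSet_creepSet MeasurableSet.univ v)))] at hv
  have : ∀ᵐ ω ∂P, ¬ (v ∈ hitSet fun s : ℚ≥0 => path Z Y ω s) := by
    filter_upwards [hv, ae_mem_hitSet_iff h hν hq hY hv0', ae_passes h hpos] with ω h1 h2 hp hmem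
    have h3 : (prePassage (path Z Y ω) v, passJump (path Z Y ω) v) ∈ creepSet univ v := by
      refine ⟨mem_univ _, ?_⟩
      have hadd := congrArg Prod.snd (IsRegularPath.prePassage_add_passJump (path Z Y ω) v)
      rw [Prod.snd_add, h2.1 hmem] at hadd
      exact hadd.le
    rw [indicator_of_mem h3, Pi.one_apply, mul_one, passWeight, if_pos (hp v)] at h1
    exact absurd (Real.exp_pos _) (not_lt.2 (ENNReal.ofReal_eq_zero.1 h1))
  rw [ae_iff] at this
  simpa only [not_not, hitProb] using this

/-- The numbers `p(a)` avoid an interval: if the level `x` is hit with probability close to one,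
then the levels below are hit either rarely or very often. -/
lemma hitProb_gap (h : IsBivariateSubordinator P Z Y)
    (hν : HasDriftAndLevyMeasure P Z Y q dZ dY ν) (hq : 0 ≤ q) (hY : P {ω | Y 1 ω = 0} = 0)
    {a x : ℝ} (ha : 0 < a) (hax : a < x) (hx : 0.95 ≤ (hitProb P Z Y x).toReal)
    (h4 : 0.25 ≤ (hitProb P Z Y a).toReal) : 0.9 ≤ (hitProb P Z Y a).toReal := by
  have hle : ∀ v, (hitProb P Z Y v).toReal ≤ 1 := fun v =>
    ENNReal.toReal_mono ENNReal.one_ne_top prob_le_one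
  -- `P(A ∩ B) ≥ P(A) + P(B) - 1`, with the regenerative property for the left-hand side.
  have key : ∀ b, 0 < b → b < x → (hitProb P Z Y b).toReal + (hitProb P Z Y x).toReal - 1 ≤
      (hitProb P Z Y b).toReal * (hitProb P Z Y (x - b)).toReal := by
    intro b hb hbx
    have e := measure_hitSet_inter h hν hq hY hb.le (sub_pos.2 hbx)
    rw [add_sub_cancel] at e
    rw [← ENNReal.toReal_mul, ← e]
    have hu := measureReal_union_add_inter (μ := P)
      (s := {ω | b ∈ hitSet fun s : ℚ≥0 => path Z Y ω s}) (measurableSet_mem_hitSet h x)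
    have hu1 := measureReal_le_one (μ := P)
      (s := {ω | b ∈ hitSet fun s : ℚ≥0 => path Z Y ω s} ∪
        {ω | x ∈ hitSet fun s : ℚ≥0 => path Z Y ω s})
    simp only [measureReal_def] at hu hu1
    change _ ≤ (P _).toReal
    simp only [hitProb]
    linarith
  have k1 := key a ha hax
  have k2 := key (x - a) (sub_pos.2 hax) (by linarith)
  rw [sub_sub_cancel] at k2
  set A := (hitProb P Z Y a).toReal
  set B := (hitProb P Z Y (x - a)).toReal
  have hA := hle a
  have hB := hle (x - a)
  have hB8 : 0.8 ≤ B := by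
    by_contra! hc
    nlinarith
  nlinarith

/-- **A subordinator without drift does not hit fixed levels.** If it did, small levels would be
hit with probability close to `1`, and walking along multiples of such a level, without ever
entering the forbidden interval of probabilities, every level in an interval would be hit with
probability bounded below. -/
theorem hitProb_eq_zero (h : IsBivariateSubordinator P Z Y)
    (hν : HasDriftAndLevyMeasure P Z Y q dZ 0 ν) (hq : 0 ≤ q) (hY : P {ω | Y 1 ω = 0} = 0)
    {u : ℝ} (hu : 0 < u) : hitProb P Z Y u = 0 := by
  by_contra hne
  have htop : ∀ v, hitProb P Z Y v ≠ ∞ := fun v => measure_ne_top _ _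
  have hsmall : ∀ δ : ℝ, 0 < δ → ∃ x, 0 < x ∧ x < δ ∧ 0.95 ≤ (hitProb P Z Y x).toReal := by
    intro δ hδ
    obtain ⟨x, hx0, hxδ, hx⟩ := exists_hitProb_gt h hν hq hY hu hne hδ
      (c := ENNReal.ofReal 0.95) (by rw [ENNReal.ofReal_lt_one]; norm_num)
    exact ⟨x, hx0, hxδ, (ENNReal.ofReal_le_iff_le_toReal (htop x)).1 hx.le⟩
  obtain ⟨x, hx0, -, hx⟩ := hsmall 1 one_pos
  have hwalk : ∀ z, 0 < z → 0.95 ≤ (hitProb P Z Y z).toReal → ∀ k : ℕ, (k + 1) * z < x →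
      0.9 ≤ (hitProb P Z Y ((k + 1) * z)).toReal := by
    intro z hz hpz k
    induction k with
    | zero =>
      intro _
      rw [Nat.cast_zero, zero_add, one_mul]
      linarith
    | succ k ih =>
      intro hk
      push_cast at hk ⊢
      have h1 := ih (by linarith)
      have hk0 : 0 < ((k : ℝ) + 1) * z := by positivity
      refine hitProb_gap h hν hq hY (by positivity) hk hx ?_
      have e := measure_hitSet_inter h hν hq hY hk0.le hz
      have h2 : (hitProb P Z Y ((k + 1) * z)).toReal * (hitProb P Z Y z).toReal ≤
          (hitProb P Z Y ((k + 1) * z + z)).toReal := by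
        rw [← ENNReal.toReal_mul, ← e]
        exact ENNReal.toReal_mono (htop _) (measure_mono inter_subset_right)
      have h3 : ((k : ℝ) + 1 + 1) * z = (k + 1) * z + z := by ring
      rw [h3]
      nlinarith
  have hall : ∀ y, 0 < y → y < x → ENNReal.ofReal 0.9 ≤ hitProb P Z Y y := by
    intro y hy hyx
    choose z hz0 hz1 hz using fun n : ℕ => hsmall (min y (1 / ((n : ℝ) + 1)))
      (lt_min hy (by positivity))
    -- the multiple `(k + 1) z` of the step `z` just below `y`
    let k : ℕ → ℕ := fun n => ⌊y / z n⌋₊ - 1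
    have hk : ∀ n, ((k n : ℝ) + 1) = ⌊y / z n⌋₊ := fun n => by
      have : 1 ≤ ⌊y / z n⌋₊ := by
        rw [Nat.one_le_floor_iff, le_div_iff₀ (hz0 n), one_mul]
        exact ((hz1 n).trans_le (min_le_left _ _)).le
      simp only [k]
      push_cast [Nat.cast_sub this]
      ring
    have hup : ∀ n, ((k n : ℝ) + 1) * z n ≤ y := fun n => by
      rw [hk, ← le_div_iff₀ (hz0 n)]
      exact Nat.floor_le (div_nonneg hy.le (hz0 n).le)
    have hlow : ∀ n : ℕ, y - 1 / ((n : ℝ) + 1) ≤ ((k n : ℝ) + 1) * z n := fun n => by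
      have h1 := Nat.lt_floor_add_one (y / z n)
      rw [← hk, div_lt_iff₀ (hz0 n)] at h1
      have h2 := (hz1 n).trans_le (min_le_right _ _)
      linarith
    have hlim : Tendsto (fun n => ((k n : ℝ) + 1) * z n) atTop (𝓝 y) := by
      refine tendsto_of_tendsto_of_tendsto_of_le_of_le ?_ tendsto_const_nhds hlow hup
      simpa using tendsto_const_nhds.sub (tendsto_one_div_add_atTop_nhds_zero_nat (𝕜 := ℝ))
    refine le_hitProb_of_tendsto h hlim fun n => ?_
    rw [ENNReal.ofReal_le_iff_le_toReal (htop _)]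
    exact hwalk (z n) (hz0 n) (hz n) (k n) ((hup n).trans_lt hyx)
  have hnull : volume (Ioo 0 x) = 0 := by
    have hae := ae_hitProb_eq_zero h hν hq hY
    rw [ae_restrict_iff' measurableSet_Ioi, ae_iff] at hae
    refine measure_mono_null (fun y hy => ?_) hae
    intro hc
    have h0 := hc hy.1
    have h1 := hall y hy.1 hy.2
    rw [h0, nonpos_iff_eq_zero, ENNReal.ofReal_eq_zero] at h1
    norm_num at h1
  rw [Real.volume_Ioo, sub_zero, ENNReal.ofReal_eq_zero] at hnull
  exact absurd hx0 (not_lt.2 hnull)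

/-- Without drift, the passage over a fixed level is by a jump across it. -/
theorem ae_passValue_ne (h : IsBivariateSubordinator P Z Y)
    (hν : HasDriftAndLevyMeasure P Z Y q dZ 0 ν) (hq : 0 ≤ q) {u : ℝ} (hu : 0 < u) :
    ∀ᵐ ω ∂P, Passes (path Z Y ω) u → (path Z Y ω (passTime (path Z Y ω) u)).2 ≠ u := by
  by_cases hY : P {ω | Y 1 ω = 0} = 0
  · have h0 : ∀ᵐ ω ∂P, ¬ (u ∈ hitSet fun s : ℚ≥0 => path Z Y ω s) := by
      rw [ae_iff]
      simpa only [not_not, hitProb] using hitProb_eq_zero h hν hq hY hu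
    filter_upwards [h0, ae_mem_hitSet_iff h hν hq hY hu.le] with ω h1 h2 _ hc
    exact h1 (h2.2 hc)
  · exact ae_passValue_ne_of_flat h hY hu.le

end Subordinator

end Polarity

end QuadrupleLaw

theorem theorem4p4 {Ω : Type*} [MeasurableSpace Ω] (P : Measure Ω) [IsProbabilityMeasure P]
    (Z Y : ℝ≥0 → Ω → ℝ) (hZY : IsBivariateSubordinator P Z Y)
    (q : ℝ) (hq : 0 ≤ q) (e : Ω → ℝ≥0∞) (he : IsExponentialTime P q e)
    (hindep : IndepFun e (fun ω (s : ℝ≥0) => (Z s ω, Y s ω)) P)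
    (dZ dY : ℝ) (ν : Measure (ℝ × ℝ)) (hν : HasDriftAndLevyMeasure P Z Y q dZ dY ν)
    (u : ℝ) (hu : 0 < u) :
    (dY = 0 → ∀ B : Set (ℝ × ℝ × ℝ × ℝ), MeasurableSet B →
      P {ω | passageQuadruple Z Y u ω ∈ B ∧ passageTime Y u ω < e ω} =
        jumpTerm P Z Y q ν u B) ∧
    (0 < dY → ∃ μ : Measure ℝ, IsLeftDerivRenewal P Z Y q u μ ∧
      ∀ B : Set (ℝ × ℝ × ℝ × ℝ), MeasurableSet B →
        P {ω | passageQuadruple Z Y u ω ∈ B ∧ passageTime Y u ω < e ω} =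
          jumpTerm P Z Y q ν u B +
            ENNReal.ofReal dY * μ {t | ((0 : ℝ), (0 : ℝ), (0 : ℝ), t) ∈ B}) := by
  open QuadrupleLaw QuadrupleLaw.Subordinator in
  have hlaw := fun B (hB : MeasurableSet B) => measure_passage_eq hZY hν hq he hindep hu.le hB
  constructor
  · rintro rfl B hB
    refine (hlaw B hB).trans ?_
    conv_rhs => rw [← add_zero (jumpTerm P Z Y q ν u B)]
    congr 1
    refine lintegral_eq_zero_of_ae_eq_zero ?_
    -- Without drift no path contributes that is at `u` at the passage.
    filter_upwards [ae_passValue_ne hZY hν hq hu] with ω hω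
    by_cases hp : Passes (path Z Y ω) u
    · refine mul_eq_zero_of_right _ (indicator_of_notMem (fun hc => hω hp ?_) _)
      have hadd := congrArg Prod.snd (IsRegularPath.prePassage_add_passJump (path Z Y ω) u)
      rw [Prod.snd_add] at hadd
      exact hadd.symm.trans hc.1
    · simp [passWeight, hp]
  · intro hd
    have hY := measure_eq_zero_of_drift_pos hZY hν hd
    have hκ : 0 < q + laplaceExponent P Z Y 0 1 := by
      have := laplaceExponent_pos hZY hY
      linarith
    obtain ⟨μ, hfin, hμ⟩ := exists_measure_eq_creepMass hZY hq hu.le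
    have hd0 : ENNReal.ofReal dY ≠ 0 := (ENNReal.ofReal_pos.2 hd).ne'
    -- The derivative is the creep mass `μ` divided by the drift, so the drift in the claim cancels.
    refine ⟨(ENNReal.ofReal dY)⁻¹ • μ, ⟨fun t v => ?_, ?_, fun t => ?_⟩, fun B hB => ?_⟩
    · rw [← renewalMeasure_Iic P Z Y hZY]
      exact renewalMeasure_prod_Iic_lt_top hZY hκ _ v
    · exact μ.smul_finite (ENNReal.inv_ne_top.2 hd0)
    · simp_rw [← renewalMeasure_Iic P Z Y hZY]
      have h1 := hasDerivWithinAt_renewal hZY hν hq hd hu t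
      rwa [← hμ _ measurableSet_Iic, ← ENNReal.toReal_ofReal hd.le, ← ENNReal.toReal_inv,
        ← ENNReal.toReal_mul] at h1
    · have hA : MeasurableSet {t : ℝ | ((0 : ℝ), (0 : ℝ), (0 : ℝ), t) ∈ B} := by
        have : Measurable fun t : ℝ => ((0 : ℝ), (0 : ℝ), (0 : ℝ), t) := by fun_prop
        exact this hB
      rw [hlaw B hB, Measure.smul_apply, smul_eq_mul, ← mul_assoc,
        ENNReal.mul_inv_cancel hd0 ENNReal.ofReal_ne_top, one_mul, hμ _ hA]
      congr 1
      -- On the paths that are at `u` at the passage, the quadruple is `(0, 0, 0, Z_{T-})`.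
      refine lintegral_congr_ae ?_
      filter_upwards [ae_creep hZY hν hq hY hu.le, ae_isRegularPath hZY] with ω h1 hω
      by_cases hp : Passes (path Z Y ω) u
      · congr 1
        have h2 := hω.le_prePassage_add_passJump_snd hp
        by_cases hc : (prePassage (path Z Y ω) u).2 + (passJump (path Z Y ω) u).2 = u
        · obtain ⟨e1, e2⟩ := h1 hp hc
          have hiff : ((prePassage (path Z Y ω) u, passJump (path Z Y ω) u) ∈
              {x : (ℝ × ℝ) × (ℝ × ℝ) | x.1.2 + x.2.2 = u ∧ quadruple u x ∈ B}) ↔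
              (prePassage (path Z Y ω) u, passJump (path Z Y ω) u) ∈
                creepSet {t : ℝ | ((0 : ℝ), (0 : ℝ), (0 : ℝ), t) ∈ B} u := by
            have hquad : quadruple u (prePassage (path Z Y ω) u, passJump (path Z Y ω) u) =
                (0, 0, 0, (prePassage (path Z Y ω) u).1) := by
              simp only [quadruple, e1, sub_self, e2, Prod.fst_zero, Prod.snd_zero, add_zero]
            change (_ = u ∧ quadruple u _ ∈ B) ↔ ((0, 0, 0, (prePassage (path Z Y ω) u).1) ∈ B ∧ _)
            rw [hquad]
            exact ⟨fun h3 => ⟨h3.2, hc.le⟩, fun h3 => ⟨hc, h3.1⟩⟩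
          by_cases hm : (prePassage (path Z Y ω) u, passJump (path Z Y ω) u) ∈
              creepSet {t : ℝ | ((0 : ℝ), (0 : ℝ), (0 : ℝ), t) ∈ B} u
          · rw [indicator_of_mem hm, indicator_of_mem (hiff.2 hm)]
          · rw [indicator_of_notMem hm, indicator_of_notMem fun h3 => hm (hiff.1 h3)]
        · have h3 : ¬ (prePassage (path Z Y ω) u).2 + (passJump (path Z Y ω) u).2 ≤ u :=
            fun h4 => hc (le_antisymm h4 h2)
          simp [indicator, creepSet, hc, h3]
      · simp [passWeight, hp]
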